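/- Let $M$ be a connected (Hausdorff) smooth manifold of dimension $n\ge 2$, $\pi:TM\to M$ its tangent bundle, $\mathcal TM\subset TM$ the set of nonzero tangent vectors, $\mathcal V=\ker d\pi$ the vertical distribution, $J=\frac{\partial}{\partial y^i}\otimes dx^i$ the natural almost-tangent structure and $\mathcal C=y^i\frac{\partial}{\partial y^i}$ the Liouville field. All vector fields below are smooth vector fields on $\mathcal TM$. A spray is a vector field $S$ with $JS=\mathcal C$ and $[\mathcal C,S]=S$. Put $[J,S]X=[JX,S]-J[X,S]$ and let $h=\frac12(\mathrm{Id}+[J,S])$, $v=\frac12(\mathrm{Id}-[J,S])$ be the horizontal and vertical projectors of $S$; $X$ is horizontal if $hX=X$. The holonomy distribution $\mathcal Hol$ of $S$ is the distribution on $\mathcal TM$ spanned at each point by the values of all iterated brackets $[X_1,[X_2,\dots,[X_{m-1},X_m]\dots]]$, $m\ge1$, of horizontal fields; it is regular if it has constant rank. Its vertical part is $\mathcal V_{\mathcal Hol}=\mathcal Hol\cap\mathcal V$. A Finsler function is a continuous $F:TM\to\mathbb R$ that is smooth and positive on $\mathcal TM$, with $\mathcal L_{\mathcal C}F=F$ there,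 such that for $E=\frac12F^2$ the matrix $\frac{\partial^2E}{\partial y^i\partial y^j}$ is nondegenerate on $\mathcal TM$. It metrizes $S$ if $i_S\,dd_JE-d(E-\mathcal L_{\mathcal C}E)=0$ on $\mathcal TM$. An energy function of $S$ on an open set $U\subseteq\mathcal TM$ is a smooth positive function $E$ on $U$ with $\mathcal L_{\mathcal C}E=2E$, with $\frac{\partial^2E}{\partial y^i\partial y^j}$ nondegenerate on $U$, and with $dE$ vanishing on $\mathcal Hol$. The spray $S$ has metrizability freedom $m$ if every $v_0\in\mathcal TM$ has an open neighbourhood $U\subseteq\mathcal TM$ with energy functions $E_1,\dots,E_m$ of $S$ on $U$ whose differentials are linearly independent at each point of $U$, such that every energy function $E$ of $S$ on a neighbourhood of $v_0$ has the form $E=\varphi(E_1,\dots,E_m)$ near $v_0$ for some function $\varphi:\mathbb R^m\to\mathbb R$. For a smooth, nowhere zero function $\mathcal P:\mathcal TM\to\mathbb R$, positively homogeneous of degree one, let $v_{\mathcal P}=v-\frac{d_v\mathcal P}{\mathcal P}\otimes\mathcal C$, where $d_v\mathcal P(X)=d\mathcal P(vX)$, and $\mathcal V_{\mathcal P}=\operatorname{Im}v_{\mathcal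 P}$. **Theorem.** Let $S$ be a spray on $M$ with regular holonomy distribution and metrizability freedom $1$, and let $F$ be a Finsler function that metrizes $S$. Then for every smooth, nowhere zero function $\mathcal P:\mathcal TM\to\mathbb R$ that is positively homogeneous of degree one ($\mathcal P(\lambda u)=\lambda\mathcal P(u)$ for $\lambda>0$) and $S$-invariant ($\mathcal L_S\mathcal P=0$), one has $\mathcal V_{\mathcal Hol}=\mathcal V_{\mathcal P}$ on $\mathcal TM$ if and only if there is a constant $c\in\mathbb R\setminus\{0\}$ with $F=c\mathcal P$ on $\mathcal TM$. -/

import Mathlib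

open scoped Manifold ContDiff

attribute [-instance] TopCat.of.chartedSpace

noncomputable section

namespace SprayGeometry

variable {n : ℕ} {M : Type*} [TopologicalSpace M]
  [ChartedSpace (EuclideanSpace ℝ (Fin n)) M] [IsManifold (𝓡 n) ∞ M]

/-- The total space `TM` of the tangent bundle of an `n`-dimensional manifold `M`. -/
abbrev TM (n : ℕ) (M : Type*) [TopologicalSpace M]
    [ChartedSpace (EuclideanSpace ℝ (Fin n)) M] [IsManifold (𝓡 n) ∞ M] : Type _ :=
  TangentBundle (𝓡 n) M

/-- The tangent space `T_u(TM)`. -/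
abbrev TTM (u : TM n M) : Type _ := TangentSpace (𝓡 n).tangent u

/-- The set `𝒯M` of nonzero tangent vectors. -/
def slit (n : ℕ) (M : Type*) [TopologicalSpace M]
    [ChartedSpace (EuclideanSpace ℝ (Fin n)) M] [IsManifold (𝓡 n) ∞ M] : Set (TM n M) :=
  {u | u.2 ≠ 0}

/-- A function on `TM` or on `𝒯M`, smooth on the open set `U`. -/
def SmoothFunOn (f : TM n M → ℝ) (U : Set (TM n M)) : Prop :=
  ContMDiffOn (𝓡 n).tangent 𝓘(ℝ, ℝ) ∞ f U

/-- The differential `df_u(ξ)` of a real function on `TM`. -/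
def diff (f : TM n M → ℝ) (u : TM n M) : TTM u →ₗ[ℝ] ℝ :=
  (mfderiv (𝓡 n).tangent 𝓘(ℝ, ℝ) f u).toLinearMap

/-- Smooth vector fields on `𝒯M`. They are encoded as fields on `TM`; what they are on the zero
section is never used. -/
def IsSmoothField (X : ∀ u : TM n M, TTM u) : Prop :=
  ContMDiffOn (𝓡 n).tangent (𝓡 n).tangent.tangent ∞
    (fun u ↦ (⟨u, X u⟩ : TangentBundle (𝓡 n).tangent (TM n M))) (slit n M)

/-- The Lie bracket of vector fields on `TM`. -/
def bracket (X Y : ∀ u : TM n M, TTM u) : ∀ u : TM n M, TTM u :=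
  VectorField.mlieBracket (𝓡 n).tangent X Y

/-- The differential `T_u(TM) → T_xM` of the projection `π : TM → M`, where `x = π u`. -/
def dproj (u : TM n M) : TTM u →ₗ[ℝ] TangentSpace (𝓡 n) u.proj :=
  (mfderiv (𝓡 n).tangent (𝓡 n) (Bundle.TotalSpace.proj : TM n M → M) u).toLinearMap

/-- The vector `y ∈ T_xM` of a point `u = (x, y)` of `TM`, as an element of `ℝⁿ`, which is what
`T_xM` is in Mathlib. -/
def vec (u : TM n M) : EuclideanSpace ℝ (Fin n) := u.2

/-- The vertical lift `T_xM → T_u(TM)`, where `x = π u`: the differential at `u` of the inclusion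
of the fibre `T_xM` into `TM`. -/
def vlift (u : TM n M) : TangentSpace (𝓡 n) u.proj →ₗ[ℝ] TTM u :=
  (mfderiv 𝓘(ℝ, EuclideanSpace ℝ (Fin n)) (𝓡 n).tangent
    (fun w : EuclideanSpace ℝ (Fin n) ↦ (⟨u.proj, w⟩ : TM n M)) (vec u)).toLinearMap

/-- The vertical space `𝒱_u = ker dπ_u`. -/
def Vert (u : TM n M) : Submodule ℝ (TTM u) := LinearMap.ker (dproj u)

/-- The natural almost-tangent structure `J = ∂/∂yⁱ ⊗ dxⁱ`. -/
def J (u : TM n M) : TTM u →ₗ[ℝ] TTM u := vlift u ∘ₗ dproj u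

/-- The field `J X`. -/
def Jfield (X : ∀ u : TM n M, TTM u) : ∀ u : TM n M, TTM u := fun u ↦ J u (X u)

/-- The Liouville vector field `C = yⁱ ∂/∂yⁱ`. -/
def liouville : ∀ u : TM n M, TTM u := fun u ↦ vlift u u.2

/-- `S` is a spray: a smooth vector field on `𝒯M` with `J S = C` and `[C, S] = S`. -/
structure IsSpray (S : ∀ u : TM n M, TTM u) : Prop where
  smooth : IsSmoothField S
  J_eq : ∀ u ∈ slit n M, J u (S u) = liouville u
  bracket_eq : ∀ u ∈ slit n M, bracket liouville S u = S u

/-- The vector-valued one-form `Γ = [J, S]`: `[J, S] X = [J X, S] - J [X, S]`. -/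
def Gam (S X : ∀ u : TM n M, TTM u) : ∀ u : TM n M, TTM u :=
  fun u ↦ bracket (Jfield X) S u - J u (bracket X S u)

/-- The horizontal projector `h = (Id + [J, S]) / 2` of the canonical connection of `S`. -/
def hproj (S X : ∀ u : TM n M, TTM u) : ∀ u : TM n M, TTM u :=
  fun u ↦ (1 / 2 : ℝ) • (X u + Gam S X u)

/-- The vertical projector `v = (Id - [J, S]) / 2` of the canonical connection of `S`. -/
def vproj (S X : ∀ u : TM n M, TTM u) : ∀ u : TM n M, TTM u :=
  fun u ↦ (1 / 2 : ℝ) • (X u - Gam S X u)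

/-- Horizontal vector fields on `𝒯M`. -/
def IsHorizontalField (S X : ∀ u : TM n M, TTM u) : Prop :=
  IsSmoothField X ∧ ∀ u ∈ slit n M, hproj S X u = X u

/-- Horizontal fields and their successive brackets `[X₁, [X₂, … [X_{m-1}, X_m] … ]]`. -/
inductive IsHolField (S : ∀ u : TM n M, TTM u) : (∀ u : TM n M, TTM u) → Prop
  | horizontal (X : ∀ u : TM n M, TTM u) (hX : IsHorizontalField S X) : IsHolField S X
  | bracket (X Y : ∀ u : TM n M, TTM u) (hX : IsHorizontalField S X) (hY : IsHolField S Y) :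
      IsHolField S (SprayGeometry.bracket X Y)

/-- The holonomy distribution of `S`, at the point `u`. -/
def Hol (S : ∀ u : TM n M, TTM u) (u : TM n M) : Submodule ℝ (TTM u) :=
  Submodule.span ℝ {ξ | ∃ Y : ∀ u : TM n M, TTM u, IsHolField S Y ∧ Y u = ξ}

/-- The holonomy distribution is regular: it has constant rank on `𝒯M`. -/
def HolRegular (S : ∀ u : TM n M, TTM u) : Prop :=
  ∃ r : ℕ, ∀ u ∈ slit n M, Module.finrank ℝ (Hol S u) = r

/-- The vertical part `𝒱_Hol` of the holonomy distribution. -/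
def VHol (S : ∀ u : TM n M, TTM u) (u : TM n M) : Submodule ℝ (TTM u) := Hol S u ⊓ Vert u

/-- The endomorphism `v_P = v - (d_v P / P) ⊗ C` attached to a nowhere zero function `P`,
homogeneous of degree one. -/
def vP (S : ∀ u : TM n M, TTM u) (P : TM n M → ℝ) (X : ∀ u : TM n M, TTM u) :
    ∀ u : TM n M, TTM u :=
  fun u ↦ vproj S X u - (diff P u (vproj S X u) / P u) • liouville u

/-- The distribution `𝒱_P = Im v_P`, at the point `u`. -/
def VP (S : ∀ u : TM n M, TTM u) (P : TM n M → ℝ) (u : TM n M) : Submodule ℝ (TTM u) :=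
  Submodule.span ℝ {ξ | ∃ X : ∀ u : TM n M, TTM u, IsSmoothField X ∧ vP S P X u = ξ}

/-- The matrix `∂²E/∂yⁱ∂yʲ` (the second derivative of `E` along the fibre) is nondegenerate
at `u`. -/
def IsRegularAt (E : TM n M → ℝ) (u : TM n M) : Prop :=
  ∀ a : EuclideanSpace ℝ (Fin n),
    (∀ b : EuclideanSpace ℝ (Fin n),
      fderiv ℝ (fderiv ℝ (fun w : EuclideanSpace ℝ (Fin n) ↦ E ⟨u.proj, w⟩)) (vec u) a b = 0) → a = 0

/-- The energy `E = F² / 2`. -/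
def energy (F : TM n M → ℝ) : TM n M → ℝ := fun u ↦ (1 / 2 : ℝ) * F u ^ 2

/-- `F` is a Finsler function on `M`. -/
structure IsFinsler (F : TM n M → ℝ) : Prop where
  continuous : Continuous F
  smooth : SmoothFunOn F (slit n M)
  pos : ∀ u ∈ slit n M, 0 < F u
  homogeneous : ∀ u ∈ slit n M, diff F u (liouville u) = F u
  regular : ∀ u ∈ slit n M, IsRegularAt (energy F) u

/-- The one-form `d_J E`: `d_J E (X) = dE (J X)`. -/
def dJ (E : TM n M → ℝ) (X : ∀ u : TM n M, TTM u) : TM n M → ℝ := fun u ↦ diff E u (J u (X u))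

/-- The two-form `d d_J E`:
`d d_J E (X, Y) = X (d_J E (Y)) - Y (d_J E (X)) - d_J E ([X, Y])`. -/
def ddJ (E : TM n M → ℝ) (X Y : ∀ u : TM n M, TTM u) : TM n M → ℝ :=
  fun u ↦ diff (dJ E Y) u (X u) - diff (dJ E X) u (Y u) - dJ E (bracket X Y) u

/-- `S` is the geodesic spray of `F`: with `E = F² / 2` one has
`i_S d d_J E - d (E - L_C E) = 0` on `𝒯M`. -/
def IsGeodesicSprayOf (S : ∀ u : TM n M, TTM u) (F : TM n M → ℝ) : Prop :=
  ∀ X : ∀ u : TM n M, TTM u, IsSmoothField X → ∀ u ∈ slit n M,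
    ddJ (energy F) S X u
      - diff (fun w ↦ energy F w - diff (energy F) w (liouville w)) u (X u) = 0

/-- `E` is an energy function of `S` on the open set `U ⊆ 𝒯M`: it is smooth, positive,
homogeneous of degree two, regular, and holonomy invariant (its differential vanishes on the
holonomy distribution of `S`). -/
structure IsEnergyFunctionOn (S : ∀ u : TM n M, TTM u) (E : TM n M → ℝ)
    (U : Set (TM n M)) : Prop where
  smooth : SmoothFunOn E U
  pos : ∀ u ∈ U, 0 < E u
  homogeneous : ∀ u ∈ U, diff E u (liouville u) = 2 * E u
  regular : ∀ u ∈ U, IsRegularAt E u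
  holInvariant : ∀ u ∈ U, ∀ ξ ∈ Hol S u, diff E u ξ = 0

/-- `S` has metrizability freedom `m`: near every `v₀ ∈ 𝒯M` there are `m` functionally
independent energy functions of `S`, and every energy function of `S` defined near `v₀` is,
near `v₀`, a function of them. -/
def HasMetrizabilityFreedom (S : ∀ u : TM n M, TTM u) (m : ℕ) : Prop :=
  ∀ v₀ ∈ slit n M, ∃ U : Set (TM n M), IsOpen U ∧ v₀ ∈ U ∧ U ⊆ slit n M ∧
    ∃ E : Fin m → TM n M → ℝ,
      (∀ i, IsEnergyFunctionOn S (E i) U) ∧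
      (∀ u ∈ U, LinearIndependent ℝ (fun i ↦ diff (E i) u)) ∧
      ∀ W : Set (TM n M), IsOpen W → v₀ ∈ W → W ⊆ slit n M →
        ∀ E' : TM n M → ℝ, IsEnergyFunctionOn S E' W →
          ∃ W' : Set (TM n M), IsOpen W' ∧ v₀ ∈ W' ∧ W' ⊆ U ∩ W ∧
            ∃ φ : (Fin m → ℝ) → ℝ, ∀ u ∈ W', E' u = φ (fun i ↦ E i u)

/-- `P` is positively homogeneous of degree one on `𝒯M`. -/
def IsHomogeneousOne (P : TM n M → ℝ) : Prop :=
  ∀ u ∈ slit n M, ∀ t : ℝ, 0 < t → P ⟨u.proj, t • u.2⟩ = t * P u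

/-- `P` is `S`-invariant: `L_S P = 0` on `𝒯M`. -/
def IsInvariant (S : ∀ u : TM n M, TTM u) (P : TM n M → ℝ) : Prop :=
  ∀ u ∈ slit n M, diff P u (S u) = 0

end SprayGeometry

end

-- Write E = F²/2. The Euler–Lagrange equations show that dE vanishes on horizontal fields
-- (`diff_energy_horizontal`). The bracket acts as a commutator of derivations, so dE, and with it
-- dF, vanishes on all of Hol. By Euler's identity dP(C) = P, the distribution V_P is V ∩ ker dP
-- (`VP_eq`).
--
-- From V_Hol = V_P to F = cP: for vertical ξ the vector ξ - (dP(ξ)/P) C lies in V_P = V_Hol, where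
-- dF vanishes. Since dF(C) = F, this gives P dF = F dP on V, so d(F/P) vanishes on V. It also
-- vanishes on S, because F and P are both S-invariant. As n ≥ 2, the punctured fibres are
-- connected, so F/P comes from the base. In a chart S = (y, *) with y an arbitrary nonzero vector,
-- so F/P is locally constant on the connected M (`exists_eq_const_of_diff_eq_zero`).
--
-- From F = cP to V_Hol = V_P: here ker dE = ker dP, so it suffices that Hol = ker dE
-- (`hol_eq_ker_diff`). The inclusion ⊆ is known and ker dE has rank 2n - 1. Suppose that Hol has
-- smaller rank r. Homogeneity of the spray makes the Lie derivative along C preserve horizontal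
-- fields, so Hol + ℝC is involutive of rank r + 1 < 2n. Frobenius' theorem gives a local θ with dθ
-- ≠ 0 at the given point, constant along Hol and C. For small ε ≠ 0, E(1 + εθ) is a second energy
-- function near that point. Metrizability freedom 1 forces the differentials of all energy
-- functions to vanish on one hyperplane complementary to C, whence dθ = 0, a contradiction.
--
-- Frobenius' theorem is proved by writing the distribution as the graphs of operators A and
-- following its leaves along rays to the transversal {0} × T (`exists_first_integral_of_graph`).
-- Smooth dependence on the end point is the implicit function theorem in a space of continuous
-- curves.

universe u

set_option linter.unusedSectionVars false

section

open Set Filter Topology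

/-! ### Superposition operators and the inverse function theorem -/

section Superposition

variable {K : Type*} [TopologicalSpace K] [CompactSpace K]
  {X Y : Type*} [NormedAddCommGroup X] [NormedSpace ℝ X] [NormedAddCommGroup Y] [NormedSpace ℝ Y]

/-- Pointwise application of a continuous family of operators, as a continuous bilinear map. -/
noncomputable def ContinuousMap.pointwiseApplyCLM (K X Y : Type*) [TopologicalSpace K]
    [CompactSpace K] [NormedAddCommGroup X] [NormedSpace ℝ X] [NormedAddCommGroup Y]
    [NormedSpace ℝ Y] : C(K, X →L[ℝ] Y) →L[ℝ] C(K, X) →L[ℝ] C(K, Y) :=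
  LinearMap.mkContinuous₂
    (LinearMap.mk₂ ℝ (fun (a : C(K, X →L[ℝ] Y)) (h : C(K, X)) ↦
        (⟨fun τ ↦ a τ (h τ), by fun_prop⟩ : C(K, Y)))
      (fun _ _ _ ↦ by ext; simp) (fun _ _ _ ↦ by ext; simp)
      (fun _ _ _ ↦ by ext; simp) (fun _ _ _ ↦ by ext; simp)) 1
    (fun a h ↦ by
      rw [ContinuousMap.norm_le _ (by positivity)]
      intro τ
      simp only [LinearMap.mk₂_apply, ContinuousMap.coe_mk, one_mul]
      exact (a τ).le_of_opNorm_le_of_le (a.norm_coe_le_norm τ) (h.norm_coe_le_norm τ))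

@[simp]
lemma ContinuousMap.pointwiseApplyCLM_apply (a : C(K, X →L[ℝ] Y)) (h : C(K, X)) (τ : K) :
    ContinuousMap.pointwiseApplyCLM K X Y a h τ = a τ (h τ) := rfl

/-- Post-composition with f' is continuous for the sup norm, so f' varies by at most c along all the
segments from z τ to z τ + h τ at once. The mean value inequality then bounds the remainder
uniformly in τ. -/
lemma ContinuousMap.hasFDerivAt_postcomp (f : C(X, Y)) (f' : C(X, X →L[ℝ] Y))
    (hf : ∀ x, HasFDerivAt f (f' x) x) (z : C(K, X)) :
    HasFDerivAt (fun z : C(K, X) ↦ f.comp z)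
      (ContinuousMap.pointwiseApplyCLM K X Y (f'.comp z)) z := by
  rw [hasFDerivAt_iff_isLittleO_nhds_zero, Asymptotics.isLittleO_iff]
  intro c hc
  have hcont : ContinuousAt (fun z : C(K, X) ↦ f'.comp z) z :=
    (ContinuousMap.continuous_postcomp f').continuousAt
  obtain ⟨δ, hδ, H⟩ := (Metric.continuousAt_iff (f := fun z : C(K, X) ↦ f'.comp z) (a := z)).1
    (by exact hcont) c hc
  filter_upwards [Metric.ball_mem_nhds (0 : C(K, X)) hδ] with h hh
  rw [ContinuousMap.norm_le _ (by positivity)]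
  intro τ
  have hseg : ∀ x ∈ segment ℝ (z τ) (z τ + h τ), ‖f' x - f' (z τ)‖ ≤ c := by
    intro x hx
    rw [segment_eq_image'] at hx
    obtain ⟨θ, hθ, rfl⟩ := hx
    have h1 : dist (z + θ • h) z < δ := by
      rw [dist_eq_norm, add_sub_cancel_left, norm_smul, Real.norm_of_nonneg hθ.1]
      rw [mem_ball_zero_iff] at hh
      exact lt_of_le_of_lt (mul_le_of_le_one_left (norm_nonneg _) hθ.2) hh
    have h2 := (ContinuousMap.dist_apply_le_dist
      (f := f'.comp (z + θ • h)) (g := f'.comp z) τ).trans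
      (H h1).le
    simpa [dist_eq_norm] using h2
  have := (convex_segment (𝕜 := ℝ) (z τ) (z τ + h τ)).norm_image_sub_le_of_norm_hasFDerivWithin_le'
    (f := f) (f' := f') (φ := f' (z τ)) (fun x _ ↦ (hf x).hasFDerivWithinAt) hseg
    (left_mem_segment ℝ _ _) (right_mem_segment ℝ _ _)
  simp only [add_sub_cancel_left] at this
  calc _ ≤ c * ‖h τ‖ := by simpa using this
    _ ≤ c * ‖h‖ := by gcongr; exact h.norm_coe_le_norm τ

/-- The superposition operator of a smooth map is smooth on spaces of continuous functions. -/
lemma ContDiff.postcomp_continuousMap {X Y : Type u} [NormedAddCommGroup X] [NormedSpace ℝ X]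
    [NormedAddCommGroup Y] [NormedSpace ℝ Y] {f : X → Y} (hf : ContDiff ℝ ∞ f) :
    ContDiff ℝ ∞ (fun z : C(K, X) ↦ (ContinuousMap.mk f hf.continuous).comp z) := by
  rw [contDiff_infty]
  intro n
  -- The target varies because the derivative is post-composition with `fderiv ℝ f`, whose values
  -- lie in X →L Y, followed by a continuous linear map. This is also why X and Y share a universe.
  induction n generalizing Y with
  | zero =>
    exact contDiff_zero.2 (ContinuousMap.continuous_postcomp _)
  | succ n ih =>
    have hf' : ContDiff ℝ ∞ (fderiv ℝ f) := hf.fderiv_right (by simp)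
    refine contDiff_succ_iff_hasFDerivAt.2 ⟨fun z ↦ ContinuousMap.pointwiseApplyCLM K X Y
      ((ContinuousMap.mk _ hf'.continuous).comp z), ?_, ?_⟩
    · exact (ContinuousLinearMap.contDiff _).comp (ih hf')
    · intro z
      exact ContinuousMap.hasFDerivAt_postcomp _ _
        (fun x ↦ (hf.differentiable (by simp) x).hasFDerivAt) z

end Superposition

/-- Inverse function theorem: the local inverse of a smooth map is smooth on a neighbourhood. -/
lemma ContDiff.exists_eventually_inverse {X Y : Type*} [NormedAddCommGroup X] [NormedSpace ℝ X]
    [CompleteSpace X] [NormedAddCommGroup Y] [NormedSpace ℝ Y] {G : X → Y} (hG : ContDiff ℝ ∞ G)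
    {a : X} (G' : X ≃L[ℝ] Y) (hG' : HasFDerivAt G (G' : X →L[ℝ] Y) a) :
    ∃ g : Y → X, g (G a) = a ∧ ∀ᶠ y in 𝓝 (G a), ContDiffAt ℝ ∞ g y ∧ G (g y) = y := by
  have ha := hG.contDiffAt (x := a)
  set e := ha.toOpenPartialHomeomorph G hG' (by simp) with he
  have hmem : G a ∈ e.target := ha.image_mem_toOpenPartialHomeomorph_target hG' (by simp)
  have hsrc : a ∈ e.source := ha.mem_toOpenPartialHomeomorph_source hG' (by simp)
  have hea : e.symm (G a) = a := e.left_inv hsrc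
  refine ⟨e.symm, hea, ?_⟩
  have hcont : ContinuousAt (fun y ↦ fderiv ℝ G (e.symm y)) (G a) :=
    (hG.continuous_fderiv (by simp)).continuousAt.comp (e.continuousAt_symm hmem)
  -- Invertible operators form an open set, so the derivative stays invertible near the point. This
  -- makes the inverse smooth on a whole neighbourhood of G a.
  have hinv : ∀ᶠ y in 𝓝 (G a), fderiv ℝ G (e.symm y) ∈ range ((↑) : (X ≃L[ℝ] Y) → X →L[ℝ] Y) := by
    refine hcont.eventually_mem ?_
    rw [hea, hG'.fderiv]
    exact ContinuousLinearEquiv.nhds G'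
  filter_upwards [hinv, e.open_target.mem_nhds hmem] with y hy hyt
  obtain ⟨L, hL⟩ := hy
  refine ⟨e.contDiffAt_symm hyt (f₀' := L) ?_ hG.contDiffAt, e.right_inv hyt⟩
  rw [hL]
  exact (hG.differentiable (by simp) _).hasFDerivAt

/-! ### Smooth dependence for the equation along rays -/

section RayEquation

variable {S T : Type u} [NormedAddCommGroup S] [NormedSpace ℝ S]
  [NormedAddCommGroup T] [NormedSpace ℝ T]

/-- The primitive vanishing at `1`, as an operator on continuous functions on `[0, 1]`. -/
noncomputable def volterra (T : Type*) [NormedAddCommGroup T] [NormedSpace ℝ T] :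
    C(unitInterval, T) →L[ℝ] C(unitInterval, T) :=
  LinearMap.mkContinuous
    { toFun := fun u ↦ ⟨fun τ ↦ ∫ r in (1 : ℝ)..τ, IccExtend zero_le_one u r,
        (intervalIntegral.continuous_primitive
          (fun a b ↦ (u.continuous.Icc_extend' (h := zero_le_one)).intervalIntegrable a b) 1).comp
          continuous_subtype_val⟩
      map_add' := fun u w ↦ by
        ext τ
        simp only [ContinuousMap.coe_mk, ContinuousMap.add_apply]
        rw [← intervalIntegral.integral_add
          ((u.continuous.Icc_extend' (h := zero_le_one)).intervalIntegrable _ _)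
          ((w.continuous.Icc_extend' (h := zero_le_one)).intervalIntegrable _ _)]
        rfl
      map_smul' := fun c u ↦ by
        ext τ
        simp only [ContinuousMap.coe_mk, ContinuousMap.smul_apply, RingHom.id_apply]
        rw [← intervalIntegral.integral_smul]
        rfl } 1
    (fun u ↦ by
      rw [ContinuousMap.norm_le _ (by positivity)]
      intro τ
      simp only [LinearMap.coe_mk, AddHom.coe_mk, ContinuousMap.coe_mk, one_mul]
      have h := intervalIntegral.norm_integral_le_of_norm_le_const (a := (1 : ℝ)) (b := τ)
        (f := IccExtend zero_le_one u) (C := ‖u‖) (fun r _ ↦ u.norm_coe_le_norm _)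
      refine h.trans (mul_le_of_le_one_right (norm_nonneg _) ?_)
      rw [abs_le]
      constructor <;> linarith [τ.2.1, τ.2.2])

/-- The curve `τ ↦ (s, τ s, z τ)`, depending linearly on `(s, z)`. -/
noncomputable def rayCurve (S T : Type*) [NormedAddCommGroup S] [NormedSpace ℝ S]
    [NormedAddCommGroup T] [NormedSpace ℝ T] :
    S × C(unitInterval, T) →L[ℝ] C(unitInterval, S × S × T) :=
  LinearMap.mkContinuous
    { toFun := fun p ↦ ⟨fun τ ↦ (p.1, (τ : ℝ) • p.1, p.2 τ), by fun_prop⟩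
      map_add' := fun p q ↦ by ext τ <;> simp
      map_smul' := fun c p ↦ by ext τ <;> simp [smul_comm c] } 1
    (fun p ↦ by
      rw [ContinuousMap.norm_le _ (by positivity)]
      intro τ
      simp only [LinearMap.coe_mk, AddHom.coe_mk, ContinuousMap.coe_mk, one_mul]
      have h1 : ‖p.1‖ ≤ ‖p‖ := norm_fst_le p
      refine norm_prod_le_iff.2 ⟨h1, norm_prod_le_iff.2 ⟨?_, ?_⟩⟩
      · simp only [norm_smul, Real.norm_of_nonneg τ.2.1]
        exact (mul_le_of_le_one_left (norm_nonneg _) τ.2.2).trans h1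
      · exact (p.2.norm_coe_le_norm τ).trans (norm_snd_le p))

@[simp]
lemma rayCurve_apply (p : S × C(unitInterval, T)) (τ : unitInterval) :
    rayCurve S T p τ = (p.1, (τ : ℝ) • p.1, p.2 τ) := rfl

/-- The right-hand side of the equation satisfied along rays by the integral manifolds of the
distribution spanned by the graphs of the operators `A x`. -/
def raySpeed (A : S × T → S →L[ℝ] T) (q : S × S × T) : T := A q.2 q.1

lemma contDiff_raySpeed {A : S × T → S →L[ℝ] T} (hA : ContDiff ℝ ∞ A) :
    ContDiff ℝ ∞ (raySpeed A) := by
  unfold raySpeed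
  fun_prop

lemma hasFDerivAt_raySpeed {A : S × T → S →L[ℝ] T} (hA : ContDiff ℝ ∞ A) (q : S × S × T) :
    HasFDerivAt (raySpeed A) ((A q.2).comp (ContinuousLinearMap.fst ℝ S (S × T)) +
      ((fderiv ℝ A q.2).comp (ContinuousLinearMap.snd ℝ S (S × T))).flip q.1) q := by
  have h1 : HasFDerivAt (fun q : S × S × T ↦ A q.2) _ q :=
    (hA.differentiable (by simp) q.2).hasFDerivAt.comp q hasFDerivAt_snd
  exact h1.clm_apply hasFDerivAt_fst

lemma fderiv_raySpeed_apply {A : S × T → S →L[ℝ] T} (hA : ContDiff ℝ ∞ A) (q v : S × S × T) :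
    fderiv ℝ (raySpeed A) q v = A q.2 v.1 + fderiv ℝ A q.2 v.2 q.1 := by
  rw [(hasFDerivAt_raySpeed hA q).fderiv]
  rfl

/-- Smooth dependence on the end point `(s, t)` of the solution on `[0, 1]` of `z' = A (τ s, z) s`,
`z 1 = t`. -/
lemma exists_smooth_ray_solution [CompleteSpace S] [CompleteSpace T] {A : S × T → S →L[ℝ] T}
    (hA : ContDiff ℝ ∞ A) :
    ∃ Z : S × T → C(unitInterval, T), Z 0 = 0 ∧ ∀ᶠ x in 𝓝 (0 : S × T), ContDiffAt ℝ ∞ Z x ∧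
      Z x = ContinuousMap.const unitInterval x.2 + volterra T
        ((ContinuousMap.mk _ (contDiff_raySpeed hA).continuous).comp
          (rayCurve S T (x.1, Z x))) := by
  set f : C(S × S × T, T) := ContinuousMap.mk _ (contDiff_raySpeed hA).continuous with hf
  have hN : ContDiff ℝ ∞ (fun z : C(unitInterval, S × S × T) ↦ f.comp z) :=
    (contDiff_raySpeed hA).postcomp_continuousMap
  have hf' : ContDiff ℝ ∞ (fderiv ℝ (raySpeed A)) := (contDiff_raySpeed hA).fderiv_right (by simp)
  let R : (S × T) × C(unitInterval, T) →L[ℝ] S × C(unitInterval, T) :=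
    ((ContinuousLinearMap.fst ℝ S T).comp (ContinuousLinearMap.fst ℝ _ _)).prod
      (ContinuousLinearMap.snd ℝ _ _)
  let c : T →L[ℝ] C(unitInterval, T) :=
    LinearMap.mkContinuous
      { toFun := fun t ↦ ContinuousMap.const unitInterval t
        map_add' := fun _ _ ↦ rfl
        map_smul' := fun _ _ ↦ rfl } 1 (fun t ↦ by
          rw [ContinuousMap.norm_le _ (by positivity)]
          intro τ
          exact (one_mul ‖t‖).ge)
  have hc : ∀ t, c t = ContinuousMap.const unitInterval t := fun t ↦ rfl
  -- The second component vanishes exactly when z solves the integral equation with end point (s,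
  -- t). Carrying (s, t) along as first component turns the inverse function theorem into the
  -- implicit one.
  let G : (S × T) × C(unitInterval, T) → (S × T) × C(unitInterval, T) := fun p ↦
    (p.1, p.2 - c p.1.2 - volterra T (f.comp (rayCurve S T (R p))))
  have hG : ContDiff ℝ ∞ G := by
    refine contDiff_fst.prodMk (ContDiff.sub (ContDiff.sub contDiff_snd ?_) ?_)
    · exact c.contDiff.comp contDiff_fst.snd
    · exact (volterra T).contDiff.comp
        (hN.comp ((rayCurve S T).contDiff.comp R.contDiff))
  have hG0 : G 0 = 0 := by
    have : f.comp (rayCurve S T (R 0)) = 0 := by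
      ext τ
      simp [f, R, raySpeed]
    simp only [G, this]
    simp
  -- B is the derivative of the second component of G in the parameters at 0. The derivative in z is
  -- the identity, because A(τs, z)s is linear in the outer s and so has no z-derivative at s = 0.
  -- Hence G' is unipotent with explicit inverse.
  let B : S × T →L[ℝ] C(unitInterval, T) :=
    - c.comp (ContinuousLinearMap.snd ℝ S T) - (volterra T).comp
      (c.comp ((A 0).comp (ContinuousLinearMap.fst ℝ S T)))
  let G' : ((S × T) × C(unitInterval, T)) ≃L[ℝ] (S × T) × C(unitInterval, T) :=
    ContinuousLinearEquiv.equivOfInverse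
      ((ContinuousLinearMap.fst ℝ _ _).prod
        (ContinuousLinearMap.snd ℝ _ _ + B.comp (ContinuousLinearMap.fst ℝ _ _)))
      ((ContinuousLinearMap.fst ℝ _ _).prod
        (ContinuousLinearMap.snd ℝ _ _ - B.comp (ContinuousLinearMap.fst ℝ _ _)))
      (fun p ↦ by simp) (fun p ↦ by simp)
  have hG' : HasFDerivAt G (G' : _ →L[ℝ] _) 0 := by
    have h1 : HasFDerivAt (fun z : C(unitInterval, S × S × T) ↦ f.comp z) _
        (rayCurve S T (R 0)) :=
      ContinuousMap.hasFDerivAt_postcomp f (ContinuousMap.mk _ hf'.continuous)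
        (fun x ↦ ((contDiff_raySpeed hA).differentiable (by simp) x).hasFDerivAt) _
    have h2 := h1.comp (0 : (S × T) × C(unitInterval, T))
      ((rayCurve S T).hasFDerivAt.comp (0 : (S × T) × C(unitInterval, T)) R.hasFDerivAt)
    have h3 := (volterra T).hasFDerivAt.comp (0 : (S × T) × C(unitInterval, T)) h2
    have h4 : HasFDerivAt (fun p : (S × T) × C(unitInterval, T) ↦ c p.1.2) _ 0 :=
      c.hasFDerivAt.comp (0 : (S × T) × C(unitInterval, T))
        (((ContinuousLinearMap.snd ℝ S T).comp
          (ContinuousLinearMap.fst ℝ (S × T) C(unitInterval, T))).hasFDerivAt)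
    refine (hasFDerivAt_fst.prodMk ((hasFDerivAt_snd.sub h4).sub h3)).congr_fderiv ?_
    refine ContinuousLinearMap.ext fun p ↦ ?_
    refine Prod.ext rfl ?_
    have h5 : (ContinuousMap.pointwiseApplyCLM unitInterval (S × S × T) T
        ((ContinuousMap.mk _ hf'.continuous).comp (rayCurve S T (R 0))))
        (rayCurve S T (R p)) = c (A 0 p.1.1) := by
      ext τ
      simp only [R, fderiv_raySpeed_apply hA, hc, ContinuousMap.pointwiseApplyCLM_apply,
        ContinuousMap.comp_apply, ContinuousMap.coe_mk, rayCurve_apply]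
      simp
      rfl
    change p.2 - c p.1.2 - volterra T ((ContinuousMap.pointwiseApplyCLM unitInterval (S × S × T) T
        ((ContinuousMap.mk _ hf'.continuous).comp (rayCurve S T (R 0))))
        (rayCurve S T (R p))) = p.2 + (- c p.1.2 - volterra T (c (A 0 p.1.1)))
    rw [h5]
    abel
  obtain ⟨g, hg0, hg⟩ := hG.exists_eventually_inverse G' hG'
  rw [hG0] at hg0 hg
  refine ⟨fun x ↦ (g (x, 0)).2, ?_, ?_⟩
  · change (g 0).2 = 0
    rw [hg0]
    rfl
  · have hcont : ContinuousAt (fun x : S × T ↦ (x, (0 : C(unitInterval, T)))) 0 := by fun_prop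
    filter_upwards [hcont.eventually hg] with x hx
    refine ⟨(hx.1.comp x (contDiffAt_id.prodMk contDiffAt_const)).snd, ?_⟩
    have h1 := congrArg Prod.fst hx.2
    have h2 := congrArg Prod.snd hx.2
    simp only [G] at h1 h2
    have h3 : R (g (x, 0)) = (x.1, (g (x, 0)).2) := by
      simp only [R, ContinuousLinearMap.prod_apply, ContinuousLinearMap.comp_apply,
        ContinuousLinearMap.coe_fst', ContinuousLinearMap.coe_snd', h1]
    rw [h1, h3, hc] at h2
    exact sub_eq_iff_eq_add'.1 (sub_eq_zero.1 h2)

end RayEquation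

/-! ### Frobenius' theorem for graphs -/

section GraphFrobenius

variable {S T : Type u} [NormedAddCommGroup S] [NormedSpace ℝ S]
  [NormedAddCommGroup T] [NormedSpace ℝ T]

/-- Uniqueness for linear equations with a condition at the right end point. -/
lemma eq_zero_of_linear_ode_of_eq_zero_right (κ : C(unitInterval, T →L[ℝ] T)) (w : ℝ → T)
    (hw : ∀ r : unitInterval, HasDerivAt w (κ r (w r)) r) (h1 : w 1 = 0) : w 0 = 0 := by
  have key := ODE_solution_unique_of_mem_Icc_left (a := (0 : ℝ)) (b := 1) (K := ‖κ‖₊)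
    (v := fun r y ↦ IccExtend zero_le_one κ r y) (s := fun _ ↦ univ) (f := w) (g := fun _ ↦ 0)
    (fun r _ ↦ (((IccExtend zero_le_one κ r).lipschitz).weaken
      (κ.norm_coe_le_norm _)).lipschitzOnWith)
    (fun r hr ↦ (hw ⟨r, hr⟩).continuousAt.continuousWithinAt)
    (fun r hr ↦ by
      rw [IccExtend_of_mem _ _ (Ioc_subset_Icc_self hr)]
      exact (hw ⟨r, Ioc_subset_Icc_self hr⟩).hasDerivWithinAt)
    (fun _ _ ↦ mem_univ _) continuousOn_const
    (fun r _ ↦ by simpa using hasDerivWithinAt_const r (Iic r) (0 : T))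
    (fun _ _ ↦ mem_univ _) h1
  exact key (left_mem_Icc.2 zero_le_one)

lemma hasDerivAt_primitive_IccExtend [CompleteSpace T] (u : C(unitInterval, T)) (a : T) (r : ℝ) :
    HasDerivAt (fun r ↦ a + ∫ ρ in (1 : ℝ)..r, IccExtend zero_le_one u ρ)
      (IccExtend zero_le_one u r) r :=
  ((u.continuous.Icc_extend' (h := zero_le_one)).integral_hasStrictDerivAt 1 r).hasDerivAt.const_add
    a

/-- Frobenius' theorem for a distribution consisting of graphs of operators. -/
lemma exists_first_integral_of_graph [CompleteSpace S] [CompleteSpace T]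
    {A : S × T → S →L[ℝ] T} (hA : ContDiff ℝ ∞ A)
    (hint : ∀ᶠ x in 𝓝 (0 : S × T), ∀ σ σ',
      fderiv ℝ A x (σ, A x σ) σ' = fderiv ℝ A x (σ', A x σ') σ) :
    ∃ θ : S × T → T, (∀ᶠ x in 𝓝 (0 : S × T), ContDiffAt ℝ ∞ θ x ∧
      ∀ σ, fderiv ℝ θ x (σ, A x σ) = 0) ∧ ∀ τ, fderiv ℝ θ 0 (0, τ) = τ := by
  obtain ⟨Z, hZ0, hZ⟩ := exists_smooth_ray_solution hA
  have hZcd : ContDiffAt ℝ ∞ Z 0 := hZ.self_of_nhds.1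
  let f : C(S × S × T, T) := ContinuousMap.mk _ (contDiff_raySpeed hA).continuous
  have hf' : ContDiff ℝ ∞ (fderiv ℝ (raySpeed A)) := (contDiff_raySpeed hA).fderiv_right (by simp)
  have hθ : ∀ (τ : unitInterval) {x}, ContDiffAt ℝ ∞ Z x →
      HasFDerivAt (fun x ↦ Z x τ) ((ContinuousMap.evalCLM ℝ τ).comp (fderiv ℝ Z x)) x :=
    fun τ x h ↦ (ContinuousMap.evalCLM ℝ τ : C(unitInterval, T) →L[ℝ] T).hasFDerivAt.comp x
      (h.differentiableAt (by simp)).hasFDerivAt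
  -- The first integral sends (s, t) to the point where the solution ending at t over s meets {0} ×
  -- T.
  refine ⟨fun x ↦ Z x 0, ?_, ?_⟩
  · obtain ⟨δ, hδ, hball⟩ := Metric.eventually_nhds_iff_ball.1 hint
    have hZball : ∀ᶠ x in 𝓝 (0 : S × T), Z x ∈ Metric.ball (0 : C(unitInterval, T)) δ :=
      hZcd.continuousAt.eventually_mem (by rw [hZ0]; exact Metric.ball_mem_nhds _ hδ)
    filter_upwards [hZ.eventually_nhds, hZball, Metric.ball_mem_nhds (0 : S × T) hδ]
      with x hx hxZ hxδ
    have hcd := hx.self_of_nhds.1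
    refine ⟨(ContinuousMap.evalCLM ℝ (0 : unitInterval) :
      C(unitInterval, T) →L[ℝ] T).contDiff.contDiffAt.comp x hcd, fun σ ↦ ?_⟩
    rw [(hθ 0 hcd).fderiv]
    -- The variation of the solution when its end point moves in the direction (σ, A x σ) of the
    -- distribution. It has to vanish at the initial time.
    set ζ : C(unitInterval, T) := fderiv ℝ Z x (σ, A x σ) with hζ
    change ζ 0 = 0
    let q : C(unitInterval, S × T) := ⟨fun τ ↦ ((τ : ℝ) • x.1, Z x τ), by fun_prop⟩
    have hq : ∀ τ, q τ = ((τ : ℝ) • x.1, Z x τ) := fun _ ↦ rfl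
    let u : C(unitInterval, T) := f.comp (rayCurve S T (x.1, Z x))
    have hu : ∀ τ, u τ = A (q τ) x.1 := fun _ ↦ rfl
    let u' : C(unitInterval, T) := ContinuousMap.pointwiseApplyCLM unitInterval (S × S × T) T
      ((ContinuousMap.mk _ hf'.continuous).comp (rayCurve S T (x.1, Z x))) (rayCurve S T (σ, ζ))
    have hu' : ∀ τ : unitInterval, u' τ = A (q τ) σ + fderiv ℝ A (q τ) ((τ : ℝ) • σ, ζ τ) x.1 :=
      fun τ ↦ fderiv_raySpeed_apply hA _ _
    have hqδ : ∀ τ, q τ ∈ Metric.ball (0 : S × T) δ := by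
      intro τ
      rw [mem_ball_zero_iff] at hxZ hxδ ⊢
      refine max_lt ?_ (((Z x).norm_coe_le_norm τ).trans_lt hxZ)
      rw [hq, norm_smul, Real.norm_of_nonneg τ.2.1]
      exact (mul_le_of_le_one_left (norm_nonneg _) τ.2.2).trans_lt ((norm_fst_le x).trans_lt hxδ)
    have hZeq : ∀ τ : unitInterval, Z x τ = x.2 + ∫ ρ in (1 : ℝ)..τ, IccExtend zero_le_one u ρ :=
      fun τ ↦ congrArg (fun z : C(unitInterval, T) ↦ z τ) hx.self_of_nhds.2
    have hζeq : ∀ τ : unitInterval,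
        ζ τ = A x σ + ∫ ρ in (1 : ℝ)..τ, IccExtend zero_le_one u' ρ := by
      intro τ
      have h0 := ContinuousMap.hasFDerivAt_postcomp f (ContinuousMap.mk _ hf'.continuous)
        (fun x ↦ ((contDiff_raySpeed hA).differentiable (by simp) x).hasFDerivAt)
        (rayCurve S T (x.1, Z x))
      have hp : HasFDerivAt (fun x : S × T ↦ (x.1, Z x)) _ x :=
        hasFDerivAt_fst.prodMk (hcd.differentiableAt (by simp)).hasFDerivAt
      have hr : HasFDerivAt (fun x ↦ rayCurve S T (x.1, Z x)) _ x :=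
        (rayCurve S T).hasFDerivAt.comp x hp
      have h1 : HasFDerivAt (fun x ↦ f.comp (rayCurve S T (x.1, Z x))) _ x :=
        HasFDerivAt.comp (g := fun z : C(unitInterval, S × S × T) ↦ f.comp z) x h0 hr
      have h2 : HasFDerivAt (fun x ↦ Z x τ) _ x :=
        (hasFDerivAt_snd.add ((ContinuousMap.evalCLM ℝ τ :
          C(unitInterval, T) →L[ℝ] T).hasFDerivAt.comp x
          ((volterra T).hasFDerivAt.comp x h1))).congr_of_eventuallyEq
          (hx.mono fun y hy ↦ congrArg (fun z : C(unitInterval, T) ↦ z τ) hy.2)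
      exact congrArg (fun L ↦ L (σ, A x σ)) ((hθ τ hcd).unique h2)
    let z₁ : ℝ → T := fun r ↦ x.2 + ∫ ρ in (1 : ℝ)..r, IccExtend zero_le_one u ρ
    let ζ₁ : ℝ → T := fun r ↦ A x σ + ∫ ρ in (1 : ℝ)..r, IccExtend zero_le_one u' ρ
    -- If the solutions sweep out leaves, the variation must be τ A(q τ) σ. The defect w vanishes at
    -- τ = 1, where q is x and ζ is A x σ.
    let w : ℝ → T := fun r ↦ ζ₁ r - r • A (r • x.1, z₁ r) σ
    have hA' : ContDiff ℝ ∞ (fderiv ℝ A) := hA.fderiv_right (by simp)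
    let κ : C(unitInterval, T →L[ℝ] T) :=
      ⟨fun τ ↦ ((fderiv ℝ A (q τ)).flip x.1).comp (ContinuousLinearMap.inr ℝ S T), by
        have h := hA'.continuous.comp q.continuous
        have h2 : Continuous fun τ ↦ (fderiv ℝ A (q τ)).flip :=
          (ContinuousLinearMap.flipₗᵢ ℝ (S × T) S T).continuous.comp h
        fun_prop⟩
    have hκ : ∀ τ y, κ τ y = fderiv ℝ A (q τ) (0, y) x.1 := fun _ _ ↦ rfl
    have hw : ∀ r : unitInterval, HasDerivAt w (κ r (w r)) r := by
      intro r
      have e1 : ((r : ℝ) • x.1, z₁ r) = q r := by rw [hq, hZeq]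
      have hz₁ : HasDerivAt z₁ (A (q r) x.1) r := by
        have := hasDerivAt_primitive_IccExtend u x.2 r
        rwa [IccExtend_val, hu] at this
      have hζ₁ : HasDerivAt ζ₁ (u' r) r := by
        have := hasDerivAt_primitive_IccExtend u' (A x σ) r
        rwa [IccExtend_val] at this
      have hray : HasDerivAt (fun r : ℝ ↦ (r • x.1, z₁ r)) (x.1, A (q r) x.1) r := by
        have := ((hasDerivAt_id (r : ℝ)).smul_const x.1).prodMk hz₁
        simpa using this
      have hAq : HasDerivAt (fun r : ℝ ↦ A (r • x.1, z₁ r))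
          (fderiv ℝ A (q r) (x.1, A (q r) x.1)) r := by
        have hd : HasFDerivAt A (fderiv ℝ A (q r)) ((r : ℝ) • x.1, z₁ r) := by
          rw [e1]
          exact (hA.differentiable (by simp) _).hasFDerivAt
        exact hd.comp_hasDerivAt (r : ℝ) hray
      have hAσ := hAq.clm_apply (hasDerivAt_const (r : ℝ) σ)
      have := hζ₁.sub ((hasDerivAt_id (r : ℝ)).smul hAσ)
      refine this.congr_deriv ?_
      have hw : w r = ζ r - (r : ℝ) • A (q r) σ := by
        change ζ₁ r - (r : ℝ) • A ((r : ℝ) • x.1, z₁ r) σ = _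
        rw [e1, hζeq]
      -- Integrability exchanges σ and x.1. The terms of w' not involving w then cancel, and w' = κ
      -- w remains.
      have hi := hball _ (hqδ r) σ x.1
      rw [hu', hκ, hw, e1, ← hi]
      have : ((0 : S), ζ r - (r : ℝ) • A (q r) σ)
          = ((r : ℝ) • σ, ζ r) - (r : ℝ) • (σ, A (q r) σ) := by
        simp
      rw [this, map_sub, map_smul]
      simp
      abel
    have h1 : w 1 = 0 := by
      simp only [w, ζ₁, z₁, intervalIntegral.integral_same, add_zero, one_smul]
      exact sub_self _
    have h0 := eq_zero_of_linear_ode_of_eq_zero_right κ w hw h1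
    rw [hζeq]
    simpa [w, ζ₁] using h0
  · intro τ
    have hc : ContinuousAt (fun t : T ↦ ((0 : S), t)) 0 := by fun_prop
    -- Over s = 0 the speed vanishes, so the solution is constant and θ(0, t) = t.
    have h1 : (fun t : T ↦ Z (0, t) 0) =ᶠ[𝓝 0] fun t ↦ t := by
      filter_upwards [hc.eventually hZ] with t ht
      rw [ht.2]
      have : (ContinuousMap.mk _ (contDiff_raySpeed hA).continuous).comp
          (rayCurve S T ((0 : S), Z (0, t))) = 0 := by
        ext ρ
        simp [raySpeed]
      simp only [this, map_zero, add_zero, ContinuousMap.const_apply]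
    have h2 : HasFDerivAt (fun t : T ↦ ((0 : S), t)) (ContinuousLinearMap.inr ℝ S T) 0 :=
      (ContinuousLinearMap.inr ℝ S T).hasFDerivAt
    have h3 := ((hθ 0 hZcd).comp (0 : T) h2).unique
      ((hasFDerivAt_id (0 : T)).congr_of_eventuallyEq h1)
    rw [(hθ 0 hZcd).fderiv]
    exact congrArg (fun L ↦ L τ) h3

end GraphFrobenius

/-! ### Frobenius' theorem for involutive frames -/

section Frobenius

/-- The germ of a smooth map at a point of a finite-dimensional space is the germ of a globally
smooth map. -/
lemma exists_contDiff_eventuallyEq {X Y : Type*} [NormedAddCommGroup X] [NormedSpace ℝ X]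
    [FiniteDimensional ℝ X] [NormedAddCommGroup Y] [NormedSpace ℝ Y] {f : X → Y} {a : X}
    (hf : ∀ᶠ x in 𝓝 a, ContDiffAt ℝ ∞ f x) : ∃ g, ContDiff ℝ ∞ g ∧ g =ᶠ[𝓝 a] f := by
  obtain ⟨δ, hδ, hball⟩ := Metric.eventually_nhds_iff_ball.1 hf
  let χ : ContDiffBump a := ⟨δ / 4, δ / 2, by positivity, by linarith⟩
  refine ⟨fun x ↦ χ x • f x, contDiff_iff_contDiffAt.2 fun x ↦ ?_, ?_⟩
  · by_cases hx : x ∈ tsupport χ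
    · rw [χ.tsupport_eq] at hx
      exact χ.contDiffAt.smul
        (hball x (Metric.closedBall_subset_ball (by simp only [χ]; linarith) hx))
    · have : (fun x ↦ χ x • f x) =ᶠ[𝓝 x] fun _ ↦ 0 := by
        filter_upwards [notMem_tsupport_iff_eventuallyEq.1 hx] with y hy
        simp [hy]
      exact contDiffAt_const.congr_of_eventuallyEq this
  · filter_upwards [χ.eventuallyEq_one] with x hx
    simp [hx]

/-- The integrability condition for a distribution of graphs which has an involutive frame. -/
lemma fderiv_graph_symm {S T : Type*} [NormedAddCommGroup S] [NormedSpace ℝ S]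
    [NormedAddCommGroup T] [NormedSpace ℝ T] {ι : Type*} [Fintype ι] {A : S × T → S →L[ℝ] T}
    {x : S × T} {Y : ι → S × T → S × T} (hA : DifferentiableAt ℝ A x)
    (hY : ∀ i, DifferentiableAt ℝ (Y i) x)
    (hgraph : ∀ i, ∀ᶠ y in 𝓝 x, A y (Y i y).1 = (Y i y).2)
    (hbr : ∀ i j, VectorField.lieBracket ℝ (Y i) (Y j) x ∈
      Submodule.span ℝ (range fun i ↦ Y i x))
    (hspan : ∀ σ, (σ, A x σ) ∈ Submodule.span ℝ (range fun i ↦ Y i x)) (σ σ' : S) :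
    fderiv ℝ A x (σ, A x σ) σ' = fderiv ℝ A x (σ', A x σ') σ := by
  have hmem : ∀ v ∈ Submodule.span ℝ (range fun i ↦ Y i x), A x v.1 = v.2 := by
    intro v hv
    induction hv using Submodule.span_induction with
    | mem v h =>
      obtain ⟨i, rfl⟩ := h
      exact (hgraph i).self_of_nhds
    | zero => simp
    | add v w _ _ h1 h2 => simp [h1, h2]
    | smul c v _ h1 => simp [h1]
  have hd : ∀ i v, fderiv ℝ A x v (Y i x).1 + A x (fderiv ℝ (Y i) x v).1
      = (fderiv ℝ (Y i) x v).2 := by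
    intro i v
    have h1 := (hA.hasFDerivAt.clm_apply (hY i).hasFDerivAt.fst).unique
      ((hY i).hasFDerivAt.snd.congr_of_eventuallyEq (hgraph i))
    have h2 := congrArg (fun L ↦ L v) h1
    simp only [add_apply, ContinuousLinearMap.comp_apply] at h2
    rw [add_comm]
    exact h2
  -- The bracket lies in the graph of A x, and by `hd` its second component is A applied to its
  -- first plus the antisymmetrized derivative of A. The latter must therefore vanish.
  have hij : ∀ i j, fderiv ℝ A x (Y i x) (Y j x).1 = fderiv ℝ A x (Y j x) (Y i x).1 := by
    intro i j
    have h1 := hmem _ (hbr i j)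
    simp only [VectorField.lieBracket_eq, Prod.fst_sub, Prod.snd_sub, map_sub, ← hd] at h1
    rw [add_sub_add_comm] at h1
    exact sub_eq_zero.1 (add_eq_right.1 h1.symm)
  have hall : ∀ v ∈ Submodule.span ℝ (range fun i ↦ Y i x),
      ∀ w ∈ Submodule.span ℝ (range fun i ↦ Y i x),
      fderiv ℝ A x v w.1 = fderiv ℝ A x w v.1 := by
    intro v hv w hw
    induction hv, hw using Submodule.span_induction₂ with
    | mem_mem v w hv hw =>
      obtain ⟨i, rfl⟩ := hv
      obtain ⟨j, rfl⟩ := hw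
      exact hij i j
    | zero_left w _ => simp
    | zero_right v _ => simp
    | add_left v v' w _ _ _ h1 h2 => simp [h1, h2]
    | add_right v w w' _ _ _ h1 h2 => simp [h1, h2]
    | smul_left c v w _ _ h1 => simp [h1]
    | smul_right c v w _ _ h1 => simp [h1]
  exact hall _ (hspan σ) _ (hspan σ')

set_option maxHeartbeats 1000000 in
/-- Local existence of a nontrivial first integral of an involutive distribution of positive
codimension. -/
theorem exists_first_integral_of_involutive {V : Type} [NormedAddCommGroup V] [NormedSpace ℝ V]
    [FiniteDimensional ℝ V] {ι : Type} [Fintype ι] {p : V} (Y : ι → V → V)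
    (hY : ∀ i, ∀ᶠ x in 𝓝 p, ContDiffAt ℝ ∞ (Y i) x)
    (hli : LinearIndependent ℝ (fun i ↦ Y i p)) (hcard : Fintype.card ι < Module.finrank ℝ V)
    (hbr : ∀ i j, ∀ᶠ x in 𝓝 p, VectorField.lieBracket ℝ (Y i) (Y j) x ∈
      Submodule.span ℝ (range fun i ↦ Y i x)) :
    ∃ θ : V → ℝ, (∀ᶠ x in 𝓝 p, ContDiffAt ℝ ∞ θ x ∧ ∀ i, fderiv ℝ θ x (Y i x) = 0) ∧
      fderiv ℝ θ p ≠ 0 := by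
  classical
  let S := ι → ℝ
  let B : V → S →L[ℝ] V := fun x ↦
    ∑ i, (ContinuousLinearMap.proj (R := ℝ) (φ := fun _ : ι ↦ ℝ) i).smulRight (Y i x)
  have hB : ∀ x (c : S), B x c = ∑ i, c i • Y i x := fun x c ↦ by
    simp only [B, sum_apply]
    rfl
  have hB1 : ∀ x i, B x (Pi.single i 1) = Y i x := fun x i ↦ by
    rw [hB, Finset.sum_eq_single i] <;> simp +contextual
  have hBinj : Function.Injective (B p : S →ₗ[ℝ] V) := by
    rw [injective_iff_map_eq_zero]
    intro c hc
    ext i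
    exact Fintype.linearIndependent_iff.1 hli c ((hB p c).symm.trans hc) i
  -- A complement of the distribution at p gives linear coordinates S × T in which the distribution
  -- is S × {0} at the origin.
  obtain ⟨T, hT⟩ := Submodule.exists_isCompl (LinearMap.range (B p : S →ₗ[ℝ] V))
  let e : (S × T) ≃L[ℝ] V := LinearEquiv.toContinuousLinearEquiv
    (((LinearEquiv.ofInjective _ hBinj).prodCongr (LinearEquiv.refl ℝ T)).trans
      (Submodule.prodEquivOfIsCompl _ _ hT))
  have he : ∀ c t, e (c, t) = B p c + t := fun c t ↦ rfl
  have hTne : Nontrivial T := by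
    rw [← Module.finrank_pos_iff (R := ℝ)]
    have := e.toLinearEquiv.finrank_eq
    rw [Module.finrank_prod] at this
    simp only [S, Module.finrank_fintype_fun_eq_card] at this
    omega
  let a : S × T → V := fun x ↦ p + e x
  have ha : ContDiff ℝ ∞ a := contDiff_const.add e.contDiff
  have ha0 : a 0 = p := by simp [a]
  have hacont : Tendsto a (𝓝 0) (𝓝 p) := by
    have := ha.continuous.tendsto 0
    rwa [ha0] at this
  let B' : S × T → S →L[ℝ] S × T := fun x ↦ (e.symm : V →L[ℝ] S × T).comp (B (a x))
  have hBsmooth : ∀ᶠ x in 𝓝 p, ContDiffAt ℝ ∞ B x := by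
    filter_upwards [eventually_all.2 hY] with x hx
    refine ContDiffAt.sum fun i _ ↦ ?_
    exact ((ContinuousLinearMap.smulRightL ℝ S V
      (ContinuousLinearMap.proj (R := ℝ) (φ := fun _ : ι ↦ ℝ) i)).contDiff.contDiffAt).comp x (hx i)
  have hB'smooth : ∀ᶠ x in 𝓝 (0 : S × T), ContDiffAt ℝ ∞ B' x := by
    filter_upwards [hacont.eventually hBsmooth] with x hx
    exact contDiffAt_const.clm_comp (hx.comp x ha.contDiffAt)
  have hB'0 : ∀ c, B' 0 c = (c, 0) := by
    intro c
    simp only [B', ha0]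
    change e.symm (B p c) = (c, 0)
    rw [e.symm_apply_eq, he]
    simp
  let P : S × T → S →L[ℝ] S := fun x ↦ (ContinuousLinearMap.fst ℝ S T).comp (B' x)
  have hPsmooth : ∀ᶠ x in 𝓝 (0 : S × T), ContDiffAt ℝ ∞ P x :=
    hB'smooth.mono fun x hx ↦ contDiffAt_const.clm_comp hx
  have hP0 : P 0 = ((ContinuousLinearEquiv.refl ℝ S : S ≃L[ℝ] S) : S →L[ℝ] S) := by
    ext c : 1
    simp [P, hB'0]
  have hPinv : ∀ᶠ x in 𝓝 (0 : S × T), (P x).IsInvertible := by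
    have hc : ContinuousAt P 0 := hPsmooth.self_of_nhds.continuousAt
    have := hc.eventually_mem (s := range ((↑) : (S ≃L[ℝ] S) → S →L[ℝ] S))
      (by rw [hP0]; exact ContinuousLinearEquiv.nhds _)
    exact this
  -- The span of the frame is the range of `B' x`. Its S-component `P x` is the identity at 0 and
  -- hence invertible nearby, so this range is the graph of the T-component composed with the
  -- inverse of `P x`.
  let A₀ : S × T → S →L[ℝ] T := fun x ↦
    ((ContinuousLinearMap.snd ℝ S T).comp (B' x)).comp (P x).inverse
  have hA₀ : ∀ᶠ x in 𝓝 (0 : S × T), ContDiffAt ℝ ∞ A₀ x := by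
    filter_upwards [hB'smooth, hPsmooth, hPinv] with x h1 h2 h3
    exact (contDiffAt_const.clm_comp h1).clm_comp ((h3.contDiffAt_map_inverse).comp x h2)
  -- The ray equation wants A smooth everywhere, while integrability is needed only near 0, so the
  -- germ of A₀ may be extended.
  obtain ⟨A, hA, hAA₀⟩ := exists_contDiff_eventuallyEq hA₀
  have hgraph : ∀ᶠ x in 𝓝 (0 : S × T), ∀ c, A x (B' x c).1 = (B' x c).2 := by
    filter_upwards [hAA₀, hPinv] with x h1 h2 c
    obtain ⟨L, hL⟩ := h2
    have h3 : (P x).inverse (B' x c).1 = c := by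
      change (P x).inverse (P x c) = c
      rw [← hL]
      simp
    rw [h1]
    simp only [A₀, ContinuousLinearMap.comp_apply, h3]
    rfl
  let Y' : ι → S × T → S × T := fun i x ↦ e.symm (Y i (a x))
  have hY' : ∀ i x, Y' i x = B' x (Pi.single i 1) := fun i x ↦ by
    simp [Y', B', hB1]
  have hB'span : ∀ x c, B' x c ∈ Submodule.span ℝ (range fun i ↦ Y' i x) := by
    intro x c
    simp only [B', ContinuousLinearMap.comp_apply, hB]
    simp only [ContinuousLinearEquiv.coe_coe, map_sum, map_smul]
    exact Submodule.sum_mem _ fun i _ ↦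
      Submodule.smul_mem _ _ (Submodule.subset_span ⟨i, rfl⟩)
  have hint : ∀ᶠ x in 𝓝 (0 : S × T), ∀ σ σ',
      fderiv ℝ A x (σ, A x σ) σ' = fderiv ℝ A x (σ', A x σ') σ := by
    filter_upwards [hgraph.eventually_nhds, hPinv, hacont.eventually (eventually_all.2 hY),
      hacont.eventually (eventually_all.2 fun i ↦ eventually_all.2 fun j ↦ hbr i j)]
      with x h1 h2 h3 h4
    have hfd : ∀ i, HasFDerivAt (Y' i) (((e.symm : V →L[ℝ] S × T).comp
        (fderiv ℝ (Y i) (a x))).comp (e : S × T →L[ℝ] V)) x := by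
      intro i
      have hda : HasFDerivAt a (e : S × T →L[ℝ] V) x := e.hasFDerivAt.const_add p
      have := (((h3 i).differentiableAt (by simp)).hasFDerivAt.comp x hda)
      exact (e.symm.hasFDerivAt.comp x this)
    refine fderiv_graph_symm (Y := Y') (hA.differentiable (by simp) x)
      (fun i ↦ (hfd i).differentiableAt) (fun i ↦ ?_) (fun i j ↦ ?_) (fun σ ↦ ?_)
    · filter_upwards [h1] with y hy
      rw [hY']
      exact hy _
    · have h5 : VectorField.lieBracket ℝ (Y' i) (Y' j) x =
          (e.symm : V →L[ℝ] S × T) (VectorField.lieBracket ℝ (Y i) (Y j) (a x)) := by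
        simp only [VectorField.lieBracket_eq, (hfd _).fderiv]
        simp [Y']
      rw [h5]
      have h6 := Submodule.mem_map_of_mem (f := ((e.symm : V →L[ℝ] S × T) : V →ₗ[ℝ] S × T)) (h4 i j)
      rw [Submodule.map_span, ← range_comp] at h6
      exact h6
    · obtain ⟨L, hL⟩ := h2
      have h5 : (B' x (L.symm σ)).1 = σ := by
        change P x (L.symm σ) = σ
        rw [← hL]
        simp
      have h6 := h1.self_of_nhds (L.symm σ)
      rw [h5] at h6
      have h7 : (σ, A x σ) = B' x (L.symm σ) := Prod.ext h5.symm h6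
      rw [h7]
      exact hB'span _ _
  obtain ⟨θ, hθ, hθ0⟩ := exists_first_integral_of_graph hA hint
  obtain ⟨τ, hτ⟩ := exists_ne (0 : T)
  -- The first integral is T-valued with derivative the identity on T at 0. A functional with ℓ τ ≠
  -- 0 makes it real-valued with nonzero differential.
  obtain ⟨ℓ, hℓ⟩ := SeparatingDual.exists_ne_zero (R := ℝ) hτ
  let b : V → S × T := fun v ↦ e.symm (v - p)
  have hb : ContDiff ℝ ∞ b := e.symm.contDiff.comp (contDiff_id.sub contDiff_const)
  have hbp : b p = 0 := by simp [b]
  have hbd : ∀ v, HasFDerivAt b (e.symm : V →L[ℝ] S × T) v := fun v ↦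
    e.symm.hasFDerivAt.comp v ((hasFDerivAt_id v).sub_const p)
  have hbcont : Tendsto b (𝓝 p) (𝓝 0) := by
    have := hb.continuous.tendsto p
    rwa [hbp] at this
  have hΘ : ∀ v, ContDiffAt ℝ ∞ θ (b v) → HasFDerivAt (fun v ↦ ℓ (θ (b v)))
      (ℓ.comp ((fderiv ℝ θ (b v)).comp (e.symm : V →L[ℝ] S × T))) v := fun v hv ↦
    ℓ.hasFDerivAt.comp v ((hv.differentiableAt (by simp)).hasFDerivAt.comp v (hbd v))
  refine ⟨fun v ↦ ℓ (θ (b v)), ?_, ?_⟩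
  · filter_upwards [hbcont.eventually hθ, hbcont.eventually hgraph] with v h1 h2
    refine ⟨ℓ.contDiff.contDiffAt.comp v (h1.1.comp v hb.contDiffAt), fun i ↦ ?_⟩
    rw [(hΘ v h1.1).fderiv]
    have hav : a (b v) = v := by simp [a, b]
    have h3 : e.symm (Y i v) = ((e.symm (Y i v)).1, A (b v) (e.symm (Y i v)).1) := by
      refine Prod.ext rfl ?_
      have := h2 (Pi.single i 1)
      rw [← hY'] at this
      simp only [Y', hav] at this
      exact this.symm
    change ℓ (fderiv ℝ θ (b v) (e.symm (Y i v))) = 0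
    rw [h3, h1.2, map_zero]
  · intro h
    have h1 := hθ.self_of_nhds.1
    rw [← hbp] at h1
    rw [(hΘ p h1).fderiv] at h
    have h2 := congrArg (fun L ↦ L (e (0, τ))) h
    simp only [ContinuousLinearMap.comp_apply, hbp, ContinuousLinearEquiv.coe_coe,
      e.symm_apply_apply, hθ0] at h2
    exact hℓ h2

end Frobenius

/-! ### Vector fields, functions and brackets read in a chart -/

section ChartCalculus

lemma minSmoothness_three_le_infty : minSmoothness ℝ 3 ≤ ∞ := by
  rw [minSmoothness_of_isRCLikeNormedField]
  exact WithTop.coe_le_coe.2 (le_top : (3 : ℕ∞) ≤ ⊤)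

lemma minSmoothness_two_le_infty : minSmoothness ℝ 2 ≤ ∞ := by
  rw [minSmoothness_of_isRCLikeNormedField]
  exact WithTop.coe_le_coe.2 (le_top : (2 : ℕ∞) ≤ ⊤)

variable {E : Type*} [NormedAddCommGroup E] [NormedSpace ℝ E] [CompleteSpace E]
  {H : Type*} [TopologicalSpace H] {I : ModelWithCorners ℝ E H} [I.Boundaryless]
  {N : Type*} [TopologicalSpace N] [ChartedSpace H N] [IsManifold I ∞ N]

/-- The differential of the preferred chart at `x`, with values in the model space. -/
noncomputable def chartDeriv (I : ModelWithCorners ℝ E H) (x y : N) : TangentSpace I y →L[ℝ] E :=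
  mfderiv I 𝓘(ℝ, E) (extChartAt I x) y

/-- The differential of a real function on a manifold, as a linear form. -/
noncomputable def realDeriv (I : ModelWithCorners ℝ E H) (f : N → ℝ) (y : N) :
    TangentSpace I y →L[ℝ] ℝ :=
  mfderiv I 𝓘(ℝ, ℝ) f y

/-- The expression of a vector field in the preferred chart at `x`. -/
noncomputable def coordField (I : ModelWithCorners ℝ E H) (x : N) (X : ∀ y : N, TangentSpace I y)
    (p : E) : E :=
  chartDeriv I x ((extChartAt I x).symm p) (X ((extChartAt I x).symm p))

lemma coordField_apply {x y : N} (hy : y ∈ (extChartAt I x).source)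
    (X : ∀ y : N, TangentSpace I y) :
    coordField I x X (extChartAt I x y) = chartDeriv I x y (X y) :=
  congrArg (fun z : N ↦ chartDeriv I x z (X z))
    ((extChartAt I x).left_inv hy)

lemma contMDiffAt_extChartAt_symm {x : N} {p : E} (hp : p ∈ (extChartAt I x).target) :
    ContMDiffAt 𝓘(ℝ, E) I ∞ (extChartAt I x).symm p :=
  (contMDiffOn_extChartAt_symm x).contMDiffAt ((isOpen_extChartAt_target x).mem_nhds hp)

lemma contMDiffAt_extChartAt_of_mem {x y : N} (hy : y ∈ (extChartAt I x).source) :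
    ContMDiffAt I 𝓘(ℝ, E) ∞ (extChartAt I x) y :=
  contMDiffAt_extChartAt' (by rwa [extChartAt_source] at hy)

/-- The chart and its inverse have mutually inverse differentials. This lets the results on
pullbacks of vector fields and of brackets be applied to `coordField`. -/
lemma mpullback_extChartAt_symm {x : N} {p : E} (hp : p ∈ (extChartAt I x).target)
    (X : ∀ y : N, TangentSpace I y) :
    VectorField.mpullback 𝓘(ℝ, E) I (extChartAt I x).symm X p = coordField I x X p := by
  have : IsManifold I 1 N := IsManifold.of_le (n := ∞) (by simp)
  have h1 := isInvertible_mfderivWithin_extChartAt_symm (I := I) hp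
  rw [I.range_eq_univ, mfderivWithin_univ] at h1
  have h3 := mfderivWithin_extChartAt_symm_comp_mfderiv_extChartAt (I := I) hp
  rw [I.range_eq_univ, mfderivWithin_univ] at h3
  exact (ContinuousLinearMap.IsInvertible.inverse_apply_eq h1).2
    (congrArg (fun L ↦ L (X ((extChartAt I x).symm p))) h3).symm

lemma isInvertible_mfderiv_extChartAt_symm {x : N} {p : E} (hp : p ∈ (extChartAt I x).target) :
    (mfderiv 𝓘(ℝ, E) I (extChartAt I x).symm p).IsInvertible := by
  have : IsManifold I 1 N := IsManifold.of_le (n := ∞) (by simp)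
  have h1 := isInvertible_mfderivWithin_extChartAt_symm (I := I) hp
  rwa [I.range_eq_univ, mfderivWithin_univ] at h1

lemma mpullback_extChartAt_symm_eventuallyEq {x : N} {p : E} (hp : p ∈ (extChartAt I x).target)
    (X : ∀ y : N, TangentSpace I y) :
    VectorField.mpullback 𝓘(ℝ, E) I (extChartAt I x).symm X =ᶠ[𝓝 p] coordField I x X := by
  filter_upwards [(isOpen_extChartAt_target x).mem_nhds hp] with q hq
  exact mpullback_extChartAt_symm hq X

lemma contDiffAt_coordField {x y : N} (hy : y ∈ (extChartAt I x).source)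
    {X : ∀ y : N, TangentSpace I y}
    (hX : ContMDiffAt I I.tangent ∞ (fun y ↦ (⟨y, X y⟩ : TangentBundle I N)) y) :
    ContDiffAt ℝ ∞ (coordField I x X) (extChartAt I x y) := by
  have : IsManifold I 1 N := IsManifold.of_le (n := ∞) (by simp)
  have hp := (extChartAt I x).map_source hy
  rw [← (extChartAt I x).left_inv hy] at hX
  have := hX.mpullback_vectorField_preimage (contMDiffAt_extChartAt_symm hp)
    (isInvertible_mfderiv_extChartAt_symm hp) (by simp)
  exact (contMDiffAt_vectorSpace_iff_contDiffAt.1 this).congr_of_eventuallyEq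
    (mpullback_extChartAt_symm_eventuallyEq hp X).symm

/-- The vector field on the domain of a chart with a given expression in this chart. -/
noncomputable def ofCoordField (I : ModelWithCorners ℝ E H) (x : N) (Z : E → E) :
    ∀ y : N, TangentSpace I y :=
  VectorField.mpullback I 𝓘(ℝ, E) (extChartAt I x) Z

lemma chartDeriv_ofCoordField {x y : N} (hy : y ∈ (extChartAt I x).source) (Z : E → E) :
    chartDeriv I x y (ofCoordField I x Z y) = Z (extChartAt I x y) := by
  have : IsManifold I 1 N := IsManifold.of_le (n := ∞) (by simp)
  have h := isInvertible_mfderiv_extChartAt (I := I) hy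
  exact ((ContinuousLinearMap.IsInvertible.inverse_apply_eq h).1
    (VectorField.mpullback_apply (I := I) (I' := 𝓘(ℝ, E)) (f := extChartAt I x) (V := Z)
      (x := y)).symm).symm

lemma contMDiffAt_ofCoordField {x y : N} (hy : y ∈ (extChartAt I x).source) {Z : E → E}
    (hZ : ContDiffAt ℝ ∞ Z (extChartAt I x y)) :
    ContMDiffAt I I.tangent ∞ (fun y ↦ (⟨y, ofCoordField I x Z y⟩ : TangentBundle I N)) y := by
  have : IsManifold I 1 N := IsManifold.of_le (n := ∞) (by simp)
  exact (contMDiffAt_vectorSpace_iff_contDiffAt.2 hZ).mpullback_vectorField_preimage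
    (contMDiffAt_extChartAt_of_mem hy) (isInvertible_mfderiv_extChartAt hy) (by simp)

lemma chartDeriv_injective {x y : N} (hy : y ∈ (extChartAt I x).source) :
    Function.Injective (chartDeriv I x y) := by
  have : IsManifold I 1 N := IsManifold.of_le (n := ∞) (by simp)
  exact (isInvertible_mfderiv_extChartAt (I := I) hy).injective

lemma contMDiffAt_of_coordField {x y : N} (hy : y ∈ (extChartAt I x).source)
    {X : ∀ y : N, TangentSpace I y}
    (hX : ContDiffAt ℝ ∞ (coordField I x X) (extChartAt I x y)) :
    ContMDiffAt I I.tangent ∞ (fun y ↦ (⟨y, X y⟩ : TangentBundle I N)) y := by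
  refine (contMDiffAt_ofCoordField hy hX).congr_of_eventuallyEq ?_
  filter_upwards [extChartAt_source_mem_nhds' (I := I) hy] with z hz
  congr 1
  refine chartDeriv_injective hz ?_
  rw [chartDeriv_ofCoordField hz, coordField_apply hz]

/-- Brackets are natural under pullback by the inverse chart, and in the model space the manifold
bracket is the ordinary one. -/
lemma chartDeriv_mlieBracket {x y : N} (hy : y ∈ (extChartAt I x).source)
    {X Y : ∀ y : N, TangentSpace I y}
    (hX : MDifferentiableAt I I.tangent (fun y ↦ (⟨y, X y⟩ : TangentBundle I N)) y)
    (hY : MDifferentiableAt I I.tangent (fun y ↦ (⟨y, Y y⟩ : TangentBundle I N)) y) :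
    chartDeriv I x y (VectorField.mlieBracket I X Y y) =
      VectorField.lieBracket ℝ (coordField I x X) (coordField I x Y) (extChartAt I x y) := by
  have : IsManifold I 1 N := IsManifold.of_le (n := ∞) (by simp)
  have : IsManifold I (minSmoothness ℝ 2) N := IsManifold.of_le (n := ∞) minSmoothness_two_le_infty
  have hp := (extChartAt I x).map_source hy
  have hl := (extChartAt I x).left_inv hy
  rw [← hl] at hX hY
  have := VectorField.mpullback_mlieBracket hX hY (n := ∞) (contMDiffAt_extChartAt_symm hp)
    (minSmoothness_two_le_infty)
  rw [← coordField_apply hy, ← mpullback_extChartAt_symm hp, this,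
    ← VectorField.mlieBracketWithin_univ,
    VectorField.mlieBracketWithin_eq_lieBracketWithin]
  refine (congrFun VectorField.lieBracketWithin_univ _).trans ?_
  exact (mpullback_extChartAt_symm_eventuallyEq hp X).lieBracket_vectorField_eq
    (mpullback_extChartAt_symm_eventuallyEq hp Y)

lemma contDiffAt_comp_extChartAt_symm {x y : N} (hy : y ∈ (extChartAt I x).source) {f : N → ℝ}
    {k : WithTop ℕ∞} (hk : k ≤ ∞) (hf : ContMDiffAt I 𝓘(ℝ, ℝ) k f y) :
    ContDiffAt ℝ k (f ∘ (extChartAt I x).symm) (extChartAt I x y) := by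
  rw [← contMDiffAt_iff_contDiffAt]
  rw [← (extChartAt I x).left_inv hy] at hf
  exact hf.comp _ ((contMDiffAt_extChartAt_symm ((extChartAt I x).map_source hy)).of_le hk)

lemma contMDiffAt_comp_extChartAt {x y : N} (hy : y ∈ (extChartAt I x).source) {g : E → ℝ}
    (hg : ContDiffAt ℝ ∞ g (extChartAt I x y)) :
    ContMDiffAt I 𝓘(ℝ, ℝ) ∞ (g ∘ extChartAt I x) y :=
  (contMDiffAt_iff_contDiffAt.2 hg).comp y (contMDiffAt_extChartAt_of_mem hy)

lemma realDeriv_eq_fderiv {x y : N} (hy : y ∈ (extChartAt I x).source) {f : N → ℝ}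
    (hf : MDifferentiableAt I 𝓘(ℝ, ℝ) f y) (ξ : TangentSpace I y) :
    realDeriv I f y ξ = fderiv ℝ (f ∘ (extChartAt I x).symm) (extChartAt I x y)
      (chartDeriv I x y ξ) := by
  have hp := (extChartAt I x).map_source hy
  have hl := (extChartAt I x).left_inv hy
  have h1 : MDifferentiableAt 𝓘(ℝ, E) 𝓘(ℝ, ℝ) (f ∘ (extChartAt I x).symm) (extChartAt I x y) := by
    rw [← hl] at hf
    exact hf.comp _ ((contMDiffAt_extChartAt_symm hp).mdifferentiableAt (by simp))
  have h2 : f =ᶠ[𝓝 y] (f ∘ (extChartAt I x).symm) ∘ extChartAt I x := by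
    filter_upwards [extChartAt_source_mem_nhds' (I := I) hy] with z hz
    simp only [Function.comp_apply, (extChartAt I x).left_inv hz]
  unfold realDeriv
  rw [h2.mfderiv_eq, mfderiv_comp y h1
    ((contMDiffAt_extChartAt_of_mem hy).mdifferentiableAt (by simp)), mfderiv_eq_fderiv]
  rfl

/-- Agreement on a neighbourhood, and not only at the point, is what allows df(X) to be
differentiated once more. -/
lemma realDeriv_apply_comp_extChartAt_symm_eventuallyEq {x y : N}
    (hy : y ∈ (extChartAt I x).source) {f : N → ℝ}
    (hf : ∀ᶠ z in 𝓝 y, MDifferentiableAt I 𝓘(ℝ, ℝ) f z) (X : ∀ y : N, TangentSpace I y) :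
    (fun z ↦ realDeriv I f z (X z)) ∘ (extChartAt I x).symm
      =ᶠ[𝓝 (extChartAt I x y)]
      fun p ↦ fderiv ℝ (f ∘ (extChartAt I x).symm) p (coordField I x X p) := by
  have hp := (extChartAt I x).map_source hy
  have hc := (contMDiffAt_extChartAt_symm (I := I) hp).continuousAt
  have h1 : ∀ᶠ p in 𝓝 (extChartAt I x y),
      MDifferentiableAt I 𝓘(ℝ, ℝ) f ((extChartAt I x).symm p) := by
    refine hc.eventually ?_
    rwa [(extChartAt I x).left_inv hy]
  filter_upwards [h1, (isOpen_extChartAt_target x).mem_nhds hp] with p h2 hpt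
  have h3 := realDeriv_eq_fderiv ((extChartAt I x).map_target hpt) h2
    (X ((extChartAt I x).symm p))
  rw [(extChartAt I x).right_inv hpt] at h3
  exact h3

lemma contMDiffAt_realDeriv_apply {y : N} {f : N → ℝ}
    (hf : ContMDiffAt I 𝓘(ℝ, ℝ) ∞ f y) {X : ∀ y : N, TangentSpace I y}
    (hX : ContMDiffAt I I.tangent ∞ (fun y ↦ (⟨y, X y⟩ : TangentBundle I N)) y) :
    ContMDiffAt I 𝓘(ℝ, ℝ) ∞ (fun z ↦ realDeriv I f z (X z)) y := by
  have : IsManifold I 1 N := IsManifold.of_le (n := ∞) (by simp)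
  have hy := mem_extChartAt_source (I := I) y
  have hfd : ∀ᶠ z in 𝓝 y, MDifferentiableAt I 𝓘(ℝ, ℝ) f z := by
    filter_upwards [(contMDiffAt_iff_contMDiffAt_nhds (n := 1) (by simp)).1
      (hf.of_le (by simp))] with z hz
    exact hz.mdifferentiableAt (by simp)
  have h1 : ContDiffAt ℝ ∞
      ((fun z ↦ realDeriv I f z (X z)) ∘ (extChartAt I y).symm) (extChartAt I y y) :=
    (((contDiffAt_comp_extChartAt_symm hy le_rfl hf).fderiv_right (m := ∞) (by simp)).clm_apply
      (contDiffAt_coordField hy hX)).congr_of_eventuallyEq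
      (realDeriv_apply_comp_extChartAt_symm_eventuallyEq hy hfd X)
  refine (contMDiffAt_comp_extChartAt hy h1).congr_of_eventuallyEq ?_
  filter_upwards [extChartAt_source_mem_nhds (I := I) y] with z hz
  simp only [Function.comp_apply]
  rw [(extChartAt I y).left_inv hz]

/-- The Lie bracket is the commutator of derivations. -/
lemma realDeriv_mlieBracket {y : N} {f : N → ℝ}
    (hf : ContMDiffAt I 𝓘(ℝ, ℝ) ∞ f y) {X Y : ∀ y : N, TangentSpace I y}
    (hX : ContMDiffAt I I.tangent ∞ (fun y ↦ (⟨y, X y⟩ : TangentBundle I N)) y)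
    (hY : ContMDiffAt I I.tangent ∞ (fun y ↦ (⟨y, Y y⟩ : TangentBundle I N)) y) :
    realDeriv I f y (VectorField.mlieBracket I X Y y) =
      realDeriv I (fun z ↦ realDeriv I f z (Y z)) y (X y) -
        realDeriv I (fun z ↦ realDeriv I f z (X z)) y (Y y) := by
  have : IsManifold I 1 N := IsManifold.of_le (n := ∞) (by simp)
  have hy := mem_extChartAt_source (I := I) y
  have hfd : ∀ᶠ z in 𝓝 y, MDifferentiableAt I 𝓘(ℝ, ℝ) f z := by
    filter_upwards [(contMDiffAt_iff_contMDiffAt_nhds (n := 1) (by simp)).1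
      (hf.of_le (by simp))] with z hz
    exact hz.mdifferentiableAt (by simp)
  have key := VectorField.fderiv_apply_lieBracket (contDiffAt_comp_extChartAt_symm hy le_rfl hf)
    (minSmoothness_two_le_infty) ((contDiffAt_coordField hy hY).differentiableAt (by simp))
    ((contDiffAt_coordField hy hX).differentiableAt (by simp))
  rw [realDeriv_eq_fderiv hy (hf.mdifferentiableAt (by simp)),
    chartDeriv_mlieBracket hy (hX.mdifferentiableAt (by simp)) (hY.mdifferentiableAt (by simp)),
    key,
    realDeriv_eq_fderiv hy ((contMDiffAt_realDeriv_apply hf hX).mdifferentiableAt (by simp)),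
    realDeriv_eq_fderiv hy ((contMDiffAt_realDeriv_apply hf hY).mdifferentiableAt (by simp)),
    (realDeriv_apply_comp_extChartAt_symm_eventuallyEq hy hfd X).fderiv_eq,
    (realDeriv_apply_comp_extChartAt_symm_eventuallyEq hy hfd Y).fderiv_eq,
    coordField_apply hy, coordField_apply hy]

end ChartCalculus

/-! ### Bundle charts of TM: local forms of dπ, J and C -/

namespace SprayGeometry

variable {n : ℕ} {M : Type*} [TopologicalSpace M]
  [ChartedSpace (EuclideanSpace ℝ (Fin n)) M] [IsManifold (𝓡 n) ∞ M]

lemma mem_chart_source_iff {w u : TM n M} : u ∈ (extChartAt (𝓡 n).tangent w).source ↔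
    u.proj ∈ (extChartAt (𝓡 n) w.proj).source := by
  rw [extChartAt_source, extChartAt_source]
  exact TangentBundle.mem_chart_source_iff u w

lemma chart_apply (w u : TM n M) : extChartAt (𝓡 n).tangent w u =
    (extChartAt (𝓡 n) w.proj u.proj, tangentCoordChange (𝓡 n) u.proj w.proj u.proj u.2) := rfl

lemma mfderiv_base_chart {x y : M} (hy : y ∈ (extChartAt (𝓡 n) x).source) :
    mfderiv (𝓡 n) 𝓘(ℝ, EuclideanSpace ℝ (Fin n)) (extChartAt (𝓡 n) x) y =
      tangentCoordChange (𝓡 n) y x y := by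
  have := mdifferentiableAt_extChartAt (I := 𝓡 n) (by rwa [extChartAt_source] at hy)
  unfold mfderiv
  -- For a differentiable map, `mfderiv` is the derivative of the expression in preferred charts.
  -- Here this is the coordinate change from the chart at y to the chart at x, which defines
  -- `tangentCoordChange`.
  exact if_pos this

lemma tangentCoordChange_injective {x y : M} (hy : y ∈ (extChartAt (𝓡 n) x).source) :
    Function.Injective (tangentCoordChange (𝓡 n) y x y) := by
  rw [← mfderiv_base_chart hy]
  exact (isInvertible_mfderiv_extChartAt hy).injective

lemma tangentCoordChange_surjective {x y : M} (hy : y ∈ (extChartAt (𝓡 n) x).source) :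
    Function.Surjective (tangentCoordChange (𝓡 n) y x y) := by
  rw [← mfderiv_base_chart hy]
  exact (isInvertible_mfderiv_extChartAt hy).surjective

/-- Base chart ∘ π and first projection ∘ bundle chart are the same map. The chain rule for its two
factorizations gives the two sides. -/
lemma chartDeriv_fst {w u : TM n M} (hu : u ∈ (extChartAt (𝓡 n).tangent w).source) (ξ : TTM u) :
    (chartDeriv (𝓡 n).tangent w u ξ).1 =
      tangentCoordChange (𝓡 n) u.proj w.proj u.proj (dproj u ξ) := by
  have hb := mem_chart_source_iff.1 hu
  have h1 : (Prod.fst : EuclideanSpace ℝ (Fin n) × EuclideanSpace ℝ (Fin n) → _) ∘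
      extChartAt (𝓡 n).tangent w = extChartAt (𝓡 n) w.proj ∘ Bundle.TotalSpace.proj := rfl
  have h2 := mfderiv_comp (I := (𝓡 n).tangent)
    (I' := 𝓘(ℝ, EuclideanSpace ℝ (Fin n) × EuclideanSpace ℝ (Fin n)))
    (I'' := 𝓘(ℝ, EuclideanSpace ℝ (Fin n))) u
    (g := (Prod.fst : EuclideanSpace ℝ (Fin n) × EuclideanSpace ℝ (Fin n) → _))
    (differentiableAt_fst.mdifferentiableAt)
    ((contMDiffAt_extChartAt_of_mem hu).mdifferentiableAt (by simp))
  have h3 := mfderiv_comp (I := (𝓡 n).tangent) (I' := 𝓡 n)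
    (I'' := 𝓘(ℝ, EuclideanSpace ℝ (Fin n))) u (f := (Bundle.TotalSpace.proj : TM n M → M))
    ((contMDiffAt_extChartAt_of_mem hb).mdifferentiableAt (by simp))
    ((Bundle.contMDiff_proj (n := 1) (TangentSpace (𝓡 n) : M → Type _)).mdifferentiableAt
      (by simp))
  rw [h1, h3, mfderiv_eq_fderiv, fderiv_fst] at h2
  have h4 := congrArg (fun L ↦ L ξ) h2
  rw [← mfderiv_base_chart hb]
  exact h4.symm

lemma chart_fibre (w : TM n M) (x : M) :
    (extChartAt (𝓡 n).tangent w ∘ fun a : EuclideanSpace ℝ (Fin n) ↦ (⟨x, a⟩ : TM n M)) =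
      fun a ↦ (extChartAt (𝓡 n) w.proj x, tangentCoordChange (𝓡 n) x w.proj x a) := rfl

lemma fibre_eq {w : TM n M} {x : M} (hx : x ∈ (extChartAt (𝓡 n) w.proj).source) :
    (fun a : EuclideanSpace ℝ (Fin n) ↦ (⟨x, a⟩ : TM n M)) =
      (extChartAt (𝓡 n).tangent w).symm ∘ fun a : EuclideanSpace ℝ (Fin n) ↦
        (extChartAt (𝓡 n) w.proj x, tangentCoordChange (𝓡 n) x w.proj x a) := by
  rw [← chart_fibre]
  funext a
  exact ((extChartAt (𝓡 n).tangent w).left_inv (mem_chart_source_iff.2 hx)).symm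

lemma hasFDerivAt_fibre_coord (w : TM n M) (x : M) (a : EuclideanSpace ℝ (Fin n)) :
    HasFDerivAt (fun a ↦ (extChartAt (𝓡 n) w.proj x, tangentCoordChange (𝓡 n) x w.proj x a))
      ((ContinuousLinearMap.inr ℝ (EuclideanSpace ℝ (Fin n)) (EuclideanSpace ℝ (Fin n))).comp
        (tangentCoordChange (𝓡 n) x w.proj x)) a := by
  refine ((hasFDerivAt_const (extChartAt (𝓡 n) w.proj x) a).prodMk
    (tangentCoordChange (𝓡 n) x w.proj x).hasFDerivAt).congr_fderiv ?_
  ext <;> rfl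

lemma contMDiff_fibre (x : M) : ContMDiff 𝓘(ℝ, EuclideanSpace ℝ (Fin n)) (𝓡 n).tangent ∞
    (fun a : EuclideanSpace ℝ (Fin n) ↦ (⟨x, a⟩ : TM n M)) := by
  intro a
  have hx := mem_extChartAt_source (I := 𝓡 n) x
  have hw : (⟨x, a⟩ : TM n M) ∈ (extChartAt (𝓡 n).tangent (⟨x, 0⟩ : TM n M)).source :=
    mem_chart_source_iff.2 hx
  rw [fibre_eq (w := ⟨x, 0⟩) hx]
  refine (contMDiffAt_extChartAt_symm ((extChartAt (𝓡 n).tangent _).map_source hw)).comp a ?_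
  rw [contMDiffAt_iff_contDiffAt]
  fun_prop

lemma chartDeriv_vlift {w u : TM n M} (hu : u ∈ (extChartAt (𝓡 n).tangent w).source)
    (a : TangentSpace (𝓡 n) u.proj) :
    chartDeriv (𝓡 n).tangent w u (vlift u a) =
      (0, tangentCoordChange (𝓡 n) u.proj w.proj u.proj a) := by
  have h1 := mfderiv_comp (I := 𝓘(ℝ, EuclideanSpace ℝ (Fin n))) (I' := (𝓡 n).tangent)
    (I'' := 𝓘(ℝ, EuclideanSpace ℝ (Fin n) × EuclideanSpace ℝ (Fin n))) (vec u)
    (g := extChartAt (𝓡 n).tangent w)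
    (f := fun a : EuclideanSpace ℝ (Fin n) ↦ (⟨u.proj, a⟩ : TM n M))
    ((contMDiffAt_extChartAt_of_mem hu).mdifferentiableAt (by simp))
    ((contMDiff_fibre u.proj).mdifferentiableAt (by simp))
  rw [chart_fibre, mfderiv_eq_fderiv, (hasFDerivAt_fibre_coord w u.proj (vec u)).fderiv] at h1
  exact (congrArg (fun L ↦ L a) h1).symm

lemma chartDeriv_J {w u : TM n M} (hu : u ∈ (extChartAt (𝓡 n).tangent w).source) (ξ : TTM u) :
    chartDeriv (𝓡 n).tangent w u (J u ξ) = (0, (chartDeriv (𝓡 n).tangent w u ξ).1) := by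
  rw [chartDeriv_fst hu]
  exact chartDeriv_vlift hu _

lemma chartDeriv_liouville {w u : TM n M} (hu : u ∈ (extChartAt (𝓡 n).tangent w).source) :
    chartDeriv (𝓡 n).tangent w u (liouville u) = (0, (extChartAt (𝓡 n).tangent w u).2) :=
  chartDeriv_vlift hu _

lemma mem_Vert_iff {w u : TM n M} (hu : u ∈ (extChartAt (𝓡 n).tangent w).source) (ξ : TTM u) :
    ξ ∈ Vert u ↔ (chartDeriv (𝓡 n).tangent w u ξ).1 = 0 := by
  rw [chartDeriv_fst hu]
  exact ((map_eq_zero_iff _ (tangentCoordChange_injective (mem_chart_source_iff.1 hu)))).symm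

lemma mem_slit_iff {w u : TM n M} (hu : u ∈ (extChartAt (𝓡 n).tangent w).source) :
    u ∈ slit n M ↔ (extChartAt (𝓡 n).tangent w u).2 ≠ 0 := by
  rw [chart_apply]
  exact (map_ne_zero_iff _ (tangentCoordChange_injective (mem_chart_source_iff.1 hu))).symm

lemma isOpen_slit : IsOpen (slit n M) := by
  rw [isOpen_iff_mem_nhds]
  intro u hu
  have h0 := mem_extChartAt_source (I := (𝓡 n).tangent) u
  have h1 : ContinuousAt (fun v ↦ (extChartAt (𝓡 n).tangent u v).2) u :=
    continuousAt_snd.comp (continuousAt_extChartAt u)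
  filter_upwards [extChartAt_source_mem_nhds (I := (𝓡 n).tangent) u,
    h1.eventually_ne ((mem_slit_iff h0).1 hu)] with v hv hv2
  exact (mem_slit_iff hv).2 hv2

end SprayGeometry

/-! ### Smooth fields and brackets on the slit tangent bundle -/

namespace SprayGeometry

variable {n : ℕ} {M : Type*} [TopologicalSpace M]
  [ChartedSpace (EuclideanSpace ℝ (Fin n)) M] [IsManifold (𝓡 n) ∞ M]

/-- Smoothness of a vector field on `TM` at a point. -/
def SmoothFieldAt (X : ∀ u : TM n M, TTM u) (u : TM n M) : Prop :=
  ContMDiffAt (𝓡 n).tangent (𝓡 n).tangent.tangent ∞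
    (fun u ↦ (⟨u, X u⟩ : TangentBundle (𝓡 n).tangent (TM n M))) u

variable {X Y Z S : ∀ u : TM n M, TTM u} {f : TM n M → ℝ} {u w : TM n M}

lemma IsSmoothField.smoothFieldAt (hX : IsSmoothField X) (hu : u ∈ slit n M) :
    SmoothFieldAt X u :=
  ContMDiffOn.contMDiffAt hX (isOpen_slit.mem_nhds hu)

lemma isSmoothField_of_forall (h : ∀ u ∈ slit n M, SmoothFieldAt X u) : IsSmoothField X :=
  fun u hu ↦ (h u hu).contMDiffWithinAt

lemma SmoothFieldAt.mdifferentiableAt (hX : SmoothFieldAt X u) :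
    MDifferentiableAt (𝓡 n).tangent (𝓡 n).tangent.tangent
      (fun u ↦ (⟨u, X u⟩ : TangentBundle (𝓡 n).tangent (TM n M))) u :=
  ContMDiffAt.mdifferentiableAt hX (by simp)

lemma SmoothFieldAt.add (hX : SmoothFieldAt X u) (hY : SmoothFieldAt Y u) :
    SmoothFieldAt (fun v ↦ X v + Y v) u :=
  ContMDiffAt.add_section hX hY

lemma SmoothFieldAt.const_smul (c : ℝ) (hX : SmoothFieldAt X u) :
    SmoothFieldAt (fun v ↦ c • X v) u :=
  ContMDiffAt.const_smul_section hX

lemma SmoothFieldAt.bracket (hX : SmoothFieldAt X u) (hY : SmoothFieldAt Y u) :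
    SmoothFieldAt (SprayGeometry.bracket X Y) u := by
  have h : IsManifold (𝓡 n).tangent (((⊤ : ℕ∞) : WithTop ℕ∞) + 1) (TM n M) :=
    inferInstanceAs (IsManifold (𝓡 n).tangent ∞ (TM n M))
  have h2 : IsManifold (𝓡 n).tangent (minSmoothness ℝ 2) (TM n M) :=
    IsManifold.of_le (n := ∞) minSmoothness_two_le_infty
  refine ContMDiffAt.mlieBracket_vectorField (m := ⊤) (n := ⊤) hX hY ?_
  rw [minSmoothness_of_isRCLikeNormedField]
  rfl

lemma IsSmoothField.bracket (hX : IsSmoothField X) (hY : IsSmoothField Y) :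
    IsSmoothField (SprayGeometry.bracket X Y) :=
  isSmoothField_of_forall fun _ hu ↦ (hX.smoothFieldAt hu).bracket (hY.smoothFieldAt hu)

lemma chartDeriv_bracket (hu : u ∈ (extChartAt (𝓡 n).tangent w).source) (hX : SmoothFieldAt X u)
    (hY : SmoothFieldAt Y u) :
    chartDeriv (𝓡 n).tangent w u (SprayGeometry.bracket X Y u) =
      VectorField.lieBracket ℝ (coordField (𝓡 n).tangent w X) (coordField (𝓡 n).tangent w Y)
        (extChartAt (𝓡 n).tangent w u) :=
  chartDeriv_mlieBracket hu hX.mdifferentiableAt hY.mdifferentiableAt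

/-- A bracket depends only on germs, and the slit bundle is open. Values on the zero section are
thus irrelevant. -/
lemma bracket_congr {X' Y' : ∀ u : TM n M, TTM u} (hX : ∀ v ∈ slit n M, X v = X' v)
    (hY : ∀ v ∈ slit n M, Y v = Y' v) (hu : u ∈ slit n M) :
    SprayGeometry.bracket X Y u = SprayGeometry.bracket X' Y' u :=
  Filter.EventuallyEq.mlieBracket_vectorField_eq
    (by filter_upwards [isOpen_slit.mem_nhds hu] with v hv using hX v hv)
    (by filter_upwards [isOpen_slit.mem_nhds hu] with v hv using hY v hv)

lemma bracket_swap : SprayGeometry.bracket X Y u = - SprayGeometry.bracket Y X u :=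
  VectorField.mlieBracket_swap_apply

lemma bracket_jacobi (hX : SmoothFieldAt X u) (hY : SmoothFieldAt Y u) (hZ : SmoothFieldAt Z u) :
    SprayGeometry.bracket X (SprayGeometry.bracket Y Z) u =
      SprayGeometry.bracket (SprayGeometry.bracket X Y) Z u +
        SprayGeometry.bracket Y (SprayGeometry.bracket X Z) u := by
  have h : IsManifold (𝓡 n).tangent (minSmoothness ℝ 3) (TM n M) :=
    IsManifold.of_le (n := ∞) minSmoothness_three_le_infty
  exact VectorField.leibniz_identity_mlieBracket_apply
    (ContMDiffAt.of_le hX minSmoothness_two_le_infty)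
    (ContMDiffAt.of_le hY minSmoothness_two_le_infty)
    (ContMDiffAt.of_le hZ minSmoothness_two_le_infty)

lemma coordField_Jfield {p : EuclideanSpace ℝ (Fin n) × EuclideanSpace ℝ (Fin n)}
    (hp : p ∈ (extChartAt (𝓡 n).tangent w).target) :
    coordField (𝓡 n).tangent w (Jfield X) p = (0, (coordField (𝓡 n).tangent w X p).1) :=
  chartDeriv_J ((extChartAt (𝓡 n).tangent w).map_target hp) _

lemma coordField_liouville {p : EuclideanSpace ℝ (Fin n) × EuclideanSpace ℝ (Fin n)}
    (hp : p ∈ (extChartAt (𝓡 n).tangent w).target) :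
    coordField (𝓡 n).tangent w liouville p = (0, p.2) := by
  have := chartDeriv_liouville ((extChartAt (𝓡 n).tangent w).map_target hp)
  rwa [(extChartAt (𝓡 n).tangent w).right_inv hp] at this

lemma target_mem_nhds (hu : u ∈ (extChartAt (𝓡 n).tangent w).source) :
    (extChartAt (𝓡 n).tangent w).target ∈ 𝓝 (extChartAt (𝓡 n).tangent w u) :=
  (isOpen_extChartAt_target w).mem_nhds ((extChartAt (𝓡 n).tangent w).map_source hu)

lemma coordField_Jfield_eventuallyEq (X : ∀ u : TM n M, TTM u)
    (hu : u ∈ (extChartAt (𝓡 n).tangent w).source) :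
    coordField (𝓡 n).tangent w (Jfield X) =ᶠ[𝓝 (extChartAt (𝓡 n).tangent w u)]
      fun p ↦ (0, (coordField (𝓡 n).tangent w X p).1) := by
  filter_upwards [target_mem_nhds hu] with p hp using coordField_Jfield hp

lemma coordField_liouville_eventuallyEq (hu : u ∈ (extChartAt (𝓡 n).tangent w).source) :
    coordField (𝓡 n).tangent w liouville =ᶠ[𝓝 (extChartAt (𝓡 n).tangent w u)]
      fun p ↦ (0, p.2) := by
  filter_upwards [target_mem_nhds hu] with p hp using coordField_liouville hp

/-- A property of all points of the slit tangent bundle, read in a chart. -/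
lemma eventually_of_forall_slit (hu : u ∈ (extChartAt (𝓡 n).tangent w).source) (hs : u ∈ slit n M)
    {p : TM n M → Prop} (h : ∀ v ∈ slit n M, p v) :
    ∀ᶠ q in 𝓝 (extChartAt (𝓡 n).tangent w u), p ((extChartAt (𝓡 n).tangent w).symm q) ∧
      q ∈ (extChartAt (𝓡 n).tangent w).target := by
  have hc := (contMDiffAt_extChartAt_symm ((extChartAt (𝓡 n).tangent w).map_source hu)).continuousAt
  have h1 := hc.eventually_mem (s := slit n M) (by
    rw [(extChartAt (𝓡 n).tangent w).left_inv hu]; exact isOpen_slit.mem_nhds hs)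
  filter_upwards [h1, target_mem_nhds hu] with q hq hqt
  exact ⟨h _ hq, hqt⟩

lemma coordField_vertical_eventuallyEq (hu : u ∈ (extChartAt (𝓡 n).tangent w).source)
    (hs : u ∈ slit n M) (hX : ∀ v ∈ slit n M, X v ∈ Vert v) :
    (fun p ↦ (coordField (𝓡 n).tangent w X p).1) =ᶠ[𝓝 (extChartAt (𝓡 n).tangent w u)]
      fun _ ↦ 0 := by
  filter_upwards [eventually_of_forall_slit hu hs hX] with p hp
  exact (mem_Vert_iff ((extChartAt (𝓡 n).tangent w).map_target hp.2) _).1 hp.1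

/-- This is J S = C in a chart, where J(a, b) = (0, a) and C = (0, y). -/
lemma coordField_spray_eventuallyEq (hu : u ∈ (extChartAt (𝓡 n).tangent w).source)
    (hs : u ∈ slit n M) (hS : IsSpray S) :
    (fun p ↦ (coordField (𝓡 n).tangent w S p).1) =ᶠ[𝓝 (extChartAt (𝓡 n).tangent w u)]
      fun p ↦ p.2 := by
  filter_upwards [eventually_of_forall_slit hu hs hS.J_eq] with p hp
  have h1 : coordField (𝓡 n).tangent w (Jfield S) p = coordField (𝓡 n).tangent w liouville p :=
    congrArg (chartDeriv (𝓡 n).tangent w _) hp.1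
  rw [coordField_Jfield hp.2, coordField_liouville hp.2] at h1
  exact congrArg Prod.snd h1

lemma SmoothFieldAt.jfield (hX : SmoothFieldAt X u) : SmoothFieldAt (Jfield X) u := by
  have hu := mem_extChartAt_source (I := (𝓡 n).tangent) u
  refine contMDiffAt_of_coordField hu (ContDiffAt.congr_of_eventuallyEq ?_
    (coordField_Jfield_eventuallyEq X hu))
  exact contDiffAt_const.prodMk (contDiffAt_coordField hu hX).fst

lemma smoothFieldAt_liouville (u : TM n M) : SmoothFieldAt liouville u := by
  have hu := mem_extChartAt_source (I := (𝓡 n).tangent) u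
  refine contMDiffAt_of_coordField hu (ContDiffAt.congr_of_eventuallyEq ?_
    (coordField_liouville_eventuallyEq hu))
  fun_prop

lemma isSmoothField_liouville : IsSmoothField (liouville : ∀ u : TM n M, TTM u) :=
  isSmoothField_of_forall fun u _ ↦ smoothFieldAt_liouville u

lemma SmoothFieldAt.differentiableAt_coordField (hX : SmoothFieldAt X u)
    (hu : u ∈ (extChartAt (𝓡 n).tangent w).source) :
    DifferentiableAt ℝ (coordField (𝓡 n).tangent w X) (extChartAt (𝓡 n).tangent w u) :=
  (contDiffAt_coordField hu hX).differentiableAt (by simp)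

end SprayGeometry

lemma fderiv_apply_fst_of_eventuallyEq {A B C : Type*} [NormedAddCommGroup A] [NormedSpace ℝ A]
    [NormedAddCommGroup B] [NormedSpace ℝ B] [NormedAddCommGroup C] [NormedSpace ℝ C]
    {f : A → B × C} {g : A → B} {p : A} (hf : DifferentiableAt ℝ f p)
    (h : (fun q ↦ (f q).1) =ᶠ[𝓝 p] g) (v : A) : (fderiv ℝ f p v).1 = fderiv ℝ g p v := by
  rw [← h.fderiv_eq, hf.hasFDerivAt.fst.fderiv]
  rfl

lemma fderiv_apply_snd_of_eventuallyEq {A B C : Type*} [NormedAddCommGroup A] [NormedSpace ℝ A]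
    [NormedAddCommGroup B] [NormedSpace ℝ B] [NormedAddCommGroup C] [NormedSpace ℝ C]
    {f : A → B × C} {g : A → C} {p : A} (hf : DifferentiableAt ℝ f p)
    (h : (fun q ↦ (f q).2) =ᶠ[𝓝 p] g) (v : A) : (fderiv ℝ f p v).2 = fderiv ℝ g p v := by
  rw [← h.fderiv_eq, hf.hasFDerivAt.snd.fderiv]
  rfl

/-! ### Sprays: identities between J, C, S and the projectors -/

namespace SprayGeometry

variable {n : ℕ} {M : Type*} [TopologicalSpace M]
  [ChartedSpace (EuclideanSpace ℝ (Fin n)) M] [IsManifold (𝓡 n) ∞ M]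
variable {X Y Z S : ∀ u : TM n M, TTM u} {f : TM n M → ℝ} {u w : TM n M}

/-- `J [X, S] = X` for a vertical field `X`. -/
lemma J_bracket_spray_of_vertical (hS : IsSpray S) (hX : IsSmoothField X)
    (hV : ∀ v ∈ slit n M, X v ∈ Vert v) (hs : u ∈ slit n M) :
    J u (SprayGeometry.bracket X S u) = X u := by
  have hu := mem_extChartAt_source (I := (𝓡 n).tangent) u
  have hXu := hX.smoothFieldAt hs
  have hSu := hS.smooth.smoothFieldAt hs
  refine chartDeriv_injective hu ?_
  rw [chartDeriv_J hu, chartDeriv_bracket hu hXu hSu, VectorField.lieBracket_eq]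
  refine Prod.ext ((mem_Vert_iff hu _).1 (hV u hs)).symm ?_
  rw [Prod.fst_sub, fderiv_apply_fst_of_eventuallyEq (hSu.differentiableAt_coordField hu)
    (coordField_spray_eventuallyEq hu hs hS),
    fderiv_apply_fst_of_eventuallyEq (hXu.differentiableAt_coordField hu)
    (coordField_vertical_eventuallyEq hu hs hV), coordField_apply hu]
  simp [fderiv_snd]

lemma Jfield_eq_zero_of_vertical (hX : X u ∈ Vert u) : Jfield X u = 0 := by
  change vlift u (dproj u (X u)) = 0
  rw [LinearMap.mem_ker.1 hX, map_zero]

lemma J_mem_Vert (ξ : TTM u) : J u ξ ∈ Vert u := by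
  have hu := mem_extChartAt_source (I := (𝓡 n).tangent) u
  rw [mem_Vert_iff hu, chartDeriv_J hu]

lemma liouville_mem_Vert : liouville u ∈ Vert u := by
  have hu := mem_extChartAt_source (I := (𝓡 n).tangent) u
  rw [mem_Vert_iff hu, chartDeriv_liouville hu]

/-- The values of the vertical projector are vertical. -/
lemma vproj_mem_Vert (hS : IsSpray S) (hX : IsSmoothField X) (hs : u ∈ slit n M) :
    vproj S X u ∈ Vert u := by
  have hu := mem_extChartAt_source (I := (𝓡 n).tangent) u
  have hXu := hX.smoothFieldAt hs
  have hSu := hS.smooth.smoothFieldAt hs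
  refine Submodule.smul_mem _ _ ?_
  unfold Gam
  -- Grouped as (X - [JX, S]) + J[X, S]: the last term is vertical, and [JX, S] has the same base
  -- component as X, since S = (y, *) and JX = (0, X¹).
  rw [← sub_add]
  refine Submodule.add_mem _ ?_ (J_mem_Vert _)
  rw [mem_Vert_iff hu, map_sub, chartDeriv_bracket hu hXu.jfield hSu, VectorField.lieBracket_eq,
    Prod.fst_sub, Prod.fst_sub,
    fderiv_apply_fst_of_eventuallyEq (hSu.differentiableAt_coordField hu)
    (coordField_spray_eventuallyEq hu hs hS),
    fderiv_apply_fst_of_eventuallyEq (hXu.jfield.differentiableAt_coordField hu)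
    (coordField_vertical_eventuallyEq hu hs (fun v _ ↦ J_mem_Vert (X v))), coordField_apply hu]
  have : chartDeriv (𝓡 n).tangent u u (Jfield X u) = (0, (chartDeriv (𝓡 n).tangent u u (X u)).1) :=
    chartDeriv_J hu _
  rw [this]
  simp [fderiv_snd]

/-- The vertical projector is the identity on vertical fields. -/
lemma vproj_of_vertical (hS : IsSpray S) (hX : IsSmoothField X)
    (hV : ∀ v ∈ slit n M, X v ∈ Vert v) (hs : u ∈ slit n M) : vproj S X u = X u := by
  have h1 : SprayGeometry.bracket (Jfield X) S u = 0 := by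
    rw [bracket_congr (X' := 0) (Y' := S)
      (fun v hv ↦ Jfield_eq_zero_of_vertical (hV v hv)) (fun _ _ ↦ rfl) hs]
    exact congrFun VectorField.mlieBracket_zero_left u
  unfold vproj Gam
  rw [h1, J_bracket_spray_of_vertical hS hX hV hs, zero_sub, sub_neg_eq_add, ← two_smul ℝ (X u),
    smul_smul]
  norm_num

/-- `[C, J] = -J`. -/
lemma bracket_liouville_Jfield (hX : SmoothFieldAt X u) :
    SprayGeometry.bracket liouville (Jfield X) u =
      J u (SprayGeometry.bracket liouville X u) - J u (X u) := by
  have hu := mem_extChartAt_source (I := (𝓡 n).tangent) u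
  have hC := smoothFieldAt_liouville u
  refine chartDeriv_injective hu ?_
  rw [map_sub, chartDeriv_J hu, chartDeriv_J hu, chartDeriv_bracket hu hC hX.jfield,
    chartDeriv_bracket hu hC hX, VectorField.lieBracket_eq, VectorField.lieBracket_eq]
  beta_reduce
  rw [coordField_apply hu, coordField_apply hu, coordField_apply hu]
  have e1 := coordField_liouville_eventuallyEq (n := n) (M := M) hu
  have e2 := coordField_Jfield_eventuallyEq X hu
  have e3 : chartDeriv (𝓡 n).tangent u u (Jfield X u) =
    (0, (chartDeriv (𝓡 n).tangent u u (X u)).1) := chartDeriv_J hu _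
  have hdC := hC.differentiableAt_coordField hu
  have hdX := hX.differentiableAt_coordField hu
  have hdJ := hX.jfield.differentiableAt_coordField hu
  refine Prod.ext ?_ ?_
  · simp only [Prod.fst_sub]
    rw [fderiv_apply_fst_of_eventuallyEq hdJ (e2.mono fun _ h ↦ congrArg Prod.fst h),
      fderiv_apply_fst_of_eventuallyEq hdC (e1.mono fun _ h ↦ congrArg Prod.fst h)]
    simp
  · simp only [Prod.snd_sub, Prod.fst_sub]
    rw [fderiv_apply_snd_of_eventuallyEq hdJ (e2.mono fun _ h ↦ congrArg Prod.snd h),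
      fderiv_apply_snd_of_eventuallyEq hdC (e1.mono fun _ h ↦ congrArg Prod.snd h),
      fderiv_apply_fst_of_eventuallyEq hdX (Filter.EventuallyEq.refl _ _),
      fderiv_apply_fst_of_eventuallyEq hdC (e1.mono fun _ h ↦ congrArg Prod.fst h), e3]
    simp [fderiv_snd]

lemma diff_bracket (hf : ContMDiffAt (𝓡 n).tangent 𝓘(ℝ, ℝ) ∞ f u) (hX : SmoothFieldAt X u)
    (hY : SmoothFieldAt Y u) :
    diff f u (SprayGeometry.bracket X Y u) =
      diff (fun z ↦ diff f z (Y z)) u (X u) - diff (fun z ↦ diff f z (X z)) u (Y u) :=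
  realDeriv_mlieBracket hf hX hY

lemma SmoothFunOn.contMDiffAt (hf : SmoothFunOn f (slit n M)) (hu : u ∈ slit n M) :
    ContMDiffAt (𝓡 n).tangent 𝓘(ℝ, ℝ) ∞ f u :=
  ContMDiffOn.contMDiffAt hf (isOpen_slit.mem_nhds hu)

lemma diff_congr {g : TM n M → ℝ} (h : f =ᶠ[𝓝 u] g) : diff f u = diff g u := by
  unfold diff
  rw [h.mfderiv_eq]

lemma diff_congr_slit {g : TM n M → ℝ} (h : ∀ v ∈ slit n M, f v = g v) (hu : u ∈ slit n M) :
    diff f u = diff g u :=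
  diff_congr (by filter_upwards [isOpen_slit.mem_nhds hu] with v hv using h v hv)

lemma diff_const (c : ℝ) : diff (fun _ : TM n M ↦ c) u = 0 := by
  unfold diff
  rw [mfderiv_const]
  rfl

end SprayGeometry

namespace SprayGeometry

variable {n : ℕ} {M : Type*} [TopologicalSpace M]
  [ChartedSpace (EuclideanSpace ℝ (Fin n)) M] [IsManifold (𝓡 n) ∞ M]
variable {X Y Z S : ∀ u : TM n M, TTM u} {f g : TM n M → ℝ} {u w : TM n M}

lemma diff_const_mul (hf : ContMDiffAt (𝓡 n).tangent 𝓘(ℝ, ℝ) ∞ f u) (c : ℝ) (ξ : TTM u) :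
    diff (fun v ↦ c * f v) u ξ = c * diff f u ξ := by
  have h := (hf.mdifferentiableAt (by simp)).hasMFDerivAt.const_smul c
  exact congrArg (fun L ↦ L ξ) h.mfderiv

lemma diff_mul (hf : ContMDiffAt (𝓡 n).tangent 𝓘(ℝ, ℝ) ∞ f u)
    (hg : ContMDiffAt (𝓡 n).tangent 𝓘(ℝ, ℝ) ∞ g u) (ξ : TTM u) :
    diff (fun v ↦ f v * g v) u ξ = f u * diff g u ξ + g u * diff f u ξ := by
  have h := (hf.mdifferentiableAt (by simp)).hasMFDerivAt.mul
    (hg.mdifferentiableAt (by simp)).hasMFDerivAt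
  exact congrArg (fun L ↦ L ξ) h.mfderiv

lemma bracket_sub_right (hX : SmoothFieldAt Y u) (hZ : SmoothFieldAt Z u) :
    SprayGeometry.bracket X (fun v ↦ Y v - Z v) u =
      SprayGeometry.bracket X Y u - SprayGeometry.bracket X Z u := by
  have h2 : IsManifold (𝓡 n).tangent (minSmoothness ℝ 2) (TM n M) :=
    IsManifold.of_le (n := ∞) minSmoothness_two_le_infty
  have h := VectorField.mlieBracket_add_right (I := (𝓡 n).tangent) (V := X)
    hX.mdifferentiableAt (hZ.const_smul (-1)).mdifferentiableAt
  have h' := VectorField.mlieBracket_const_smul_right (I := (𝓡 n).tangent) (V := X) (c := (-1 : ℝ))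
    hZ.mdifferentiableAt
  have e : (fun v ↦ Y v - Z v) = Y + fun v ↦ (-1 : ℝ) • Z v := by
    funext v
    simp [sub_eq_add_neg]
  unfold SprayGeometry.bracket
  rw [e]
  refine h.trans ?_
  rw [sub_eq_add_neg]
  exact congrArg _ (h'.trans (neg_one_smul ℝ _))

lemma bracket_add_left (hX : SmoothFieldAt X u) (hY : SmoothFieldAt Y u) :
    SprayGeometry.bracket (fun v ↦ X v + Y v) Z u =
      SprayGeometry.bracket X Z u + SprayGeometry.bracket Y Z u :=
  VectorField.mlieBracket_add_left (I := (𝓡 n).tangent) (W := Z)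
    hX.mdifferentiableAt hY.mdifferentiableAt

lemma bracket_add_right (hX : SmoothFieldAt X u) (hY : SmoothFieldAt Y u) :
    SprayGeometry.bracket Z (fun v ↦ X v + Y v) u =
      SprayGeometry.bracket Z X u + SprayGeometry.bracket Z Y u :=
  VectorField.mlieBracket_add_right (I := (𝓡 n).tangent) (V := Z)
    hX.mdifferentiableAt hY.mdifferentiableAt

lemma bracket_smul_right (c : ℝ) (hX : SmoothFieldAt X u) :
    SprayGeometry.bracket Z (fun v ↦ c • X v) u = c • SprayGeometry.bracket Z X u :=
  VectorField.mlieBracket_const_smul_right (I := (𝓡 n).tangent) (V := Z) hX.mdifferentiableAt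

lemma hproj_eq_self_iff : hproj S X u = X u ↔ Gam S X u = X u := by
  unfold hproj
  constructor
  · intro h
    have h2 := congrArg (fun ξ ↦ (2 : ℝ) • ξ) h
    simp only [smul_smul] at h2
    norm_num at h2
    rw [two_smul] at h2
    exact add_left_cancel h2
  · intro h
    rw [h, ← two_smul ℝ (X u), smul_smul]
    norm_num

/-! ### Euler–Lagrange equations and holonomy invariance of the energy -/

section Energy

variable {F : TM n M → ℝ}

lemma contMDiffAt_energy (hF : IsFinsler F) (hs : u ∈ slit n M) :
    ContMDiffAt (𝓡 n).tangent 𝓘(ℝ, ℝ) ∞ (energy F) u := by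
  have h := hF.smooth.contMDiffAt hs
  have : energy F = (fun x : ℝ ↦ (1 / 2 : ℝ) * x ^ 2) ∘ F := rfl
  rw [this]
  have h1 : ContDiff ℝ ∞ (fun x : ℝ ↦ (1 / 2 : ℝ) * x ^ 2) := by fun_prop
  exact h1.contMDiff.contMDiffAt.comp u h

lemma diff_energy (hF : IsFinsler F) (hs : u ∈ slit n M) (ξ : TTM u) :
    diff (energy F) u ξ = F u * diff F u ξ := by
  have h := hF.smooth.contMDiffAt hs
  have e : energy F = fun v ↦ (1 / 2 : ℝ) * (F v * F v) := by
    funext v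
    simp [energy, sq]
  have h2 : ContMDiffAt (𝓡 n).tangent 𝓘(ℝ, ℝ) ∞ (fun v ↦ F v * F v) u := h.mul h
  rw [e, diff_const_mul h2, diff_mul h h]
  ring

lemma diff_energy_liouville (hF : IsFinsler F) (hs : u ∈ slit n M) :
    diff (energy F) u (liouville u) = 2 * energy F u := by
  rw [diff_energy hF hs, hF.homogeneous u hs]
  unfold energy
  ring

/-- The Euler–Lagrange equations. -/
lemma euler_lagrange (hS : IsSpray S) (hF : IsFinsler F) (hFS : IsGeodesicSprayOf S F)
    (hX : IsSmoothField X) (hs : u ∈ slit n M) :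
    diff (dJ (energy F) X) u (S u) - diff (energy F) u (J u (SprayGeometry.bracket S X u)) =
      diff (energy F) u (X u) := by
  have h := hFS X hX u hs
  -- By homogeneity d_J E(S) = 2E and E - L_C E = -E. The two corresponding terms of the equation
  -- combine to a single -dE(X).
  have h1 : diff (dJ (energy F) S) u (X u) = 2 * diff (energy F) u (X u) := by
    rw [diff_congr_slit (g := fun v ↦ 2 * energy F v) _ hs,
      diff_const_mul (contMDiffAt_energy hF hs)]
    intro v hv
    unfold dJ
    rw [hS.J_eq v hv, diff_energy_liouville hF hv]
  have h2 : diff (fun v ↦ energy F v - diff (energy F) v (liouville v)) u (X u) =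
      (-1) * diff (energy F) u (X u) := by
    rw [diff_congr_slit (g := fun v ↦ (-1) * energy F v) _ hs,
      diff_const_mul (contMDiffAt_energy hF hs)]
    intro v hv
    rw [diff_energy_liouville hF hv]
    ring
  unfold ddJ at h
  rw [h1, h2] at h
  unfold dJ at h ⊢
  linarith

/-- The Euler–Lagrange equation at X = S: there [S, S] = 0 and d_J E(S) = 2E, so 2 dE(S) = dE(S). -/
lemma diff_energy_spray (hS : IsSpray S) (hF : IsFinsler F) (hFS : IsGeodesicSprayOf S F)
    (hs : u ∈ slit n M) : diff (energy F) u (S u) = 0 := by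
  have h := euler_lagrange hS hF hFS hS.smooth hs
  have h0 : SprayGeometry.bracket S S u = 0 := congrFun VectorField.mlieBracket_self u
  have h1 : diff (dJ (energy F) S) u (S u) = 2 * diff (energy F) u (S u) := by
    rw [diff_congr_slit (g := fun v ↦ 2 * energy F v) _ hs,
      diff_const_mul (contMDiffAt_energy hF hs)]
    intro v hv
    unfold dJ
    rw [hS.J_eq v hv, diff_energy_liouville hF hv]
  rw [h0, h1, map_zero, map_zero] at h
  linarith

/-- The energy of a Finsler metric is constant along the horizontal distribution of its geodesic
spray. -/
lemma diff_energy_horizontal (hS : IsSpray S) (hF : IsFinsler F) (hFS : IsGeodesicSprayOf S F)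
    (hX : IsHorizontalField S X) (hs : u ∈ slit n M) : diff (energy F) u (X u) = 0 := by
  have hE := contMDiffAt_energy hF hs
  have h1 := euler_lagrange hS hF hFS hX.1 hs
  have h2 := hproj_eq_self_iff.1 (hX.2 u hs)
  -- Horizontality reads [JX, S] = X + J[X, S], and S-invariance of E gives dE([JX, S]) = -S(d_J
  -- E(X)). Comparison with the Euler–Lagrange equation leaves 2 dE(X) = 0.
  have h3 := diff_bracket hE (hX.1.smoothFieldAt hs).jfield (hS.smooth.smoothFieldAt hs)
  rw [diff_congr_slit (f := fun z ↦ diff (energy F) z (S z)) (g := fun _ ↦ 0)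
    (fun v hv ↦ diff_energy_spray hS hF hFS hv) hs, diff_const] at h3
  unfold Gam at h2
  rw [sub_eq_iff_eq_add] at h2
  rw [h2, bracket_swap, map_neg, map_add, map_neg] at h3
  change diff (energy F) u (X u) + _ = 0 - diff (dJ (energy F) X) u (S u) at h3
  linarith

lemma IsHolField.isSmoothField (hY : IsHolField S Y) : IsSmoothField Y := by
  induction hY with
  | horizontal X hX => exact hX.1
  | bracket X Y hX _ ih => exact hX.1.bracket ih

/-- Fields annihilating f are closed under brackets, the bracket being a commutator of derivations.
The hypothesis covers the whole slit bundle because df(X) = 0 gets differentiated. -/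
lemma diff_holField (hf : SmoothFunOn f (slit n M))
    (h : ∀ X, IsHorizontalField S X → ∀ v ∈ slit n M, diff f v (X v) = 0) (hY : IsHolField S Y)
    (hs : u ∈ slit n M) : diff f u (Y u) = 0 := by
  induction hY generalizing u with
  | horizontal X hX => exact h X hX u hs
  | bracket X Y hX hY ih =>
    rw [diff_bracket (hf.contMDiffAt hs) (hX.1.smoothFieldAt hs)
      (hY.isSmoothField.smoothFieldAt hs),
      diff_congr_slit (f := fun z ↦ diff f z (Y z)) (g := fun _ ↦ 0) (fun v hv ↦ ih hv) hs,
      diff_congr_slit (f := fun z ↦ diff f z (X z)) (g := fun _ ↦ 0) (fun v hv ↦ h X hX v hv) hs,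
      diff_const]
    simp

lemma diff_energy_hol (hS : IsSpray S) (hF : IsFinsler F) (hFS : IsGeodesicSprayOf S F)
    (hs : u ∈ slit n M) {ξ : TTM u} (hξ : ξ ∈ Hol S u) : diff (energy F) u ξ = 0 := by
  have hE : SmoothFunOn (energy F) (slit n M) :=
    fun v hv ↦ (contMDiffAt_energy hF hv).contMDiffWithinAt
  have : Hol S u ≤ LinearMap.ker (diff (energy F) u) := by
    refine Submodule.span_le.2 ?_
    rintro _ ⟨Y, hY, rfl⟩
    exact diff_holField hE (fun X hX v hv ↦ diff_energy_horizontal hS hF hFS hX hv) hY hs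
  exact this hξ

lemma energy_pos (hF : IsFinsler F) (hs : u ∈ slit n M) : 0 < energy F u := by
  have := hF.pos u hs
  unfold energy
  positivity

lemma isEnergyFunctionOn_energy (hS : IsSpray S) (hF : IsFinsler F)
    (hFS : IsGeodesicSprayOf S F) : IsEnergyFunctionOn S (energy F) (slit n M) where
  smooth := fun _ hv ↦ (contMDiffAt_energy hF hv).contMDiffWithinAt
  pos := fun _ hu ↦ energy_pos hF hu
  homogeneous := fun _ hu ↦ diff_energy_liouville hF hu
  regular := hF.regular
  holInvariant := fun _ hu _ hξ ↦ diff_energy_hol hS hF hFS hu hξ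

end Energy

/-! ### Involutivity of the holonomy distribution, and of its sum with C -/

section Involutive

/-- Fields which agree on the slit tangent bundle with a linear combination of iterated brackets
of horizontal fields. -/
def IsHolCombination (S Z : ∀ u : TM n M, TTM u) : Prop :=
  ∃ Z' ∈ Submodule.span ℝ {Y | IsHolField S Y}, ∀ u ∈ slit n M, Z u = Z' u

lemma isSmoothField_of_mem_span (hZ : Z ∈ Submodule.span ℝ {Y | IsHolField S Y}) :
    IsSmoothField Z := by
  induction hZ using Submodule.span_induction with
  | mem Y hY => exact IsHolField.isSmoothField hY
  | zero => exact (Bundle.contMDiff_zeroSection (n := ∞) (IB := (𝓡 n).tangent) ℝ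
      (TangentSpace (𝓡 n).tangent : TM n M → Type _)).contMDiffOn
  | add X Y _ _ hX hY =>
    exact isSmoothField_of_forall fun u hu ↦ (hX.smoothFieldAt hu).add (hY.smoothFieldAt hu)
  | smul c X _ hX =>
    exact isSmoothField_of_forall fun u hu ↦ (hX.smoothFieldAt hu).const_smul c

lemma IsHolCombination.of_holField (hY : IsHolField S Y) : IsHolCombination S Y :=
  ⟨Y, Submodule.subset_span hY, fun _ _ ↦ rfl⟩

lemma IsHolCombination.congr (hY : IsHolCombination S Y) (h : ∀ u ∈ slit n M, Z u = Y u) :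
    IsHolCombination S Z := by
  obtain ⟨Y', hY', e⟩ := hY
  exact ⟨Y', hY', fun u hu ↦ (h u hu).trans (e u hu)⟩

lemma IsHolCombination.add (hY : IsHolCombination S Y) (hZ : IsHolCombination S Z) :
    IsHolCombination S (fun u ↦ Y u + Z u) := by
  obtain ⟨Y', hY', e⟩ := hY
  obtain ⟨Z', hZ', e'⟩ := hZ
  exact ⟨Y' + Z', Submodule.add_mem _ hY' hZ', fun u hu ↦ by
    beta_reduce; rw [e u hu, e' u hu]; rfl⟩

lemma IsHolCombination.sub (hY : IsHolCombination S Y) (hZ : IsHolCombination S Z) :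
    IsHolCombination S (fun u ↦ Y u - Z u) := by
  obtain ⟨Y', hY', e⟩ := hY
  obtain ⟨Z', hZ', e'⟩ := hZ
  exact ⟨Y' - Z', Submodule.sub_mem _ hY' hZ', fun u hu ↦ by
    beta_reduce; rw [e u hu, e' u hu]; rfl⟩

lemma IsHolCombination.mem_Hol (hY : IsHolCombination S Y) (hs : u ∈ slit n M) :
    Y u ∈ Hol S u := by
  obtain ⟨Y', hY', e⟩ := hY
  rw [e u hs]
  clear e
  induction hY' using Submodule.span_induction with
  | mem Y hY => exact Submodule.subset_span ⟨Y, hY, rfl⟩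
  | zero => exact Submodule.zero_mem _
  | add X Y _ _ hX hY => exact Submodule.add_mem _ hX hY
  | smul c X _ hX => exact Submodule.smul_mem _ c hX

lemma IsHolCombination.isSmoothField (hY : IsHolCombination S Y) : IsSmoothField Y := by
  obtain ⟨Y', hY', e⟩ := hY
  exact ContMDiffOn.congr (isSmoothField_of_mem_span hY') fun u hu ↦ by rw [e u hu]

/-- Bracketing with X is linear over constants, so a single iterated bracket is enough, and there
the definition of `IsHolField` applies. -/
lemma IsHolCombination.bracket_horizontal (hX : IsHorizontalField S X)
    (hZ : IsHolCombination S Z) : IsHolCombination S (SprayGeometry.bracket X Z) := by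
  obtain ⟨Z', hZ', e⟩ := hZ
  refine IsHolCombination.congr (Y := SprayGeometry.bracket X Z') ?_
    fun u hu ↦ bracket_congr (fun _ _ ↦ rfl) e hu
  clear e
  induction hZ' using Submodule.span_induction with
  | mem Y hY => exact .of_holField (.bracket X Y hX hY)
  | zero =>
    refine ⟨0, Submodule.zero_mem _, fun u _ ↦ ?_⟩
    exact congrFun VectorField.mlieBracket_zero_right u
  | add Y W hY hW h1 h2 =>
    exact (h1.add h2).congr fun u hu ↦ bracket_add_right
      ((isSmoothField_of_mem_span hY).smoothFieldAt hu)
      ((isSmoothField_of_mem_span hW).smoothFieldAt hu)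
  | smul c Y hY h1 =>
    obtain ⟨W, hW, e⟩ := h1
    refine ⟨c • W, Submodule.smul_mem _ c hW, fun u hu ↦ ?_⟩
    refine (bracket_smul_right c ((isSmoothField_of_mem_span hY).smoothFieldAt hu)).trans ?_
    rw [e u hu]
    rfl

/-- The definition allows only horizontal left entries. The Jacobi identity, by induction on the
nesting of X, removes this restriction and gives involutivity. -/
lemma IsHolCombination.bracket_holField (hX : IsHolField S X) (hZ : IsHolCombination S Z) :
    IsHolCombination S (SprayGeometry.bracket X Z) := by
  induction hX generalizing Z with
  | horizontal X hX => exact hZ.bracket_horizontal hX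
  | bracket X Y hX hY ih =>
    have h1 := (ih hZ).bracket_horizontal hX
    have h2 := ih (hZ.bracket_horizontal hX)
    refine (h1.sub h2).congr fun u hu ↦ ?_
    rw [bracket_jacobi (hX.1.smoothFieldAt hu) (hY.isSmoothField.smoothFieldAt hu)
      (hZ.isSmoothField.smoothFieldAt hu), add_sub_cancel_right]

/-- The Lie derivative along the Liouville field preserves horizontal fields. -/
lemma isHorizontalField_bracket_liouville (hS : IsSpray S) (hX : IsHorizontalField S X) :
    IsHorizontalField S (SprayGeometry.bracket liouville X) := by
  refine ⟨isSmoothField_liouville.bracket hX.1, fun u hs ↦ hproj_eq_self_iff.2 ?_⟩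
  have hC := fun {v : TM n M} (_ : v ∈ slit n M) ↦ smoothFieldAt_liouville v
  have hXs := fun {v : TM n M} (hv : v ∈ slit n M) ↦ hX.1.smoothFieldAt hv
  have hSs := fun {v : TM n M} (hv : v ∈ slit n M) ↦ hS.smooth.smoothFieldAt hv
  have hJ := fun {v : TM n M} (hv : v ∈ slit n M) ↦ (hXs hv).jfield
  -- With `e2`, this says that Γ = [J, S] commutes with the Lie derivative along C: the defect in
  -- [C, J] = -J is compensated by [C, S] = S.
  have e1 : SprayGeometry.bracket (Jfield (SprayGeometry.bracket liouville X)) S u =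
      SprayGeometry.bracket liouville (SprayGeometry.bracket (Jfield X) S) u := by
    rw [bracket_congr (X' := fun v ↦ SprayGeometry.bracket liouville (Jfield X) v + Jfield X v)
      (Y' := S) (fun v hv ↦ ?_) (fun _ _ ↦ rfl) hs,
      bracket_add_left ((hC hs).bracket (hJ hs)) (hJ hs),
      bracket_jacobi (hC hs) (hJ hs) (hSs hs),
      bracket_congr (X := Jfield X) (Y := SprayGeometry.bracket liouville S) (X' := Jfield X)
        (Y' := S) (fun _ _ ↦ rfl) hS.bracket_eq hs]
    rw [bracket_liouville_Jfield (hXs hv)]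
    exact (sub_add_cancel _ _).symm
  have e2 : J u (SprayGeometry.bracket (SprayGeometry.bracket liouville X) S u) =
      SprayGeometry.bracket liouville (Jfield (SprayGeometry.bracket X S)) u := by
    rw [bracket_liouville_Jfield ((hXs hs).bracket (hSs hs)),
      bracket_jacobi (hC hs) (hXs hs) (hSs hs),
      bracket_congr (X := X) (Y := SprayGeometry.bracket liouville S) (X' := X)
        (Y' := S) (fun _ _ ↦ rfl) hS.bracket_eq hs, map_add, add_sub_cancel_right]
  unfold Gam
  rw [e1, e2, ← bracket_sub_right ((hJ hs).bracket (hSs hs)) ((hXs hs).bracket (hSs hs)).jfield]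
  exact bracket_congr (fun _ _ ↦ rfl) (fun v hv ↦ hproj_eq_self_iff.1 (hX.2 v hv)) hs

/-- The Lie derivative along C is a derivation of the bracket and preserves horizontal fields, so it
preserves iterated brackets up to sums. Hence Hol + ℝC is involutive. -/
lemma isHolCombination_bracket_liouville (hS : IsSpray S) (hY : IsHolField S Y) :
    IsHolCombination S (SprayGeometry.bracket liouville Y) := by
  induction hY with
  | horizontal X hX =>
    exact .of_holField (.horizontal _ (isHorizontalField_bracket_liouville hS hX))
  | bracket X Y hX hY ih =>
    have h1 := IsHolCombination.of_holField
      (IsHolField.bracket _ Y (isHorizontalField_bracket_liouville hS hX) hY)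
    refine (h1.add (ih.bracket_horizontal hX)).congr fun u hu ↦ ?_
    exact bracket_jacobi (smoothFieldAt_liouville u) (hX.1.smoothFieldAt hu)
      (hY.isSmoothField.smoothFieldAt hu)

end Involutive

end SprayGeometry

/-! ### Vertical fields, Euler's identity and the distribution V_P -/

namespace SprayGeometry

variable {n : ℕ} {M : Type*} [TopologicalSpace M]
  [ChartedSpace (EuclideanSpace ℝ (Fin n)) M] [IsManifold (𝓡 n) ∞ M]
variable {X Y Z S : ∀ u : TM n M, TTM u} {f g : TM n M → ℝ} {u w : TM n M}

lemma mem_target_iff {p : EuclideanSpace ℝ (Fin n) × EuclideanSpace ℝ (Fin n)} :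
    p ∈ (extChartAt (𝓡 n).tangent w).target ↔ p.1 ∈ (extChartAt (𝓡 n) w.proj).target := by
  rw [extChartAt_target, extChartAt_target]
  have h := TangentBundle.mem_chart_target_iff (I := 𝓡 n) (M := M) p w
  simp only [ModelWithCorners.range_eq_univ, inter_univ]
  exact h

lemma contMDiff_proj : ContMDiff (𝓡 n).tangent (𝓡 n) ∞
    (Bundle.TotalSpace.proj : TM n M → M) :=
  Bundle.contMDiff_proj (TangentSpace (𝓡 n) : M → Type _)

/-- Every vertical vector is the value of a smooth vertical vector field. -/
lemma exists_vertical_field [T2Space M] (u : TM n M) {ξ : TTM u} (hξ : ξ ∈ Vert u) :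
    ∃ X : ∀ u : TM n M, TTM u, IsSmoothField X ∧ (∀ v, X v ∈ Vert v) ∧ X u = ξ := by
  have hu := mem_extChartAt_source (I := (𝓡 n).tangent) u
  -- The cutoff may depend on the base point alone, since a bundle chart is defined on full fibres.
  -- The Hausdorff hypothesis keeps its closed support inside the chart domain.
  let χ : SmoothBumpFunction (𝓡 n) u.proj := Classical.choice inferInstance
  let a := (chartDeriv (𝓡 n).tangent u u ξ).2
  let L : ∀ v : TM n M, TTM v := ofCoordField (𝓡 n).tangent u fun _ ↦ (0, a)
  have hsupp : ∀ v : TM n M, v ∉ (extChartAt (𝓡 n).tangent u).source →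
      v.proj ∉ tsupport χ := by
    intro v hv h
    refine hv (mem_chart_source_iff.2 ?_)
    rw [extChartAt_source]
    exact χ.tsupport_subset_chartAt_source h
  refine ⟨fun v ↦ χ v.proj • L v, isSmoothField_of_forall fun v _ ↦ ?_, fun v ↦ ?_, ?_⟩
  · by_cases hv : v ∈ (extChartAt (𝓡 n).tangent u).source
    · have h1 : ContMDiffAt (𝓡 n).tangent 𝓘(ℝ, ℝ) ∞ (fun v : TM n M ↦ χ v.proj) v :=
        (χ.contMDiff.contMDiffAt).comp v contMDiff_proj.contMDiffAt
      exact ContMDiffAt.smul_section h1 (contMDiffAt_ofCoordField hv contDiffAt_const)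
    · have h1 : ∀ᶠ v' : TM n M in 𝓝 v, χ v'.proj = 0 :=
        (contMDiff_proj.continuous.tendsto v).eventually
          (notMem_tsupport_iff_eventuallyEq.1 (hsupp v hv))
      refine ((Bundle.contMDiff_zeroSection (n := ∞) (IB := (𝓡 n).tangent) ℝ
        (TangentSpace (𝓡 n).tangent : TM n M → Type _)) v).congr_of_eventuallyEq ?_
      filter_upwards [h1] with v' hv'
      rw [hv', zero_smul]
      rfl
  · by_cases hv : v ∈ (extChartAt (𝓡 n).tangent u).source
    · refine Submodule.smul_mem _ _ ?_
      rw [mem_Vert_iff hv, chartDeriv_ofCoordField hv]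
    · have : χ v.proj = 0 := image_eq_zero_of_notMem_tsupport (hsupp v hv)
      beta_reduce
      rw [this, zero_smul]
      exact Submodule.zero_mem _
  · refine chartDeriv_injective hu ?_
    beta_reduce
    rw [χ.eq_one, one_smul, chartDeriv_ofCoordField hu]
    exact Prod.ext ((mem_Vert_iff hu ξ).1 hξ).symm rfl

lemma diff_vlift (hf : ContMDiffAt (𝓡 n).tangent 𝓘(ℝ, ℝ) ∞ f u)
    (a : EuclideanSpace ℝ (Fin n)) :
    HasFDerivAt (fun w : EuclideanSpace ℝ (Fin n) ↦ f ⟨u.proj, w⟩)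
      (fderiv ℝ (fun w : EuclideanSpace ℝ (Fin n) ↦ f ⟨u.proj, w⟩) (vec u)) (vec u) ∧
    diff f u (vlift u a) =
      fderiv ℝ (fun w : EuclideanSpace ℝ (Fin n) ↦ f ⟨u.proj, w⟩) (vec u) a := by
  have hfib := (contMDiff_fibre (n := n) (M := M) u.proj).contMDiffAt (x := vec u)
  have h1 : ContMDiffAt 𝓘(ℝ, EuclideanSpace ℝ (Fin n)) 𝓘(ℝ, ℝ) ∞
      (f ∘ fun w : EuclideanSpace ℝ (Fin n) ↦ (⟨u.proj, w⟩ : TM n M)) (vec u) :=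
    ContMDiffAt.comp (I' := (𝓡 n).tangent) (vec u) hf hfib
  refine ⟨((contMDiffAt_iff_contDiffAt.1 h1).differentiableAt (by simp)).hasFDerivAt, ?_⟩
  have h2 := mfderiv_comp (I := 𝓘(ℝ, EuclideanSpace ℝ (Fin n))) (I' := (𝓡 n).tangent)
    (I'' := 𝓘(ℝ, ℝ)) (vec u) (g := f)
    (f := fun w : EuclideanSpace ℝ (Fin n) ↦ (⟨u.proj, w⟩ : TM n M))
    (hf.mdifferentiableAt (by simp)) (hfib.mdifferentiableAt (by simp))
  rw [mfderiv_eq_fderiv] at h2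
  exact (congrArg (fun L ↦ L a) h2).symm

/-- Euler's identity. -/
lemma diff_liouville_of_homogeneous (hf : ContMDiffAt (𝓡 n).tangent 𝓘(ℝ, ℝ) ∞ f u)
    (h : ∀ t : ℝ, 0 < t → f ⟨u.proj, t • u.2⟩ = t * f u) : diff f u (liouville u) = f u := by
  obtain ⟨h1, h2⟩ := diff_vlift hf (vec u)
  refine h2.trans ?_
  have h3 : HasDerivAt (fun t : ℝ ↦ t • vec u) (vec u) 1 := by
    simpa using (hasDerivAt_id (1 : ℝ)).smul_const (vec u)
  have h4 : HasFDerivAt (fun w : EuclideanSpace ℝ (Fin n) ↦ f ⟨u.proj, w⟩)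
      (fderiv ℝ (fun w : EuclideanSpace ℝ (Fin n) ↦ f ⟨u.proj, w⟩) (vec u)) ((1 : ℝ) • vec u) := by
    rwa [one_smul]
  have h5 := h4.comp_hasDerivAt (1 : ℝ) h3
  have h6 : HasDerivAt (fun t : ℝ ↦ t * f u) (f u) 1 := by
    simpa using (hasDerivAt_id (1 : ℝ)).mul_const (f u)
  refine h5.unique (h6.congr_of_eventuallyEq ?_)
  filter_upwards [lt_mem_nhds (zero_lt_one' ℝ)] with t ht
  exact h t ht

section ProjectedVertical

variable {P : TM n M → ℝ}

/-- By Euler's identity dP(C) = P, the correction term makes dP vanish on the values of v_P.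
Conversely, v_P fixes a vertical vector annihilated by dP. -/
lemma VP_eq [T2Space M] (hS : IsSpray S) (hP : SmoothFunOn P (slit n M))
    (hP0 : ∀ u ∈ slit n M, P u ≠ 0) (hP1 : IsHomogeneousOne P) (hs : u ∈ slit n M) :
    VP S P u = Vert u ⊓ LinearMap.ker (diff P u) := by
  have hC := diff_liouville_of_homogeneous (hP.contMDiffAt hs) (hP1 u hs)
  apply le_antisymm
  · refine Submodule.span_le.2 ?_
    rintro _ ⟨X, hX, rfl⟩
    have hv := vproj_mem_Vert hS hX hs
    refine ⟨Submodule.sub_mem _ hv (Submodule.smul_mem _ _ liouville_mem_Vert), ?_⟩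
    refine LinearMap.mem_ker.2 ?_
    unfold vP
    rw [map_sub, map_smul, hC, smul_eq_mul, div_mul_cancel₀ _ (hP0 u hs), sub_self]
  · rintro ξ ⟨hξ, hξP⟩
    obtain ⟨X, hX, hXV, rfl⟩ := exists_vertical_field u hξ
    refine Submodule.subset_span ⟨X, hX, ?_⟩
    unfold vP
    rw [vproj_of_vertical hS hX (fun v _ ↦ hXV v) hs, LinearMap.mem_ker.1 hξP, zero_div, zero_smul,
      sub_zero]

end ProjectedVertical

end SprayGeometry

/-! ### From V_Hol = V_P to F = cP -/

/-- A function on `V × (E \ {0})` is constant if its fibre derivative vanishes and if its derivative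
vanishes along the vectors `(y, 0)` at the points `(x, y)`. -/
lemma exists_eq_const_of_fderiv_eq_zero {E : Type*} [NormedAddCommGroup E] [NormedSpace ℝ E]
    (hE : 1 < Module.rank ℝ E) {V : Set E} (hV : IsOpen V) (hVc : IsPreconnected V)
    {g : E × E → ℝ} (hg : ∀ x ∈ V, ∀ y ≠ 0, DifferentiableAt ℝ g (x, y))
    (h1 : ∀ x ∈ V, ∀ y ≠ 0, ∀ b, fderiv ℝ g (x, y) (0, b) = 0)
    (h2 : ∀ x ∈ V, ∀ y ≠ 0, fderiv ℝ g (x, y) (y, 0) = 0) :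
    ∃ c, ∀ x ∈ V, ∀ y ≠ 0, g (x, y) = c := by
  have hfib : ∀ x ∈ V, ∀ y ≠ 0, ∀ y' ≠ 0, g (x, y) = g (x, y') := by
    intro x hx y hy y' hy'
    have hd : ∀ z ≠ 0, HasFDerivAt (fun z ↦ g (x, z)) (0 : E →L[ℝ] ℝ) z := by
      intro z hz
      refine ((hg x hx z hz).hasFDerivAt.comp z (hasFDerivAt_prodMk_right x z)).congr_fderiv ?_
      ext b
      exact h1 x hx z hz b
    refine isOpen_compl_singleton.is_const_of_fderiv_eq_zero
      (isConnected_compl_singleton_of_one_lt_rank hE (0 : E)).isPreconnected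
      (fun z hz ↦ (hd z hz).differentiableAt.differentiableWithinAt)
      (fun z hz ↦ (hd z hz).fderiv) hy hy'
  have : Nontrivial E := by
    rw [← rank_pos_iff_nontrivial (R := ℝ)]
    exact zero_lt_one.trans hE
  obtain ⟨y₀, hy₀⟩ := exists_ne (0 : E)
  have hd : ∀ y ≠ 0, ∀ x ∈ V, HasFDerivAt (fun x ↦ g (x, y))
      ((fderiv ℝ g (x, y)).comp (ContinuousLinearMap.inl ℝ E E)) x :=
    fun y hy x hx ↦ (hg x hx y hy).hasFDerivAt.comp x (hasFDerivAt_prodMk_left x y)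
  have hd0 : ∀ x ∈ V, HasFDerivAt (fun x ↦ g (x, y₀)) (0 : E →L[ℝ] ℝ) x := by
    intro x hx
    refine (hd y₀ hy₀ x hx).congr_fderiv ?_
    ext a
    by_cases ha : a = 0
    · subst ha
      exact map_zero (fderiv ℝ g (x, y₀))
    · have h3 : (fun x ↦ g (x, y₀)) =ᶠ[𝓝 x] fun x ↦ g (x, a) := by
        filter_upwards [hV.mem_nhds hx] with x' hx' using hfib x' hx' y₀ hy₀ a ha
      have h4 := (hd y₀ hy₀ x hx).unique ((hd a ha x hx).congr_of_eventuallyEq h3)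
      rw [h4]
      exact h2 x hx a ha
  by_cases hne : V.Nonempty
  · obtain ⟨x₀, hx₀⟩ := hne
    refine ⟨g (x₀, y₀), fun x hx y hy ↦ ?_⟩
    rw [hfib x hx y hy y₀ hy₀]
    exact hV.is_const_of_fderiv_eq_zero hVc
      (fun z hz ↦ (hd0 z hz).differentiableAt.differentiableWithinAt)
      (fun z hz ↦ (hd0 z hz).fderiv) hx hx₀
  · exact ⟨0, fun x hx ↦ (hne ⟨x, hx⟩).elim⟩

namespace SprayGeometry

variable {n : ℕ} {M : Type*} [TopologicalSpace M]
  [ChartedSpace (EuclideanSpace ℝ (Fin n)) M] [IsManifold (𝓡 n) ∞ M]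
variable {S : ∀ u : TM n M, TTM u} {g : TM n M → ℝ} {u w : TM n M}

/-- A function on the slit tangent bundle of a connected manifold is constant if its differential
vanishes on the vertical distribution and on a spray. -/
lemma exists_eq_const_of_diff_eq_zero (hn : 2 ≤ n) [ConnectedSpace M] (hS : IsSpray S)
    (hg : SmoothFunOn g (slit n M)) (hV : ∀ u ∈ slit n M, ∀ ξ ∈ Vert u, diff g u ξ = 0)
    (hgS : ∀ u ∈ slit n M, diff g u (S u) = 0) : ∃ c, ∀ u ∈ slit n M, g u = c := by
  have hrank : 1 < Module.rank ℝ (EuclideanSpace ℝ (Fin n)) := by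
    rw [← Module.finrank_eq_rank, finrank_euclideanSpace_fin]
    exact_mod_cast hn
  have hloc : ∀ x₀ : M, ∃ O ∈ 𝓝 x₀, ∃ c, ∀ u ∈ slit n M, u.proj ∈ O → g u = c := by
    intro x₀
    let w : TM n M := ⟨x₀, 0⟩
    obtain ⟨δ, hδ, hball⟩ := Metric.mem_nhds_iff.1
      (extChartAt_target_mem_nhds (I := 𝓡 n) x₀)
    have hmem : ∀ x ∈ Metric.ball (extChartAt (𝓡 n) x₀ x₀) δ, ∀ y ≠ (0 : EuclideanSpace ℝ (Fin n)),
        (x, y) ∈ (extChartAt (𝓡 n).tangent w).target ∧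
        (extChartAt (𝓡 n).tangent w).symm (x, y) ∈ slit n M := by
      intro x hx y hy
      have h1 : (x, y) ∈ (extChartAt (𝓡 n).tangent w).target := mem_target_iff.2 (hball hx)
      refine ⟨h1, ?_⟩
      rw [mem_slit_iff ((extChartAt (𝓡 n).tangent w).map_target h1),
        (extChartAt (𝓡 n).tangent w).right_inv h1]
      exact hy
    let gc := g ∘ (extChartAt (𝓡 n).tangent w).symm
    have hd : ∀ v ∈ (extChartAt (𝓡 n).tangent w).source, v ∈ slit n M →
        DifferentiableAt ℝ gc (extChartAt (𝓡 n).tangent w v) ∧ ∀ ξ : TTM v,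
        fderiv ℝ gc (extChartAt (𝓡 n).tangent w v) (chartDeriv (𝓡 n).tangent w v ξ) =
          diff g v ξ := fun v hv hs ↦
      ⟨(contDiffAt_comp_extChartAt_symm hv le_rfl (hg.contMDiffAt hs)).differentiableAt (by simp),
        fun ξ ↦ (realDeriv_eq_fderiv hv ((hg.contMDiffAt hs).mdifferentiableAt (by simp)) ξ).symm⟩
    have hvert : ∀ v ∈ (extChartAt (𝓡 n).tangent w).source, v ∈ slit n M → ∀ b,
        fderiv ℝ gc (extChartAt (𝓡 n).tangent w v) (0, b) = 0 := by
      intro v hv hs b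
      have h1 := (hd v hv hs).2 (ofCoordField (𝓡 n).tangent w (fun _ ↦ (0, b)) v)
      rw [chartDeriv_ofCoordField hv] at h1
      rw [h1]
      refine hV v hs _ ?_
      rw [mem_Vert_iff hv, chartDeriv_ofCoordField hv]
    have hspray : ∀ v ∈ (extChartAt (𝓡 n).tangent w).source, v ∈ slit n M →
        fderiv ℝ gc (extChartAt (𝓡 n).tangent w v) ((extChartAt (𝓡 n).tangent w v).2, 0) = 0 := by
      intro v hv hs
      have h1 := (hd v hv hs).2 (S v)
      rw [hgS v hs] at h1
      have h2 := (coordField_spray_eventuallyEq hv hs hS).self_of_nhds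
      simp only [coordField_apply hv] at h2
      -- The spray is (y, *) in the chart. Its vertical part does not contribute, so only the
      -- derivative along (y, 0) is left.
      have h3 : ((extChartAt (𝓡 n).tangent w v).2, (0 : EuclideanSpace ℝ (Fin n))) =
          chartDeriv (𝓡 n).tangent w v (S v) - (0, (chartDeriv (𝓡 n).tangent w v (S v)).2) := by
        refine Prod.ext ?_ ?_
        · simp [h2]
        · simp
      rw [h3, map_sub, h1, hvert v hv hs, sub_zero]
    have key : ∀ x ∈ Metric.ball (extChartAt (𝓡 n) x₀ x₀) δ,
        ∀ y ≠ (0 : EuclideanSpace ℝ (Fin n)), DifferentiableAt ℝ gc (x, y) ∧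
        (∀ b, fderiv ℝ gc (x, y) (0, b) = 0) ∧ fderiv ℝ gc (x, y) (y, 0) = 0 := by
      intro x hx y hy
      obtain ⟨h1, h2⟩ := hmem x hx y hy
      have h3 := (extChartAt (𝓡 n).tangent w).map_target h1
      have e := (extChartAt (𝓡 n).tangent w).right_inv h1
      refine ⟨?_, ?_, ?_⟩
      · have := (hd _ h3 h2).1
        rwa [e] at this
      · have := hvert _ h3 h2
        rwa [e] at this
      · have := hspray _ h3 h2
        rwa [e] at this
    obtain ⟨c, hc⟩ := exists_eq_const_of_fderiv_eq_zero hrank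
      (Metric.isOpen_ball (x := extChartAt (𝓡 n) x₀ x₀) (ε := δ))
      (convex_ball _ _).isPreconnected (fun x hx y hy ↦ (key x hx y hy).1)
      (fun x hx y hy ↦ (key x hx y hy).2.1) (fun x hx y hy ↦ (key x hx y hy).2.2)
    refine ⟨(extChartAt (𝓡 n) x₀).source ∩ extChartAt (𝓡 n) x₀ ⁻¹'
      Metric.ball (extChartAt (𝓡 n) x₀ x₀) δ, ?_, c, fun u hs hu ↦ ?_⟩
    · exact inter_mem (extChartAt_source_mem_nhds x₀)
        ((continuousAt_extChartAt x₀).preimage_mem_nhds (Metric.ball_mem_nhds _ hδ))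
    · have hus : u ∈ (extChartAt (𝓡 n).tangent w).source := mem_chart_source_iff.2 hu.1
      have h1 := hc _ hu.2 _ ((mem_slit_iff hus).1 hs)
      rw [← h1]
      exact congrArg g ((extChartAt (𝓡 n).tangent w).left_inv hus).symm
  have hnt : Nontrivial (EuclideanSpace ℝ (Fin n)) := by
    rw [← rank_pos_iff_nontrivial (R := ℝ)]
    exact zero_lt_one.trans hrank
  obtain ⟨a, ha⟩ := exists_ne (0 : EuclideanSpace ℝ (Fin n))
  -- The choice ⟨x, a⟩ need not be continuous in x: it only selects a nonzero vector over each
  -- point, and `hloc` gives local constancy.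
  have hlc : IsLocallyConstant fun x : M ↦ g ⟨x, a⟩ := by
    rw [IsLocallyConstant.iff_eventually_eq]
    intro x
    obtain ⟨O, hO, c, hc⟩ := hloc x
    filter_upwards [hO] with y hy
    rw [hc ⟨y, a⟩ ha hy, hc ⟨x, a⟩ ha (mem_of_mem_nhds hO)]
  obtain ⟨x₀⟩ : Nonempty M := inferInstance
  refine ⟨g ⟨x₀, a⟩, fun u hu ↦ ?_⟩
  obtain ⟨O, hO, c, hc⟩ := hloc u.proj
  rw [hc u hu (mem_of_mem_nhds hO), ← hc ⟨u.proj, a⟩ ha (mem_of_mem_nhds hO)]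
  exact hlc.apply_eq_of_preconnectedSpace _ _

lemma diff_finsler_hol {F : TM n M → ℝ} (hS : IsSpray S) (hF : IsFinsler F)
    (hFS : IsGeodesicSprayOf S F) (hs : u ∈ slit n M) {ξ : TTM u} (hξ : ξ ∈ Hol S u) :
    diff F u ξ = 0 := by
  have h := diff_energy_hol hS hF hFS hs hξ
  rw [diff_energy hF hs] at h
  exact (mul_eq_zero.1 h).resolve_left (hF.pos u hs).ne'

/-- Subtracting from a vertical vector its multiple of C with the same dP-value lands in V_P =
V_Hol, where dF vanishes. So F and P have equal logarithmic derivatives on V, and both are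
S-invariant, which makes F/P constant. Positivity of F gives c ≠ 0. -/
lemma exists_eq_const_mul_of_VHol_eq_VP (hn : 2 ≤ n) [T2Space M] [ConnectedSpace M]
    (hS : IsSpray S) {F P : TM n M → ℝ} (hF : IsFinsler F) (hFS : IsGeodesicSprayOf S F)
    (hP : SmoothFunOn P (slit n M)) (hP0 : ∀ u ∈ slit n M, P u ≠ 0) (hP1 : IsHomogeneousOne P)
    (hPS : IsInvariant S P) (h : ∀ u ∈ slit n M, VHol S u = VP S P u) :
    ∃ c : ℝ, c ≠ 0 ∧ ∀ u ∈ slit n M, F u = c * P u := by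
  have hFP : ∀ u ∈ slit n M, ∀ ξ ∈ Vert u, P u * diff F u ξ = F u * diff P u ξ := by
    intro u hs ξ hξ
    have hC := diff_liouville_of_homogeneous (hP.contMDiffAt hs) (hP1 u hs)
    have h1 : ξ - (diff P u ξ / P u) • liouville u ∈ VP S P u := by
      rw [VP_eq hS hP hP0 hP1 hs]
      refine ⟨Submodule.sub_mem _ hξ (Submodule.smul_mem _ _ liouville_mem_Vert),
        LinearMap.mem_ker.2 ?_⟩
      rw [map_sub, map_smul, hC, smul_eq_mul, div_mul_cancel₀ _ (hP0 u hs), sub_self]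
    rw [← h u hs] at h1
    have h2 := diff_finsler_hol hS hF hFS hs h1.1
    rw [map_sub, map_smul, hF.homogeneous u hs, smul_eq_mul, sub_eq_zero] at h2
    rw [h2]
    field_simp [hP0 u hs]
  let g : TM n M → ℝ := fun u ↦ F u / P u
  have hg : SmoothFunOn g (slit n M) := ContMDiffOn.div₀ hF.smooth hP hP0
  have hdg : ∀ u ∈ slit n M, ∀ ξ,
      P u * (P u * diff g u ξ) = P u * diff F u ξ - F u * diff P u ξ := by
    intro u hs ξ
    have h1 := diff_mul (hP.contMDiffAt hs) (hg.contMDiffAt hs) ξ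
    rw [diff_congr_slit (g := F) (fun v hv ↦ mul_div_cancel₀ _ (hP0 v hv)) hs] at h1
    rw [h1]
    simp only [g]
    field_simp [hP0 u hs]
    ring
  have hzero : ∀ u ∈ slit n M, ∀ ξ, P u * diff F u ξ - F u * diff P u ξ = 0 →
      diff g u ξ = 0 := by
    intro u hs ξ h0
    have := hdg u hs ξ
    rw [h0] at this
    simpa [hP0 u hs] using this
  have hFspray : ∀ u ∈ slit n M, diff F u (S u) = 0 := by
    intro u hs
    have h1 := diff_energy_spray hS hF hFS hs
    rw [diff_energy hF hs] at h1
    exact (mul_eq_zero.1 h1).resolve_left (hF.pos u hs).ne'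
  obtain ⟨c, hc⟩ := exists_eq_const_of_diff_eq_zero hn hS hg
    (fun u hs ξ hξ ↦ hzero u hs ξ (sub_eq_zero.2 (hFP u hs ξ hξ)))
    (fun u hs ↦ hzero u hs _ (by rw [hFspray u hs, hPS u hs]; simp))
  have hc' : ∀ u ∈ slit n M, F u = c * P u := fun u hs ↦ by
    rw [← hc u hs]
    exact (div_mul_cancel₀ _ (hP0 u hs)).symm
  refine ⟨c, ?_, hc'⟩
  rintro rfl
  have hnt : Nontrivial (EuclideanSpace ℝ (Fin n)) :=
    Module.nontrivial_of_finrank_pos (R := ℝ) (by rw [finrank_euclideanSpace_fin]; omega)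
  obtain ⟨a, ha⟩ := exists_ne (0 : EuclideanSpace ℝ (Fin n))
  obtain ⟨x₀⟩ : Nonempty M := inferInstance
  have h1 := hF.pos ⟨x₀, a⟩ ha
  rw [hc' ⟨x₀, a⟩ ha, zero_mul] at h1
  exact h1.false

end SprayGeometry

/-! ### Stability of nondegeneracy, and functional dependence -/

lemma ContinuousLinearMap.eventually_injective_add_smul {A B : Type*} [NormedAddCommGroup A]
    [NormedSpace ℝ A] [FiniteDimensional ℝ A] [NormedAddCommGroup B] [NormedSpace ℝ B]
    (L : A →L[ℝ] B) (hL : Function.Injective L) (K : A →L[ℝ] B) :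
    ∀ᶠ ε in 𝓝 (0 : ℝ), Function.Injective (L + ε • K : A →L[ℝ] B) := by
  have h1 : Continuous fun ε : ℝ ↦ L + ε • K := by fun_prop
  refine h1.continuousAt.eventually (ContinuousLinearMap.isOpen_injective.mem_nhds ?_)
  simpa using hL

section FibreHessian

variable {V : Type*} [NormedAddCommGroup V] [NormedSpace ℝ V]

/-- The second derivative of a function on `V × V` along the second factor. -/
noncomputable def fibreHessian (g : V × V → ℝ) (p : V × V) : V →L[ℝ] V →L[ℝ] ℝ :=
  ((ContinuousLinearMap.compL ℝ V (V × V) ℝ).flip (ContinuousLinearMap.inr ℝ V V)).comp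
    ((fderiv ℝ (fderiv ℝ g) p).comp (ContinuousLinearMap.inr ℝ V V))

lemma fibreHessian_apply (g : V × V → ℝ) (p : V × V) (a b : V) :
    fibreHessian g p a b = fderiv ℝ (fderiv ℝ g) p (0, a) (0, b) := rfl

lemma continuousAt_fibreHessian {g : V × V → ℝ} {p : V × V} (hg : ContDiffAt ℝ ∞ g p) :
    ContinuousAt (fibreHessian g) p := by
  have h1 : ContDiffAt ℝ 1 (fderiv ℝ g) p :=
    hg.fderiv_right (by exact WithTop.coe_le_coe.2 (le_top : (1 + 1 : ℕ∞) ≤ ⊤))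
  have h2 : ContinuousAt (fderiv ℝ (fderiv ℝ g)) p :=
    (h1.fderiv_right (m := 0) (by simp)).continuousAt
  exact continuousAt_const.clm_comp (h2.clm_comp continuousAt_const)

lemma fibreHessian_add_smul {f g : V × V → ℝ} {p : V × V} (hf : ContDiffAt ℝ ∞ f p)
    (hg : ContDiffAt ℝ ∞ g p) (c : ℝ) :
    fibreHessian (fun q ↦ f q + c * g q) p = fibreHessian f p + c • fibreHessian g p := by
  have key : ∀ {k : V × V → ℝ}, ContDiffAt ℝ ∞ k p →
      (∀ᶠ q in 𝓝 p, DifferentiableAt ℝ k q) ∧ DifferentiableAt ℝ (fderiv ℝ k) p := by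
    intro k hk
    refine ⟨?_, (hk.fderiv_right (m := 1)
      (by exact WithTop.coe_le_coe.2 (le_top : (1 + 1 : ℕ∞) ≤ ⊤))).differentiableAt (by simp)⟩
    filter_upwards [(hk.of_le (m := 1) (by simp)).eventually (by simp)] with q hq
    exact hq.differentiableAt (by simp)
  have h1 : fderiv ℝ (fun q ↦ f q + c * g q) =ᶠ[𝓝 p] fun q ↦ fderiv ℝ f q + c • fderiv ℝ g q := by
    filter_upwards [(key hf).1, (key hg).1] with q hfq hgq
    exact (hfq.hasFDerivAt.add (hgq.hasFDerivAt.const_mul c)).fderiv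
  have h2 := ((key hf).2.hasFDerivAt.add
    ((key hg).2.hasFDerivAt.const_smul c)).congr_of_eventuallyEq h1
  ext a b
  rw [fibreHessian_apply, h2.fderiv]
  rfl

lemma eventually_injective_fibreHessian_add_mul [FiniteDimensional ℝ V] {f g : V × V → ℝ}
    {p : V × V} (hf : ContDiffAt ℝ ∞ f p) (hg : ContDiffAt ℝ ∞ g p)
    (h : Function.Injective (fibreHessian f p)) :
    ∀ᶠ ε in 𝓝 (0 : ℝ), Function.Injective (fibreHessian (fun q ↦ f q + ε * g q) p) := by
  filter_upwards [(fibreHessian f p).eventually_injective_add_smul h (fibreHessian g p)] with ε hε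
  rw [fibreHessian_add_smul hf hg]
  exact hε

lemma fderiv_fderiv_comp_fibre {g : V × V → ℝ} {x : V} {T : V →L[ℝ] V} {a : V}
    (hg : ContDiffAt ℝ ∞ g (x, T a)) (b c : V) :
    fderiv ℝ (fderiv ℝ fun w ↦ g (x, T w)) a b c = fibreHessian g (x, T a) (T b) (T c) := by
  have hT : ∀ w, HasFDerivAt (fun w ↦ (x, T w))
      ((ContinuousLinearMap.inr ℝ V V).comp T) w := by
    intro w
    refine ((hasFDerivAt_const x w).prodMk T.hasFDerivAt).congr_fderiv ?_
    ext <;> rfl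
  have h1 : ∀ᶠ w in 𝓝 a, DifferentiableAt ℝ g (x, T w) := by
    refine (hT a).continuousAt.eventually ?_
    filter_upwards [(hg.of_le (m := 1) (by simp)).eventually (by simp)] with q hq
    exact hq.differentiableAt (by simp)
  have h2 : (fderiv ℝ fun w ↦ g (x, T w)) =ᶠ[𝓝 a]
      fun w ↦ (fderiv ℝ g (x, T w)).comp ((ContinuousLinearMap.inr ℝ V V).comp T) := by
    filter_upwards [h1] with w hw
    exact (hw.hasFDerivAt.comp w (hT w)).fderiv
  have h3 : DifferentiableAt ℝ (fderiv ℝ g) (x, T a) := (hg.fderiv_right (m := 1)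
      (by exact WithTop.coe_le_coe.2 (le_top : (1 + 1 : ℕ∞) ≤ ⊤))).differentiableAt (by simp)
  have h4 : HasFDerivAt (fun w ↦ fderiv ℝ g (x, T w)) _ a := h3.hasFDerivAt.comp a (hT a)
  have h5 := (h4.clm_comp (hasFDerivAt_const ((ContinuousLinearMap.inr ℝ V V).comp T) a))
  rw [(h5.congr_of_eventuallyEq h2).fderiv]
  simp [fibreHessian_apply]

end FibreHessian

/-- If `f` is a function of `g` near `p`, then the kernel of `dg` is contained in that of `df`. -/
lemma fderiv_apply_eq_zero_of_eventuallyEq_comp {V : Type*} [NormedAddCommGroup V] [NormedSpace ℝ V]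
    [CompleteSpace V] {f g : V → ℝ} {p : V} (hf : ContDiffAt ℝ 1 f p) (hg : ContDiffAt ℝ 1 g p)
    (hg0 : fderiv ℝ g p ≠ 0) {φ : ℝ → ℝ} (h : f =ᶠ[𝓝 p] φ ∘ g) {v : V}
    (hv : fderiv ℝ g p v = 0) : fderiv ℝ f p v = 0 := by
  by_contra hfv
  obtain ⟨w, hw⟩ := DFunLike.ne_iff.1 hg0
  rw [_root_.zero_apply] at hw
  -- Since φ is arbitrary, no chain rule applies. If df(v) ≠ 0, then (g, f) is a submersion at p, so
  -- it maps neighbourhoods of p onto neighbourhoods of (g p, f p). These cannot lie in the graph of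
  -- φ.
  have h1 := (hg.hasStrictFDerivAt (by simp)).prodMk (hf.hasStrictFDerivAt (by simp))
  have h2 : ((fderiv ℝ g p).prod (fderiv ℝ f p)).range = ⊤ := by
    rw [LinearMap.range_eq_top]
    rintro ⟨a, b⟩
    refine ⟨(a / fderiv ℝ g p w) • w +
      ((b - a / fderiv ℝ g p w * fderiv ℝ f p w) / fderiv ℝ f p v) • v, ?_⟩
    refine Prod.ext ?_ ?_
    · simp [hv, div_mul_cancel₀ _ hw]
    · simp [div_mul_cancel₀ _ hfv]
  have h3 := h1.map_nhds_eq_of_surj h2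
  have h4 : ∀ᶠ q in 𝓝 (g p, f p), q.2 = φ q.1 := by
    rw [← h3]
    exact h
  have h5 : ∀ᶠ b in 𝓝 (f p), b = φ (g p) :=
    (Continuous.prodMk_right (g p)).continuousAt.eventually h4
  have h6 : ∀ᶠ b in 𝓝 (f p), b = f p := by
    filter_upwards [h5] with b hb
    rw [hb, ← h5.self_of_nhds]
  have h7 : ∀ᶠ b in 𝓝[≠] (f p), False := by
    filter_upwards [h6.filter_mono nhdsWithin_le_nhds, self_mem_nhdsWithin] with b hb hb'
    exact hb' hb
  exact (h7.exists).elim fun _ h ↦ h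

namespace SprayGeometry

variable {n : ℕ} {M : Type*} [TopologicalSpace M]
  [ChartedSpace (EuclideanSpace ℝ (Fin n)) M] [IsManifold (𝓡 n) ∞ M]
variable {f g : TM n M → ℝ} {u w : TM n M}

/-- The chart is linear and bijective on fibres, so the two Hessians are congruent. The chart
version depends continuously on the point, which makes regularity an open condition. -/
lemma isRegularAt_iff (hu : u ∈ (extChartAt (𝓡 n).tangent w).source)
    (hf : ContMDiffAt (𝓡 n).tangent 𝓘(ℝ, ℝ) ∞ f u) :
    IsRegularAt f u ↔ Function.Injective
      (fibreHessian (f ∘ (extChartAt (𝓡 n).tangent w).symm) (extChartAt (𝓡 n).tangent w u)) := by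
  have hb := mem_chart_source_iff.1 hu
  let T := tangentCoordChange (𝓡 n) u.proj w.proj u.proj
  have e1 : (fun a : EuclideanSpace ℝ (Fin n) ↦ f ⟨u.proj, a⟩) = fun a ↦
      (f ∘ (extChartAt (𝓡 n).tangent w).symm) (extChartAt (𝓡 n) w.proj u.proj, T a) :=
    congrArg (fun k ↦ f ∘ k) (fibre_eq (w := w) hb)
  have hc := contDiffAt_comp_extChartAt_symm hu le_rfl hf
  have e2 : extChartAt (𝓡 n).tangent w u = (extChartAt (𝓡 n) w.proj u.proj, T (vec u)) := rfl
  rw [e2] at hc ⊢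
  unfold IsRegularAt
  rw [e1, injective_iff_map_eq_zero]
  constructor
  · intro h a ha
    obtain ⟨a, rfl⟩ := tangentCoordChange_surjective hb a
    rw [h a fun b ↦ ?_, map_zero]
    rw [fderiv_fderiv_comp_fibre hc]
    exact congrArg (fun L : EuclideanSpace ℝ (Fin n) →L[ℝ] ℝ ↦ L (T b)) ha
  · intro h a ha
    refine (map_eq_zero_iff _ (tangentCoordChange_injective hb)).1 (h _ ?_)
    ext b
    obtain ⟨b, rfl⟩ := tangentCoordChange_surjective hb b
    rw [← fderiv_fderiv_comp_fibre hc]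
    exact ha b

lemma IsRegularAt.eventually
    (hf : ∀ᶠ v in 𝓝 u, ContMDiffAt (𝓡 n).tangent 𝓘(ℝ, ℝ) ∞ f v)
    (h : IsRegularAt f u) : ∀ᶠ v in 𝓝 u, IsRegularAt f v := by
  have hu := mem_extChartAt_source (I := (𝓡 n).tangent) u
  have h1 := (continuousAt_fibreHessian
    (contDiffAt_comp_extChartAt_symm hu le_rfl hf.self_of_nhds)).comp
    (continuousAt_extChartAt (I := (𝓡 n).tangent) u)
  have h2 := h1.eventually
    (ContinuousLinearMap.isOpen_injective.mem_nhds ((isRegularAt_iff hu hf.self_of_nhds).1 h))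
  filter_upwards [h2, extChartAt_source_mem_nhds (I := (𝓡 n).tangent) u, hf] with v hv hvs hvf
  exact (isRegularAt_iff hvs hvf).2 hv

lemma IsRegularAt.eventually_add_mul (hf : ContMDiffAt (𝓡 n).tangent 𝓘(ℝ, ℝ) ∞ f u)
    (hg : ContMDiffAt (𝓡 n).tangent 𝓘(ℝ, ℝ) ∞ g u) (h : IsRegularAt f u) :
    ∀ᶠ ε in 𝓝 (0 : ℝ), IsRegularAt (fun v ↦ f v + ε * g v) u := by
  have hu := mem_extChartAt_source (I := (𝓡 n).tangent) u
  filter_upwards [eventually_injective_fibreHessian_add_mul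
    (contDiffAt_comp_extChartAt_symm hu le_rfl hf) (contDiffAt_comp_extChartAt_symm hu le_rfl hg)
    ((isRegularAt_iff hu hf).1 h)] with ε hε
  exact (isRegularAt_iff hu (hf.add (contMDiffAt_const.mul hg))).2 hε

end SprayGeometry

/-! ### From F = cP to V_Hol = V_P: holonomy in metrizability freedom 1 -/

namespace SprayGeometry

variable {n : ℕ} {M : Type*} [TopologicalSpace M]
  [ChartedSpace (EuclideanSpace ℝ (Fin n)) M] [IsManifold (𝓡 n) ∞ M]
variable {S : ∀ u : TM n M, TTM u} {f g : TM n M → ℝ} {u w : TM n M}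

lemma diff_comp_extChartAt (hu : u ∈ (extChartAt (𝓡 n).tangent w).source)
    {k : EuclideanSpace ℝ (Fin n) × EuclideanSpace ℝ (Fin n) → ℝ}
    (hk : ContDiffAt ℝ ∞ k (extChartAt (𝓡 n).tangent w u)) (ξ : TTM u) :
    diff (k ∘ extChartAt (𝓡 n).tangent w) u ξ =
      fderiv ℝ k (extChartAt (𝓡 n).tangent w u) (chartDeriv (𝓡 n).tangent w u ξ) := by
  have h1 := (contMDiffAt_iff_contDiffAt.2 hk).mdifferentiableAt (by simp)
  have h2 := mfderiv_comp u h1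
    ((contMDiffAt_extChartAt_of_mem (I := (𝓡 n).tangent) hu).mdifferentiableAt (by simp))
  rw [mfderiv_eq_fderiv] at h2
  exact congrArg (fun L ↦ L ξ) h2

lemma diff_add (hf : ContMDiffAt (𝓡 n).tangent 𝓘(ℝ, ℝ) ∞ f u)
    (hg : ContMDiffAt (𝓡 n).tangent 𝓘(ℝ, ℝ) ∞ g u) (ξ : TTM u) :
    diff (fun v ↦ f v + g v) u ξ = diff f u ξ + diff g u ξ := by
  have h := (hf.mdifferentiableAt (by simp)).hasMFDerivAt.add
    (hg.mdifferentiableAt (by simp)).hasMFDerivAt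
  exact congrArg (fun L ↦ L ξ) h.mfderiv

lemma diff_add_const_mul_mul (hf : ContMDiffAt (𝓡 n).tangent 𝓘(ℝ, ℝ) ∞ f u)
    (hg : ContMDiffAt (𝓡 n).tangent 𝓘(ℝ, ℝ) ∞ g u) (c : ℝ) (ξ : TTM u) :
    diff (fun v ↦ f v + c * (f v * g v)) u ξ =
      diff f u ξ + c * (f u * diff g u ξ + g u * diff f u ξ) := by
  have h : ContMDiffAt (𝓡 n).tangent 𝓘(ℝ, ℝ) ∞ (fun v ↦ f v * g v) u := hf.mul hg
  have h' : ContMDiffAt (𝓡 n).tangent 𝓘(ℝ, ℝ) ∞ (fun v ↦ c * (f v * g v)) u :=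
    contMDiffAt_const.mul h
  rw [diff_add hf h', diff_const_mul h, diff_mul hf hg]

lemma finiteDimensional_TTM (u : TM n M) : FiniteDimensional ℝ (TTM u) :=
  inferInstanceAs (FiniteDimensional ℝ (EuclideanSpace ℝ (Fin n) × EuclideanSpace ℝ (Fin n)))

lemma finrank_TTM (u : TM n M) : Module.finrank ℝ (TTM u) = n + n := by
  have h : Module.finrank ℝ (EuclideanSpace ℝ (Fin n) × EuclideanSpace ℝ (Fin n)) = n + n := by
    simp
  exact h

lemma exists_holField_basis (S : ∀ u : TM n M, TTM u) (u : TM n M) :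
    ∃ Y : Fin (Module.finrank ℝ (Hol S u)) → ∀ v : TM n M, TTM v, (∀ i, IsHolField S (Y i)) ∧
      LinearIndependent ℝ fun i ↦ Y i u := by
  have := finiteDimensional_TTM u
  obtain ⟨f, hf, -, hli⟩ := Submodule.exists_fun_fin_finrank_span_eq ℝ
    {ξ | ∃ Y : ∀ u : TM n M, TTM u, IsHolField S Y ∧ Y u = ξ}
  choose Y hY hYf using hf
  refine ⟨Y, hY, ?_⟩
  exact (funext hYf : (fun i ↦ Y i u) = f) ▸ hli

/-- If the holonomy distribution and the Liouville field span a distribution of constant rank less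
than `2n`, then it has a local first integral. -/
lemma exists_first_integral_hol_liouville (hS : IsSpray S) {r : ℕ}
    (hr : ∀ v ∈ slit n M, Module.finrank ℝ (Hol S v) = r) (hrn : r + 1 < n + n) (hs : u ∈ slit n M)
    (hC : liouville u ∉ Hol S u) :
    ∃ θ : TM n M → ℝ, (∀ᶠ v in 𝓝 u, ContMDiffAt (𝓡 n).tangent 𝓘(ℝ, ℝ) ∞ θ v ∧
      (∀ ξ ∈ Hol S v, diff θ v ξ = 0) ∧ diff θ v (liouville v) = 0) ∧
      θ u = 0 ∧ diff θ u ≠ 0 := by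
  have hu := mem_extChartAt_source (I := (𝓡 n).tangent) u
  obtain ⟨Y, hY, hYli⟩ : ∃ Y : Fin r → ∀ v : TM n M, TTM v, (∀ i, IsHolField S (Y i)) ∧
      LinearIndependent ℝ fun i ↦ Y i u := by
    rw [← hr u hs]
    exact exists_holField_basis S u
  let e := extChartAt (𝓡 n).tangent u
  -- The frame of Hol + ℝC, with C at the index `none`.
  let Z : Option (Fin r) → ∀ v : TM n M, TTM v := fun o ↦ o.elim liouville Y
  let Zc : Option (Fin r) → EuclideanSpace ℝ (Fin n) × EuclideanSpace ℝ (Fin n) →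
    EuclideanSpace ℝ (Fin n) × EuclideanSpace ℝ (Fin n) := fun o ↦ coordField (𝓡 n).tangent u (Z o)
  have hZ : ∀ o, ∀ v ∈ slit n M, SmoothFieldAt (Z o) v := by
    rintro (_ | i) v hv
    · exact smoothFieldAt_liouville v
    · exact (hY i).isSmoothField.smoothFieldAt hv
  have hbr : ∀ o o', ∀ v ∈ slit n M, SprayGeometry.bracket (Z o) (Z o') v ∈ Hol S v := by
    have hCY : ∀ i, ∀ v ∈ slit n M, SprayGeometry.bracket liouville (Y i) v ∈ Hol S v :=
      fun i v hv ↦ (isHolCombination_bracket_liouville hS (hY i)).mem_Hol hv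
    rintro (_ | i) (_ | j) v hv
    · rw [show SprayGeometry.bracket (Z none) (Z none) v = 0 from
        congrFun VectorField.mlieBracket_self v]
      exact Submodule.zero_mem _
    · exact hCY j v hv
    · rw [bracket_swap]
      exact Submodule.neg_mem _ (hCY i v hv)
    · exact (IsHolCombination.bracket_holField (hY i) (.of_holField (hY j))).mem_Hol hv
  -- Constancy of the rank enters here: r independent values in Hol must span it, so the chosen
  -- fields remain a frame nearby and the brackets lie in their span.
  have hspan : ∀ v ∈ slit n M, LinearIndependent ℝ (fun i ↦ Y i v) →
      Submodule.span ℝ (range fun i ↦ Y i v) = Hol S v := by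
    intro v hv hli
    have := finiteDimensional_TTM v
    refine Submodule.eq_of_le_of_finrank_eq (Submodule.span_le.2 ?_) ?_
    · rintro _ ⟨i, rfl⟩
      exact Submodule.subset_span ⟨Y i, hY i, rfl⟩
    · rw [finrank_span_eq_card hli, hr v hv, Fintype.card_fin]
  have hnear : ∀ᶠ x in 𝓝 (e u), e.symm x ∈ slit n M ∧ x ∈ e.target :=
    eventually_of_forall_slit hu hs fun v hv ↦ hv
  have hsmooth : ∀ o, ∀ᶠ x in 𝓝 (e u), ContDiffAt ℝ ∞ (Zc o) x := by
    intro o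
    filter_upwards [hnear] with x hx
    have h := contDiffAt_coordField (e.map_target hx.2) (hZ o _ hx.1)
    rwa [e.right_inv hx.2] at h
  have hZcu : ∀ o, Zc o (e u) = chartDeriv (𝓡 n).tangent u u (Z o u) :=
    fun o ↦ coordField_apply hu (Z o)
  have hZli : LinearIndependent ℝ fun o ↦ Z o u := by
    rw [linearIndependent_option]
    refine ⟨hYli, ?_⟩
    have := hspan u hs hYli
    change liouville u ∉ Submodule.span ℝ (range fun i ↦ Y i u)
    rwa [this]
  have hli : LinearIndependent ℝ fun o ↦ Zc o (e u) := by
    simp only [hZcu]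
    exact hZli.map' (chartDeriv (𝓡 n).tangent u u).toLinearMap
      (LinearMap.ker_eq_bot.2 (chartDeriv_injective hu))
  have hlinear : ∀ᶠ x in 𝓝 (e u), LinearIndependent ℝ fun o ↦ Zc o x := by
    have hc : ContinuousAt (fun x o ↦ Zc o x) (e u) :=
      continuousAt_pi.2 fun o ↦ (hsmooth o).self_of_nhds.continuousAt
    exact hc.eventually (isOpen_setOfPred_linearIndependent.mem_nhds hli)
  have hYlin : ∀ x ∈ e.target, LinearIndependent ℝ (fun o ↦ Zc o x) →
      LinearIndependent ℝ fun i ↦ Y i (e.symm x) := by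
    intro x hx h
    exact (h.comp some (Option.some_injective _)).of_comp
      (chartDeriv (𝓡 n).tangent u (e.symm x)).toLinearMap
  have hZx : ∀ x ∈ e.target, ∀ o,
      chartDeriv (𝓡 n).tangent u (e.symm x) (Z o (e.symm x)) = Zc o x := fun _ _ _ ↦ rfl
  have hinvol : ∀ o o', ∀ᶠ x in 𝓝 (e u),
      VectorField.lieBracket ℝ (Zc o) (Zc o') x ∈ Submodule.span ℝ (range fun o ↦ Zc o x) := by
    intro o o'
    filter_upwards [hnear, hlinear] with x hx hlx
    have hb := chartDeriv_bracket (e.map_target hx.2) (hZ o _ hx.1) (hZ o' _ hx.1)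
    rw [e.right_inv hx.2] at hb
    change _ = VectorField.lieBracket ℝ (Zc o) (Zc o') x at hb
    rw [← hb]
    have h1 := hbr o o' _ hx.1
    rw [← hspan _ hx.1 (hYlin x hx.2 hlx)] at h1
    have h2 := Submodule.mem_map_of_mem
      (f := (chartDeriv (𝓡 n).tangent u (e.symm x)).toLinearMap) h1
    rw [Submodule.map_span] at h2
    refine Submodule.span_mono ?_ h2
    rintro _ ⟨_, ⟨i, rfl⟩, rfl⟩
    exact ⟨some i, rfl⟩
  obtain ⟨θ, hθ, hθu⟩ :=
    exists_first_integral_of_involutive Zc hsmooth hli (by simpa using hrn) hinvol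
  -- Normalized to vanish at u, so that E(1 + εθ) equals E there and is positive nearby.
  let k := fun x ↦ θ x - θ (e u)
  have hk : ∀ x, fderiv ℝ k x = fderiv ℝ θ x := fun x ↦ fderiv_sub_const _
  refine ⟨k ∘ e, ?_, sub_self _, ?_⟩
  · have h1 := (continuousAt_extChartAt (I := (𝓡 n).tangent) u).eventually (hθ.and hlinear)
    filter_upwards [h1, extChartAt_source_mem_nhds (I := (𝓡 n).tangent) u,
      isOpen_slit.mem_nhds hs] with v hv hvs hsl
    have hkv : ContDiffAt ℝ ∞ k (e v) := hv.1.1.sub contDiffAt_const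
    have hZv : ∀ o, diff (k ∘ e) v (Z o v) = 0 := by
      intro o
      refine (diff_comp_extChartAt hvs hkv _).trans ?_
      rw [hk, ← coordField_apply hvs]
      exact hv.1.2 o
    refine ⟨contMDiffAt_comp_extChartAt hvs hkv, ?_, hZv none⟩
    have h2 := hYlin (e v) (e.map_source hvs) hv.2
    rw [e.left_inv hvs] at h2
    have h3 : Hol S v ≤ LinearMap.ker (diff (k ∘ e) v) := by
      rw [← hspan v hsl h2, Submodule.span_le]
      rintro _ ⟨i, rfl⟩
      exact hZv (some i)
    exact fun ξ hξ ↦ h3 hξ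
  · intro h0
    refine hθu ?_
    refine ContinuousLinearMap.ext fun x ↦ ?_
    have h1 := diff_comp_extChartAt hu (hθ.self_of_nhds.1.sub (contDiffAt_const (c := θ (e u))))
      (ofCoordField (𝓡 n).tangent u (fun _ ↦ x) u)
    rw [chartDeriv_ofCoordField hu] at h1
    rw [← hk]
    refine h1.symm.trans ?_
    exact DFunLike.congr_fun h0 _

/-- If the metrizability freedom is `1`, then the kernel of the differential of an energy function
is determined by the spray. -/
lemma HasMetrizabilityFreedom.exists_ker_le (h : HasMetrizabilityFreedom S 1) (hs : u ∈ slit n M) :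
    ∃ e : TM n M → ℝ, e u ≠ 0 ∧ diff e u (liouville u) = 2 * e u ∧
      ∀ W : Set (TM n M), IsOpen W → u ∈ W → W ⊆ slit n M → ∀ f, IsEnergyFunctionOn S f W →
        ∀ ξ, diff e u ξ = 0 → diff f u ξ = 0 := by
  obtain ⟨U, hUo, huU, -, E, hE, -, hφ⟩ := h u hs
  have hu := mem_extChartAt_source (I := (𝓡 n).tangent) u
  refine ⟨E 0, ((hE 0).pos u huU).ne', (hE 0).homogeneous u huU, fun W hW huW hWs f hf ξ hξ ↦ ?_⟩
  obtain ⟨W', hW', huW', -, φ, hφ⟩ := hφ W hW huW hWs f hf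
  have h1 := ContMDiffOn.contMDiffAt (hE 0).smooth (hUo.mem_nhds huU)
  have h2 := ContMDiffOn.contMDiffAt hf.smooth (hW.mem_nhds huW)
  have e1 : ∀ ξ, diff (E 0) u ξ = _ := realDeriv_eq_fderiv hu (h1.mdifferentiableAt (by simp))
  have e2 : ∀ ξ, diff f u ξ = _ := realDeriv_eq_fderiv hu (h2.mdifferentiableAt (by simp))
  rw [e1] at hξ
  rw [e2]
  refine fderiv_apply_eq_zero_of_eventuallyEq_comp (φ := fun t ↦ φ fun _ ↦ t)
    ((contDiffAt_comp_extChartAt_symm hu le_rfl h2).of_le (by simp))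
    ((contDiffAt_comp_extChartAt_symm hu le_rfl h1).of_le (by simp)) (fun h0 ↦ ?_) ?_ hξ
  · have h3 := (hE 0).homogeneous u huU
    rw [e1, h0] at h3
    have h4 := (hE 0).pos u huU
    have h5 : (0 : ℝ) = 2 * E 0 u := h3
    linarith
  · have hc :=
      (contMDiffAt_extChartAt_symm ((extChartAt (𝓡 n).tangent u).map_source hu)).continuousAt
    have h3 := hc.eventually_mem (s := W') (by
      rw [(extChartAt (𝓡 n).tangent u).left_inv hu]; exact hW'.mem_nhds huW')
    filter_upwards [h3] with x hx
    refine (hφ _ hx).trans (congrArg φ ?_)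
    funext i
    rw [Subsingleton.elim i 0]
    rfl

/-- Multiplying an energy function by `1 + ε θ`, where `θ` is a first integral of the holonomy
distribution and of the Liouville field, yields an energy function. -/
lemma exists_isEnergyFunctionOn_perturbation {E θ : TM n M → ℝ}
    (hE : IsEnergyFunctionOn S E (slit n M)) (hs : u ∈ slit n M)
    (hθ : ∀ᶠ v in 𝓝 u, ContMDiffAt (𝓡 n).tangent 𝓘(ℝ, ℝ) ∞ θ v ∧
      (∀ ξ ∈ Hol S v, diff θ v ξ = 0) ∧ diff θ v (liouville v) = 0) (hθu : θ u = 0) :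
    ∃ ε : ℝ, ε ≠ 0 ∧ ∃ W : Set (TM n M), IsOpen W ∧ u ∈ W ∧ W ⊆ slit n M ∧
      IsEnergyFunctionOn S (fun v ↦ E v + ε * (E v * θ v)) W := by
  have hEs : ∀ v ∈ slit n M, ContMDiffAt (𝓡 n).tangent 𝓘(ℝ, ℝ) ∞ E v :=
    fun v hv ↦ hE.smooth.contMDiffAt hv
  have hr := (hE.regular u hs).eventually_add_mul (hEs u hs)
    ((hEs u hs).mul hθ.self_of_nhds.1)
  -- A small ε keeps the fibre Hessian nondegenerate at the single point u, and openness of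
  -- regularity then extends this to a neighbourhood. The conclusion needs ε ≠ 0 to recover dθ.
  obtain ⟨ε, hε, hε0⟩ := ((hr.filter_mono nhdsWithin_le_nhds).and
    (self_mem_nhdsWithin : {(0 : ℝ)}ᶜ ∈ 𝓝[≠] (0 : ℝ))).exists
  let E' : TM n M → ℝ := fun v ↦ E v + ε * (E v * θ v)
  have hs' : ∀ᶠ v in 𝓝 u, v ∈ slit n M := isOpen_slit.mem_nhds hs
  have hsm : ∀ᶠ v in 𝓝 u, ContMDiffAt (𝓡 n).tangent 𝓘(ℝ, ℝ) ∞ E' v := by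
    filter_upwards [hθ, hs'] with v hv hvs
    exact (hEs v hvs).add (contMDiffAt_const.mul ((hEs v hvs).mul hv.1))
  have hreg : ∀ᶠ v in 𝓝 u, IsRegularAt E' v := IsRegularAt.eventually hsm hε
  have hpos : ∀ᶠ v in 𝓝 u, 0 < E' v := by
    refine hsm.self_of_nhds.continuousAt.eventually (lt_mem_nhds ?_)
    simpa [E', hθu] using hE.pos u hs
  obtain ⟨W, hW, hWo, huW⟩ := eventually_nhds_iff.1 (((hθ.and hs').and hsm).and (hreg.and hpos))
  refine ⟨ε, hε0, W, hWo, huW, fun v hv ↦ (hW v hv).1.1.2, ?_⟩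
  have hd : ∀ v ∈ W, ∀ ξ, diff E' v ξ =
      diff E v ξ + ε * (E v * diff θ v ξ + θ v * diff E v ξ) := by
    intro v hv ξ
    have hθv := (hW v hv).1.1.1.1
    have hEv := hEs v (hW v hv).1.1.2
    exact diff_add_const_mul_mul hEv hθv ε ξ
  refine ⟨fun v hv ↦ (hW v hv).1.2.contMDiffWithinAt, fun v hv ↦ (hW v hv).2.2, fun v hv ↦ ?_,
    fun v hv ↦ (hW v hv).2.1, fun v hv ξ hξ ↦ ?_⟩
  · refine (hd v hv _).trans ?_
    rw [(hW v hv).1.1.1.2.2, hE.homogeneous v (hW v hv).1.1.2]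
    ring
  · refine (hd v hv _).trans ?_
    rw [(hW v hv).1.1.1.2.1 ξ hξ, hE.holInvariant v (hW v hv).1.1.2 ξ hξ]
    ring

/-- The holonomy distribution of a spray of metrizability freedom `1` is the kernel of the
differential of every energy function. -/
lemma hol_eq_ker_diff (hS : IsSpray S) (hreg : HolRegular S) (hfree : HasMetrizabilityFreedom S 1)
    {E : TM n M → ℝ} (hE : IsEnergyFunctionOn S E (slit n M)) (hs : u ∈ slit n M) :
    Hol S u = LinearMap.ker (diff E u) := by
  have := finiteDimensional_TTM u
  obtain ⟨r, hr⟩ := hreg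
  have hEu := hE.pos u hs
  have hle : Hol S u ≤ LinearMap.ker (diff E u) := fun ξ hξ ↦ hE.holInvariant u hs ξ hξ
  have hCE := hE.homogeneous u hs
  have hne : diff E u ≠ 0 := by
    intro h0
    rw [h0, LinearMap.zero_apply] at hCE
    linarith
  have hker := Module.Dual.finrank_ker_add_one_of_ne_zero hne
  rw [finrank_TTM] at hker
  -- The kernel has rank 2n - 1. If r is smaller, then r + 1 < 2n, which leaves room for a first
  -- integral of Hol + ℝC.
  refine Submodule.eq_of_le_of_finrank_le hle ?_
  rw [hr u hs]
  by_contra! hlt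
  have hC : liouville u ∉ Hol S u := by
    intro hC
    rw [hE.holInvariant u hs _ hC] at hCE
    linarith
  obtain ⟨θ, hθ, hθu, hθ0⟩ := exists_first_integral_hol_liouville hS hr (by omega) hs hC
  obtain ⟨ε, hε, W, hWo, huW, hWs, hE'⟩ := exists_isEnergyFunctionOn_perturbation hE hs hθ hθu
  obtain ⟨e, he, hCe, hker'⟩ := hfree.exists_ker_le hs
  have hθs := hθ.self_of_nhds
  have hEs := hE.smooth.contMDiffAt hs
  refine hθ0 (LinearMap.ext fun ξ ↦ ?_)
  -- The projection of ξ along C to ker de. Both E and E(1 + εθ) have differentials vanishing on η,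
  -- so dθ(η) = 0, and dθ(C) = 0 gives dθ(ξ) = 0.
  let η := ξ - (diff e u ξ / (2 * e u)) • liouville u
  have hη : diff e u η = 0 := by
    rw [map_sub, map_smul, hCe, smul_eq_mul, div_mul_cancel₀ _ (by simpa using he), sub_self]
  have h1 := hker' _ isOpen_slit hs le_rfl E hE η hη
  have h2 := hker' _ hWo huW hWs _ hE' η hη
  rw [diff_add_const_mul_mul hEs hθs.1, h1] at h2
  have h3 : diff θ u η = 0 := by
    simpa [hε, hEu.ne'] using h2
  rwa [map_sub, map_smul, hθs.2.2, smul_zero, sub_zero] at h3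

/-- Since dE = F dF = cF dP with cF nonzero, Hol = ker dE = ker dP. Intersecting with V gives V_P by
`VP_eq`. -/
lemma VHol_eq_VP_of_eq_const_mul [T2Space M] (hS : IsSpray S) (hreg : HolRegular S)
    (hfree : HasMetrizabilityFreedom S 1) {F P : TM n M → ℝ} (hF : IsFinsler F)
    (hFS : IsGeodesicSprayOf S F) (hP : SmoothFunOn P (slit n M)) (hP0 : ∀ u ∈ slit n M, P u ≠ 0)
    (hP1 : IsHomogeneousOne P) {c : ℝ} (hc : c ≠ 0) (h : ∀ u ∈ slit n M, F u = c * P u)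
    (hs : u ∈ slit n M) : VHol S u = VP S P u := by
  rw [VP_eq hS hP hP0 hP1 hs, VHol,
    hol_eq_ker_diff hS hreg hfree (isEnergyFunctionOn_energy hS hF hFS) hs, inf_comm]
  congr 1
  ext ξ
  rw [LinearMap.mem_ker, LinearMap.mem_ker, diff_energy hF hs, diff_congr_slit h hs,
    diff_const_mul (hP.contMDiffAt hs)]
  simp [hc, (hF.pos u hs).ne']

end SprayGeometry

end

theorem mainTheorem2 {n : ℕ} (hn : 2 ≤ n) {M : Type*} [TopologicalSpace M] [T2Space M]
    [ConnectedSpace M] [ChartedSpace (EuclideanSpace ℝ (Fin n)) M] [IsManifold (𝓡 n) ∞ M]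
    (S : ∀ u : SprayGeometry.TM n M, SprayGeometry.TTM u) (hS : SprayGeometry.IsSpray S)
    (hreg : SprayGeometry.HolRegular S)
    (hfree : SprayGeometry.HasMetrizabilityFreedom S 1)
    (F : SprayGeometry.TM n M → ℝ) (hF : SprayGeometry.IsFinsler F)
    (hFS : SprayGeometry.IsGeodesicSprayOf S F)
    (P : SprayGeometry.TM n M → ℝ) (hP : SprayGeometry.SmoothFunOn P (SprayGeometry.slit n M))
    (hP0 : ∀ u ∈ SprayGeometry.slit n M, P u ≠ 0)
    (hP1 : SprayGeometry.IsHomogeneousOne P) (hPS : SprayGeometry.IsInvariant S P) :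
    (∀ u ∈ SprayGeometry.slit n M, SprayGeometry.VHol S u = SprayGeometry.VP S P u) ↔
      ∃ c : ℝ, c ≠ 0 ∧ ∀ u ∈ SprayGeometry.slit n M, F u = c * P u := by
  refine ⟨SprayGeometry.exists_eq_const_mul_of_VHol_eq_VP hn hS hF hFS hP hP0 hP1 hPS, ?_⟩
  rintro ⟨c, hc, h⟩ u hu
  exact SprayGeometry.VHol_eq_VP_of_eq_const_mul hS hreg hfree hF hFS hP hP0 hP1 hc h hu
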